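/- **Conventions.** All algorithms and adversaries are uniform quantum polynomial-time (QPT) algorithms; $\lambda$ is the security parameter, given in unary to every algorithm; a function is negligible if it tends to $0$ faster than every inverse polynomial. A *digital signature scheme* $\mathsf{DSig}=(\mathsf{Gen},\mathsf{Sign},\mathsf{Vrfy})$ for arbitrary messages consists of efficient algorithms with classical inputs and outputs, $(sk,vk)\leftarrow\mathsf{Gen}(1^\lambda)$, $\sigma\leftarrow\mathsf{Sign}(sk,m)$, $\mathsf{Vrfy}(vk,m,\sigma)\in\{\top,\bot\}$. It is *post-quantum (unforgeable)* if every QPT adversary that is given $vk$ and classical access to the oracle $\mathsf{Sign}(sk,\cdot)$ outputs only with negligible probability a pair $(m,\sigma)$ such that $\mathsf{Vrfy}(vk,m,\sigma)=\top$ and $m$ was not queried. A *DS-SKL scheme* (signature scheme with secure key leasing) $S$ with message space $\mathcal M_\lambda=\{0,1\}^{\ell(\lambda)}$ consists of efficient algorithms $\mathsf{Setup}(1^\lambda,q)\to(msk,ssk,svk)$ ($q$ a collusion bound, or $\bot$ if there is none), $\mathsf{KG}(msk)\to(\mathbf{sk},vk)$ with a quantum leased key $\mathbf{sk}$ (possibly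 with a classical part), $\mathsf{Eval}(\mathbf{sk},m)\to\sigma$, $\mathsf{Del}(\mathbf{sk})\to cert$ and $\mathsf{Vrfy}(vk,cert)\in\{\top,\bot\}$ with classical $cert$, $\mathsf{Sign}(ssk,m)\to\sigma$, and $\mathsf{SigVrfy}(svk,m,\sigma)\in\{\top,\bot\}$. No correctness property is needed. The message space is of super-polynomial size: $2^{-\ell(\lambda)}$ is negligible. *Standard-KLA experiment* (unbounded, with parameter $\epsilon$). The challenger samples $(msk,ssk,svk)\leftarrow\mathsf{Setup}(1^\lambda,\bot)$ and sends $svk$ to the adversary, who replies with a number $q$ (in unary). The challenger samples $(\mathbf{sk}_i,vk_i)\leftarrow\mathsf{KG}(msk)$ for $i\in[q]$ and sends $(\mathbf{sk}_i)_{i\in[q]}$. The adversary outputs certificates $cert_1,\dots,cert_q$ and a quantum program $P^*=(U,\rho)$, that is, a classical description of a unitary circuit $U$ and a state $\rho$. The adversary wins if $\mathsf{Vrfy}(vk_i,cert_i)=\top$ for all $i$ and $P^*$ is tested to be $\epsilon$-good. This test is the following. Let $M$ be the effect (POVM element) on the register of $\rho$ of the event that, for uniform $m\leftarrow\mathcal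 M_\lambda$, running $U$ on $m$, the register, and zero ancillas and then measuring the output qubits gives $y$ with $\mathsf{SigVrfy}(svk,m,y)=\top$. Measure $\rho$ with the projective implementation of $(M,1-M)$, that is, in the eigenspaces of $M$, and accept if the measured eigenvalue is at least $\epsilon$. The scheme has *unbounded standard-KLA security* if for every QPT adversary and every $\epsilon=1/\mathrm{poly}(\lambda)$ the winning probability is negligible. It has *$1$-bounded standard-KLA security* if this holds for the experiment in which $q=1$ is fixed and $\mathsf{Setup}(1^\lambda,1)$ is run. **Compiled scheme.** Given a DS-SKL scheme $\widetilde S$ and a digital signature scheme $\mathsf{DSig}$, define a DS-SKL scheme with the message space of $\widetilde S$: - $\mathsf{Setup}(1^\lambda,\cdot)$: sample $(sk,vk)\leftarrow\mathsf{DSig.Gen}(1^\lambda)$; output $msk=(sk,vk)$, $ssk=sk$, $svk=vk$. - $\mathsf{KG}(msk)$: sample $(\widetilde{msk},\widetilde{ssk},\widetilde{svk})\leftarrow\widetilde{\mathsf{Setup}}(1^\lambda,1)$, $(\widetilde{\mathbf{sk}},\widetilde{vk})\leftarrow\widetilde{\mathsf{KG}}(\widetilde{msk})$, $s\leftarrow\mathsf{DSig.Sign}(sk,\widetilde{svk})$;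 output the leased key $(\widetilde{\mathbf{sk}},\widetilde{svk},s)$ and the verification key $\widetilde{vk}$. - $\mathsf{Eval}((\widetilde{\mathbf{sk}},\widetilde{svk},s),m)$: output $(\widetilde\sigma,\widetilde{svk},s)$ with $\widetilde\sigma\leftarrow\widetilde{\mathsf{Eval}}(\widetilde{\mathbf{sk}},m)$. - $\mathsf{Del}((\widetilde{\mathbf{sk}},\widetilde{svk},s))=\widetilde{\mathsf{Del}}(\widetilde{\mathbf{sk}})$, $\mathsf{Vrfy}=\widetilde{\mathsf{Vrfy}}$, $\mathsf{Sign}=\mathsf{DSig.Sign}$. - $\mathsf{SigVrfy}(vk,m,\sigma)$: output $\top$ if $\mathsf{DSig.Vrfy}(vk,m,\sigma)=\top$; otherwise output $\top$ if $\sigma$ is of the form $(\widetilde\sigma,\widetilde{svk},s)$ with $\mathsf{DSig.Vrfy}(vk,\widetilde{svk},s)=\top$ and $\widetilde{\mathsf{SigVrfy}}(\widetilde{svk},m,\widetilde\sigma)=\top$; otherwise output $\bot$. **Theorem.** If $\widetilde S$ has $1$-bounded standard-KLA security and $\mathsf{DSig}$ is post-quantum unforgeable, then the compiled scheme has unbounded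 standard-KLA security. -/

import Mathlib

open scoped Polynomial

namespace SKL

/-! ### Classical data: finite binary trees (the finite strings of the formalization) -/

/-- Classical data. Bits are `nil` and `node nil nil`, lists are right combs, numbers are written in
unary as lists of `nil`, so that `Data.ofNat n` plays the role of the string `1^n`. -/
inductive Data : Type where
  | nil : Data
  | node (l r : Data) : Data

namespace Data

/-- Number of inner nodes. -/
def size : Data → ℕ
  | nil => 0
  | node l r => l.size + r.size + 1

def fst : Data → Data
  | nil => nil
  | node l _ => l

def snd : Data → Data
  | nil => nil
  | node _ r => r

def isNil : Data → Bool
  | nil => true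
  | node _ _ => false

/-- Length of a list; also the value of a unary number. -/
def len : Data → ℕ
  | nil => 0
  | node _ r => r.len + 1

def toList : Data → List Data
  | nil => []
  | node x r => x :: r.toList

def ofList : List Data → Data
  | [] => nil
  | x :: xs => node x (ofList xs)

def ofNat (n : ℕ) : Data := ofList (List.replicate n nil)

def ofBool : Bool → Data
  | false => nil
  | true => node nil nil

def ofBits (x : List Bool) : Data := ofList (x.map ofBool)

/-- A collusion bound, with `none` for the unbounded case. -/
def ofBound : Option ℕ → Data
  | none => nil
  | some q => node nil (ofNat q)

/-- The prefix code of trees as bit strings: `0` for `nil`, and `1` followed by both subtrees. -/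
def bits : Data → List Bool
  | nil => [false]
  | node l r => true :: (l.bits ++ r.bits)

/-- Reads one tree off a bit string, and returns the unread rest. The first argument bounds the
depth of the recursion; missing bits count as `0`. -/
def parse : ℕ → List Bool → Data × List Bool
  | 0, x => (nil, x)
  | _ + 1, [] => (nil, [])
  | _ + 1, false :: x => (nil, x)
  | k + 1, true :: x =>
    (node (parse k x).1 (parse k (parse k x).2).1, (parse k (parse k x).2).2)

/-- The tree that a bit string starts with; bits after its code are ignored. -/
def ofCode (x : List Bool) : Data := (parse x.length x).1

theorem parse_bits (d : Data) :
    ∀ (k : ℕ) (x : List Bool), d.bits.length ≤ k → parse k (d.bits ++ x) = (d, x) := by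
  induction d with
  | nil =>
    intro k x h
    cases k with
    | zero => simp [bits] at h
    | succ k => simp [bits, parse]
  | node l r hl hr =>
    intro k x h
    cases k with
    | zero => simp [bits] at h
    | succ k =>
      simp only [bits, List.length_cons, List.length_append] at h
      simp only [bits, List.cons_append, List.append_assoc, parse]
      rw [hl k _ (by omega)]
      simp only
      rw [hr k _ (by omega)]

theorem ofCode_bits (d : Data) (x : List Bool) : ofCode (d.bits ++ x) = d := by
  rw [ofCode, parse_bits d _ x (by simp)]

end Data

/-! ### Weighted sums

Classical-quantum states are finite formal sums with complex coefficients. A mixed state of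
qubits `∑ ρ_{k,b} |k⟩⟨b|` is the formal sum of the pairs `(k, b)` with coefficients `ρ_{k,b}`,
and a classical value that was obtained on the way is a further component of the index. A
probability distribution is the special case without qubits. All physical operations are linear
in the state, so they are determined by their action on the indices, and are composed by
`bind`. -/

/-- Finite formal complex combinations of elements of `α`. -/
def Wt (α : Type) : Type := α →₀ ℂ

namespace Wt

noncomputable instance (α : Type) : AddCommGroup (Wt α) := inferInstanceAs (AddCommGroup (α →₀ ℂ))

noncomputable instance (α : Type) : Module ℂ (Wt α) := inferInstanceAs (Module ℂ (α →₀ ℂ))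

noncomputable instance : Monad Wt where
  pure a := Finsupp.single a 1
  bind x f := Finsupp.sum x fun a c => c • f a

/-- The coefficient of `a`. -/
def coeff {α : Type} (x : Wt α) (a : α) : ℂ := Finsupp.toFun x a

/-- The indices with a nonzero coefficient. -/
def supp {α : Type} (x : Wt α) : Finset α := Finsupp.support x

/-- The entrywise complex conjugate. -/
noncomputable def conj {α : Type} (x : Wt α) : Wt α :=
  Finsupp.mapRange (starRingEnd ℂ) (map_zero _) x

/-- The probability of the outcome `true`. -/
noncomputable def prTrue (x : Wt Bool) : ℝ := (x.coeff true).re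

end Wt

/-! ### Qubits and gates -/

/-- An index `|ket⟩⟨bra|` of the state of a list of qubits. -/
structure Reg : Type where
  ket : List Bool
  bra : List Bool

namespace Reg

/-- No qubits. -/
def empty : Reg := ⟨[], []⟩

/-- Number of qubits. -/
def len (r : Reg) : ℕ := r.ket.length

/-- Both sides speak about the same number of qubits. -/
def Square (r : Reg) : Prop := r.ket.length = r.bra.length

def append (r s : Reg) : Reg := ⟨r.ket ++ s.ket, r.bra ++ s.bra⟩

def take (k : ℕ) (r : Reg) : Reg := ⟨r.ket.take k, r.bra.take k⟩

def drop (k : ℕ) (r : Reg) : Reg := ⟨r.ket.drop k, r.bra.drop k⟩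

end Reg

/-- Hadamard gate, `π/8` gate and controlled-not gate. -/
inductive Gate : Type where
  | had (i : ℕ) : Gate
  | tee (i : ℕ) : Gate
  | cnot (i j : ℕ) : Gate

/-- Every datum is read as a gate; data of no use are read as `cnot 0 0`, which is the identity. -/
def Gate.ofData : Data → Gate
  | .node .nil i => .had i.len
  | .node (.node .nil .nil) i => .tee i.len
  | .node _ (.node i j) => .cnot i.len j.len
  | _ => .cnot 0 0

/-- Action on a computational basis vector. A gate that points to a missing qubit, or a
controlled-not gate whose control is its target, does nothing. -/
noncomputable def Gate.apply : Gate → List Bool → Wt (List Bool)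
  | .had i, x =>
    match x[i]? with
    | none => pure x
    | some b =>
      ((1 / Real.sqrt 2 : ℝ) : ℂ) • (pure (x.set i false) : Wt (List Bool)) +
        (((if b then -1 else 1) / Real.sqrt 2 : ℝ) : ℂ) • (pure (x.set i true) : Wt (List Bool))
  | .tee i, x =>
    match x[i]? with
    | some true => Complex.exp (Real.pi / 4 * Complex.I) • (pure x : Wt (List Bool))
    | _ => pure x
  | .cnot i j, x =>
    if i ≠ j ∧ x[i]? = some true then pure (x.modify j not) else pure x

/-- `ρ ↦ U ρ U†` for a gate `U`. -/
noncomputable def Gate.conjugate (g : Gate) (r : Reg) : Wt Reg := do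
  let k ← g.apply r.ket
  let b ← (g.apply r.bra).conj
  pure ⟨k, b⟩

/-- Application of a sequence of gates to a computational basis vector. -/
noncomputable def runCircuit : List Gate → List Bool → Wt (List Bool)
  | [], x => pure x
  | g :: gs, x => do
    let y ← g.apply x
    runCircuit gs y

/-! ### Quantum polynomial time

The machine model is a small language with classical control, for programs that hold one classical
datum and a list of qubits. Every instruction costs one step plus the size of the data that it
reads and writes. The only loops run over a list that is known when the loop starts; this is no loss
for computations in polynomial time. A finite program works for all security parameters, so the
model is uniform. -/

inductive Prog : Type where
  /-- the constant `nil` -/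
  | nil : Prog
  /-- the datum itself -/
  | id : Prog
  /-- projections -/
  | fst : Prog
  | snd : Prog
  /-- the size of the datum, in unary -/
  | size : Prog
  /-- the number of qubits, in unary -/
  | numQ : Prog
  /-- first `P`, then `Q` on the outcome -/
  | comp (P Q : Prog) : Prog
  /-- first `P`, then `Q` on the same datum, and the pair of both outcomes -/
  | pair (P Q : Prog) : Prog
  /-- on `node c d`: if `c` is `nil` then `P` on `d`, otherwise `Q` on `d` -/
  | cond (P Q : Prog) : Prog
  /-- on `node c d`: for each entry `x` of the list `c` in turn, replace `d` by the outcome of `P` on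
  `node x d` -/
  | fold (P : Prog) : Prog
  /-- append a qubit in the state `|0⟩` if the datum is `nil`, and `|1⟩` otherwise -/
  | newQ : Prog
  /-- apply the gate that the datum describes -/
  | gate : Prog
  /-- cyclic renumbering of the qubits: the datum says how many move from the front to the end -/
  | rotate : Prog
  /-- measure the qubit with the given number, remove it, and return the bit -/
  | measure : Prog
  /-- on `node k d`: run `P` on `d` with the last `k` qubits as its only qubits -/
  | frame (P : Prog) : Prog
  /-- put the datum as a classical query to the oracle, and return the answer -/
  | query : Prog

/-- The outcome of a run: datum, qubits, list of oracle queries in their order, and number of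
steps. -/
structure Out : Type where
  data : Data
  reg : Reg
  log : List Data
  time : ℕ

/-- Continues a run after `o`. -/
noncomputable def Out.andThen (o : Out) (x : Wt Out) : Wt Out := do
  let o' ← x
  pure ⟨o'.data, o'.reg, o.log ++ o'.log, o.time + o'.time⟩

/-- Adds a number of steps. -/
noncomputable def tick (t : ℕ) (x : Wt Out) : Wt Out := do
  let o ← x
  pure ⟨o.data, o.reg, o.log, o.time + t⟩

/-- The loop of `Prog.fold` with body `f`. -/
noncomputable def foldData (f : Data → Reg → Wt Out) : Data → Data → Reg → Wt Out
  | .nil, d, r => pure ⟨d, r, [], 0⟩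
  | .node x c, d, r => do
    let o ← f (.node x d) r
    o.andThen (foldData f c o.data o.reg)

/-- Measurement, in the computational basis, of qubit `i`, which is removed: the entries of the state
with different bits in `ket` and `bra` vanish. A missing qubit gives `nil`. -/
noncomputable def measureReg (i : ℕ) (r : Reg) : Wt (Data × Reg) :=
  match r.ket[i]?, r.bra[i]? with
  | some x, some y =>
    if x = y then pure (Data.ofBool x, ⟨r.ket.eraseIdx i, r.bra.eraseIdx i⟩) else 0
  | _, _ => pure (.nil, r)

/-- Semantics of programs that run with the (randomized) classical oracle `O`. -/
noncomputable def Prog.eval (O : Data → Wt Data) : Prog → Data → Reg → Wt Out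
  | .nil, d, r => pure ⟨.nil, r, [], d.size + 1⟩
  | .id, d, r => pure ⟨d, r, [], d.size + 1⟩
  | .fst, d, r => pure ⟨d.fst, r, [], d.size + 1⟩
  | .snd, d, r => pure ⟨d.snd, r, [], d.size + 1⟩
  | .size, d, r => pure ⟨Data.ofNat d.size, r, [], d.size + 1⟩
  | .numQ, d, r => pure ⟨Data.ofNat r.len, r, [], d.size + r.len + 1⟩
  | .comp P Q, d, r => do
    let o ← P.eval O d r
    o.andThen (Q.eval O o.data o.reg)
  | .pair P Q, d, r => tick (d.size + 1) do
    let o ← P.eval O d r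
    o.andThen do
      let o' ← Q.eval O d o.reg
      pure { o' with data := .node o.data o'.data }
  | .cond P Q, d, r => tick (d.size + 1)
    (if d.fst.isNil then P.eval O d.snd r else Q.eval O d.snd r)
  | .fold P, d, r => tick (d.size + 1) (foldData (P.eval O) d.fst d.snd r)
  | .newQ, d, r =>
    pure ⟨d, r.append ⟨[!d.isNil], [!d.isNil]⟩, [], d.size + 1⟩
  | .gate, d, r => do
    let r' ← (Gate.ofData d).conjugate r
    pure ⟨d, r', [], d.size + 1⟩
  | .rotate, d, r =>
    pure ⟨d, ⟨r.ket.rotate d.len, r.bra.rotate d.len⟩, [], d.size + 1⟩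
  | .measure, d, r => do
    let x ← measureReg d.len r
    pure ⟨x.1, x.2, [], d.size + 1⟩
  | .frame P, d, r => tick (d.size + 1) do
    let o ← P.eval O d.snd (r.drop (r.len - d.fst.len))
    pure { o with reg := (r.take (r.len - d.fst.len)).append o.reg }
  | .query, d, r => do
    let a ← O d
    pure ⟨a, r, [d], d.size + a.size + 1⟩

/-- The oracle that always answers `nil`; programs that run with it have no oracle. -/
noncomputable def noOracle : Data → Wt Data := fun _ => pure .nil

/-- Outcome of a program without oracle: a datum and the final state of all qubits. -/
noncomputable def Prog.exec (P : Prog) (d : Data) (r : Reg) : Wt (Data × Reg) := do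
  let o ← P.eval noOracle d r
  pure (o.data, o.reg)

open Classical in
/-- The index contributes to the trace. -/
noncomputable def traceOut (r : Reg) : Wt Unit := if r.ket = r.bra then pure () else 0

/-- Classical outcome of a program without oracle; its final qubits are traced out. -/
noncomputable def Prog.run (P : Prog) (d : Data) (r : Reg) : Wt Data := do
  let x ← P.exec d r
  traceOut x.2
  pure x.1

/-- Worst case polynomial running time without oracle, in the size of the classical input and the
number of input qubits. A program with this property is a QPT algorithm. -/
def Prog.PolyTime (P : Prog) : Prop :=
  ∃ p : ℕ[X], ∀ (d : Data) (r : Reg), r.Square →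
    ∀ o ∈ (P.eval noOracle d r).supp, o.time ≤ p.eval (d.size + r.len)

/-! ### Digital signatures -/

/-- A digital signature scheme for arbitrary messages: `gen n` returns `(sk, vk)`, `sign n sk m`
a signature, and `vrfy n vk m σ` is `true` for acceptance. All of them may be randomized. The
argument `n` is the security parameter. -/
structure DigSig : Type where
  gen : ℕ → Wt (Data × Data)
  sign : ℕ → Data → Data → Wt Data
  vrfy : ℕ → Data → Data → Data → Wt Bool

/-- All algorithms of the scheme are computed by polynomial time programs. -/
structure DigSig.Efficient (D : DigSig) : Prop where
  gen : ∃ P : Prog, P.PolyTime ∧ ∀ n,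
    P.run (.ofNat n) .empty = do
      let k ← D.gen n
      pure (.node k.1 k.2)
  sign : ∃ P : Prog, P.PolyTime ∧ ∀ n sk m,
    P.run (.node (.ofNat n) (.node sk m)) .empty = D.sign n sk m
  vrfy : ∃ P : Prog, P.PolyTime ∧ ∀ n vk m σ,
    P.run (.node (.ofNat n) (.node vk (.node m σ))) .empty = do
      let b ← D.vrfy n vk m σ
      pure (.ofBool b)

/-- A QPT forger with classical access to the signing oracle of `D`. -/
structure Forger (D : DigSig) : Type where
  prog : Prog
  polyTime : ∃ p : ℕ[X], ∀ n sk vk,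
    ∀ o ∈ (prog.eval (D.sign n sk) (.node (.ofNat n) vk) .empty).supp,
      o.time ≤ p.eval (n + sk.size + vk.size)

open Classical in
/-- The forgery experiment: the forger has to sign a message that it did not query. -/
noncomputable def DigSig.forgeExp (D : DigSig) (B : Forger D) (n : ℕ) : Wt Bool := do
  let k ← D.gen n
  let o ← B.prog.eval (D.sign n k.1) (.node (.ofNat n) k.2) .empty
  traceOut o.reg
  let b ← D.vrfy n k.2 o.data.fst o.data.snd
  pure (b && decide (o.data.fst ∉ o.log))

/-- Negligible functions of the security parameter. -/
def Negligible (f : ℕ → ℝ) : Prop :=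
  Asymptotics.SuperpolynomialDecay Filter.atTop (fun n : ℕ => (n : ℝ)) f

/-- Unforgeability under chosen message attacks by quantum polynomial time adversaries. -/
def DigSig.PostQuantum (D : DigSig) : Prop :=
  ∀ B : Forger D, Negligible fun n => (D.forgeExp B n).prTrue

/-! ### Signatures with secure key leasing -/

/-- The algorithms of a signature scheme with secure key leasing. The message space is the set of
bit strings of length `msgLen n`. `setup n q` returns `(msk, ssk, svk)`, where `q` is the collusion
bound (`none` if there is none); the leased function is given by `ssk`, and the public auxiliary
information is `svk`. A leased key is a state of qubits together with a classical part.
`keyGen n msk` returns a verification key and a leased key, `eval` a signature and the leased key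
that is left, `del` a certificate. -/
structure DSSKL : Type where
  msgLen : ℕ → ℕ
  setup : ℕ → Option ℕ → Wt (Data × Data × Data)
  keyGen : ℕ → Data → Wt (Data × Data × Reg)
  eval : ℕ → Data × Reg → Data → Wt (Data × Data × Reg)
  del : ℕ → Data × Reg → Wt Data
  vrfy : ℕ → Data → Data → Wt Bool
  sign : ℕ → Data → Data → Wt Data
  sigVrfy : ℕ → Data → Data → Data → Wt Bool

/-- All algorithms of the scheme are computed by polynomial time programs. -/
structure DSSKL.Efficient (S : DSSKL) : Prop where
  msgLen : ∃ P : Prog, P.PolyTime ∧ ∀ n,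
    P.run (.ofNat n) .empty = pure (.ofNat (S.msgLen n))
  setup : ∃ P : Prog, P.PolyTime ∧ ∀ n q,
    P.run (.node (.ofNat n) (.ofBound q)) .empty = do
      let k ← S.setup n q
      pure (.node k.1 (.node k.2.1 k.2.2))
  keyGen : ∃ P : Prog, P.PolyTime ∧ ∀ n msk,
    P.exec (.node (.ofNat n) msk) .empty = do
      let k ← S.keyGen n msk
      pure (.node k.1 k.2.1, k.2.2)
  eval : ∃ P : Prog, P.PolyTime ∧ ∀ n c r m, r.Square →
    P.exec (.node (.ofNat n) (.node c m)) r = do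
      let k ← S.eval n (c, r) m
      pure (.node k.1 k.2.1, k.2.2)
  del : ∃ P : Prog, P.PolyTime ∧ ∀ n c r, r.Square →
    P.run (.node (.ofNat n) c) r = S.del n (c, r)
  vrfy : ∃ P : Prog, P.PolyTime ∧ ∀ n vk cert,
    P.run (.node (.ofNat n) (.node vk cert)) .empty = do
      let b ← S.vrfy n vk cert
      pure (.ofBool b)
  sign : ∃ P : Prog, P.PolyTime ∧ ∀ n ssk m,
    P.run (.node (.ofNat n) (.node ssk m)) .empty = S.sign n ssk m
  sigVrfy : ∃ P : Prog, P.PolyTime ∧ ∀ n svk m σ,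
    P.run (.node (.ofNat n) (.node svk (.node m σ))) .empty = do
      let b ← S.sigVrfy n svk m σ
      pure (.ofBool b)

/-! ### Quantum programs and the test for goodness -/

/-- Classical description of the unitary part of a quantum program: a circuit, the list of the
qubits that carry its output, and a number of ancilla qubits. -/
structure QProgram : Type where
  gates : List Gate
  outs : List ℕ
  anc : ℕ

/-- Every datum is read as a program. -/
def QProgram.ofData (d : Data) : QProgram :=
  ⟨d.fst.toList.map Gate.ofData, d.snd.fst.toList.map Data.len, d.snd.snd.len⟩

/-- The state before the final measurement when the circuit runs on the message `m`, a basis state `x`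
of the program's own qubits, and ancilla qubits in the state `|0⟩`. -/
noncomputable def QProgram.final (U : QProgram) (m x : List Bool) : Wt (List Bool) :=
  runCircuit U.gates (m ++ x ++ List.replicate U.anc false)

/-- The datum that a measurement outcome `z` of all qubits stands for. -/
def QProgram.output (U : QProgram) (z : List Bool) : Data :=
  .ofCode (U.outs.map fun i => z.getD i false)

/-- The effect (POVM element) on `k` program qubits of the event that the program, when run on a
uniformly random message `m` of length `l`, has an output `y` that is accepted, where `acc m y`
is the probability with which `y` is accepted for `m`. -/
noncomputable def QProgram.effect (U : QProgram) (l : ℕ) (acc : Data → Data → ℝ) (k : ℕ) :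
    Matrix (Fin k → Bool) (Fin k → Bool) ℂ :=
  Matrix.of fun i j =>
    (1 / 2 ^ l : ℂ) * ∑ m : Fin l → Bool, ∑ z : Fin (l + k + U.anc) → Bool,
      (starRingEnd ℂ) ((U.final (List.ofFn m) (List.ofFn i)).coeff (List.ofFn z)) *
        (acc (.ofBits (List.ofFn m)) (U.output (List.ofFn z)) : ℂ) *
        (U.final (List.ofFn m) (List.ofFn j)).coeff (List.ofFn z)

open Classical in
/-- The spectral projection of a Hermitian matrix to its eigenvalues that are at least `t`. -/
noncomputable def spectralProj {ι : Type} [Fintype ι] [DecidableEq ι] (E : Matrix ι ι ℂ) (t : ℝ) :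
    Matrix ι ι ℂ :=
  cfc (fun p : ℝ => if t ≤ p then (1 : ℝ) else 0) E

open Classical in
/-- The two-outcome measurement `{Π, 1 - Π}`: the trace against `|ket⟩⟨bra|` of both parts. -/
noncomputable def projTest (r : Reg)
    (proj : Matrix (Fin r.len → Bool) (Fin r.len → Bool) ℂ) : Wt Bool :=
  if r.Square then
    (proj (fun i => r.bra.getD i false) (fun i => r.ket.getD i false)) • (pure true : Wt Bool) +
      ((1 - proj) (fun i => r.bra.getD i false) (fun i => r.ket.getD i false)) •
        (pure false : Wt Bool)
  else 0

/-- The test whether the quantum program `(U, ρ)` is `ε`-good for signing under `svk`, where `r` is an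
index of `ρ`: apply to `ρ` the projective implementation of the experiment in which the program is
run on a random message and its output is checked with `sigVrfy`, and accept if the measured
success probability is at least `0 + ε`. -/
noncomputable def DSSKL.goodTest (S : DSSKL) (n : ℕ) (svk : Data) (ε : ℝ) (U : QProgram) (r : Reg) :
    Wt Bool :=
  projTest r (spectralProj
    (U.effect (S.msgLen n) (fun m y => (S.sigVrfy n svk m y).prTrue) r.len) (0 + ε))

/-! ### Key leasing attacks -/

/-- Generates `q` leased keys independently. Returns the verification keys, the list of the classical
parts of the leased keys with their numbers of qubits, and all qubits of the leased keys. -/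
noncomputable def DSSKL.leaseKeys (S : DSSKL) (n : ℕ) (msk : Data) :
    ℕ → Wt (List Data × List Data × Reg)
  | 0 => pure ([], [], .empty)
  | q + 1 => do
    let (vk, c, r) ← S.keyGen n msk
    let (vks, cs, rs) ← S.leaseKeys n msk q
    pure (vk :: vks, .node c (.ofNat r.len) :: cs, r.append rs)

/-- Every verification key accepts the certificate at its place. -/
noncomputable def DSSKL.vrfyAll (S : DSSKL) (n : ℕ) : List Data → List Data → Wt Bool
  | [], _ => pure true
  | _ :: _, [] => pure false
  | vk :: vks, cert :: certs => do
    let b ← S.vrfy n vk cert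
    let b' ← S.vrfyAll n vks certs
    pure (b && b')

/-- A QPT adversary in two stages; it keeps a classical datum and qubits between them. -/
structure KLAdversary : Type where
  first : Prog
  second : Prog
  first_polyTime : first.PolyTime
  second_polyTime : second.PolyTime

/-- The experiment for standard key leasing attacks. In the first stage the adversary gets `svk`, and
returns a number `q` of leased keys; for a bounded experiment the number of keys is the given
bound, which is also an input of `setup`. In the second stage the adversary gets the leased keys, and
returns certificates and a quantum program. The outcome is `true` if all certificates are valid and
the program is tested to be `ε`-good. -/
noncomputable def DSSKL.stdKLAExp (S : DSSKL) (bound : Option (ℕ → ℕ)) (A : KLAdversary) (ε : ℝ)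
    (n : ℕ) : Wt Bool := do
  let (msk, _, svk) ← S.setup n (bound.map fun b => b n)
  let (a, st) ← A.first.exec (.node (.ofNat n) svk) .empty
  let q := match bound with
    | none => a.fst.len
    | some b => b n
  let (vks, cs, keys) ← S.leaseKeys n msk q
  let (out, ρ) ← A.second.exec (.node (.ofNat n) (.node a.snd (.ofList cs))) (st.append keys)
  let valid ← S.vrfyAll n vks out.fst.toList
  let good ← S.goodTest n svk ε (.ofData out.snd) ρ
  pure (valid && good)

/-- Standard-KLA security: for every QPT adversary and every inverse polynomial `ε` the adversary
succeeds with negligible probability only. -/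
def DSSKL.StdKLASecure (S : DSSKL) (bound : Option (ℕ → ℕ)) : Prop :=
  ∀ (A : KLAdversary) (p : ℕ[X]), (∀ n, 0 < p.eval n) →
    Negligible fun n => (S.stdKLAExp bound A (1 / ((p.eval n : ℕ) : ℝ)) n).prTrue

/-- Unbounded standard-KLA security: the adversary chooses the number of keys. -/
def DSSKL.UnboundedStdKLA (S : DSSKL) : Prop := S.StdKLASecure none

/-- Standard-KLA security for a number of keys that is fixed in advance. -/
def DSSKL.BoundedStdKLA (S : DSSKL) (q : ℕ → ℕ) : Prop := S.StdKLASecure (some q)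

/-! ### The compiler -/

/-- The compiled scheme: every leased key consists of a leased key of a fresh instance of `S`, the
signature verification key of this instance, and a signature of `D` on the latter. -/
noncomputable def compile (S : DSSKL) (D : DigSig) : DSSKL where
  msgLen := S.msgLen
  setup n _ := do
    let (sk, vk) ← D.gen n
    pure (.node sk vk, sk, vk)
  keyGen n msk := do
    let (msk', _, svk') ← S.setup n (some 1)
    let (vk', c', r) ← S.keyGen n msk'
    let s ← D.sign n msk.fst svk'
    pure (vk', .node c' (.node svk' s), r)
  eval n key m := do
    let (σ, c', r) ← S.eval n (key.1.fst, key.2) m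
    pure (.node σ key.1.snd, .node c' key.1.snd, r)
  del n key := S.del n (key.1.fst, key.2)
  vrfy n vk cert := S.vrfy n vk cert
  sign n sk m := D.sign n sk m
  sigVrfy n vk m σ := do
    let b ← D.vrfy n vk m σ
    if b then pure true
    else
      match σ with
      | .node σ' (.node svk' s) => do
        let b₁ ← D.vrfy n vk svk' s
        let b₂ ← S.sigVrfy n svk' m σ'
        pure (b₁ && b₂)
      | _ => pure false

end SKL

/-!
A program that signs a random message for the compiled scheme with noticeable probability has to do
one of the following. It makes a signature by `D` of the message, or it makes a signature by `D` of
the verification key `svk` of an instance of `S`, together with a signature of the message by this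
instance. If what `D` signs was not signed in the leased keys, this is a forgery. The message is one
of the at most `Q` signed verification keys with probability at most `Q / 2 ^ ℓ`. What remains is
that the program signs the message for one of the leased instances of `S`, although the deletion
certificate for this instance is valid.

The test of the program is a spectral measurement, and the effects of these events need not commute
with the effect that is tested, so the comparison is made between positive operators. Let `E` be the effect of
acceptance by the compiled scheme, `Eᵢ` that of acceptance by the instance number `i`, where the
program outputs the first component of its signature only, and let `Π` and `Πᵢ` be the spectral
projections of `E` and `Eᵢ` to the eigenvalues that are at least `ε` and `ε'`. Then

* `ε Π ≤ E`, as `E ≥ 0` (`posSemidef_sub_smul_spectralProj`),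
* `E ≤ F + F' + (Q / 2 ^ ℓ) + ∑ Eᵢ` with the effects `F` and `F'` of both kinds of forgeries
  (`posForm_effect_compile`),
* `Eᵢ ≤ Πᵢ + ε'`, as `Eᵢ ≤ 1` (`posSemidef_spectralProj_add_sub`).

In expectation over the attack (`prTrue_stdKLAExp_compile_le`), `ε` times the success probability is
at most the sum of the success probabilities of two forgers (`exists_forger_message`,
`exists_forger_key`), of `Q / 2 ^ ℓ + Q ε'`, and of `2 Q ^ 2` times the success probability of an
adversary against a single instance, which puts its instance at a random place among the leased keys
(`exists_reduction`); the place is the right one with probability at least `1 / (2 Q)`, and there are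
at most `Q` places. To make the whole bound small against `1 / n ^ k`, the threshold `ε'` is chosen as
an inverse polynomial that depends on `k`.

Passing from operators to expectations needs that the state after the attack is positive. States are
formal sums of `|ket⟩⟨bra|`, and programs are interpreted by linear extension (`Wt.ex`, `wp`), so
positivity is a theorem about programs, which is proved with Kraus operators (`kraus_wp`,
`wp_re_nonneg`). The reductions have to be programs as well, with polynomial running time. They are
built from closure properties of three classes: deterministic functions (`Det`), operations on qubits
(`Act`), and generation of new qubits (`Gen`). For the latter two, a program realizes a procedure if
both have the same expectations.
-/

namespace SKL

/-! ### Expectations over weighted sums -/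

namespace Wt

variable {α β γ : Type}

/-- The linear extension of `φ` to formal sums: the expectation of `φ`. -/
noncomputable def ex (x : Wt α) (φ : α → ℂ) : ℂ :=
  Finsupp.sum (M := ℂ) x fun a c => c * φ a

theorem ex_eq_sum (x : Wt α) (φ : α → ℂ) : x.ex φ = ∑ a ∈ x.supp, x.coeff a * φ a := rfl

theorem mem_supp {x : Wt α} {a : α} : a ∈ x.supp ↔ x.coeff a ≠ 0 :=
  Finsupp.mem_support_iff (f := x)

theorem ex_eq_sum_of_subset (x : Wt α) (φ : α → ℂ) {s : Finset α} (h : x.supp ⊆ s) :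
    x.ex φ = ∑ a ∈ s, x.coeff a * φ a := by
  rw [ex_eq_sum]
  refine Finset.sum_subset h fun a _ ha => ?_
  rw [mem_supp, not_not] at ha
  rw [ha, zero_mul]

@[simp] theorem ex_zero (φ : α → ℂ) : (0 : Wt α).ex φ = 0 :=
  Finsupp.sum_zero_index (h := fun a c => c * φ a)

@[simp] theorem ex_pure (a : α) (φ : α → ℂ) : (pure a : Wt α).ex φ = φ a := by
  change Finsupp.sum (Finsupp.single a (1 : ℂ)) _ = _
  rw [Finsupp.sum_single_index] <;> simp

@[simp] theorem ex_add (x y : Wt α) (φ : α → ℂ) : (x + y).ex φ = x.ex φ + y.ex φ :=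
  Finsupp.sum_add_index' (h := fun a c => c * φ a) (by simp) (by intros; ring)

@[simp] theorem ex_smul (c : ℂ) (x : Wt α) (φ : α → ℂ) : (c • x).ex φ = c * x.ex φ := by
  refine (Finsupp.sum_smul_index (b := c) (g := x) (h := fun a c => c * φ a) (by simp)).trans ?_
  simp only [mul_assoc]
  exact (Finset.mul_sum _ _ _).symm

@[simp] theorem ex_bind (x : Wt α) (f : α → Wt β) (φ : β → ℂ) :
    (x >>= f).ex φ = x.ex fun a => (f a).ex φ := by
  have h : ∀ s : Finset α, ∀ c : α → ℂ,
      ex (∑ a ∈ s, c a • f a) φ = ∑ a ∈ s, c a * (f a).ex φ := by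
    classical
    intro s c
    induction s using Finset.induction_on with
    | empty => simp
    | insert a s ha ih => rw [Finset.sum_insert ha, Finset.sum_insert ha, ex_add, ex_smul, ih]
  exact h _ _

theorem ex_congr {x : Wt α} {φ ψ : α → ℂ} (h : ∀ a ∈ x.supp, φ a = ψ a) : x.ex φ = x.ex ψ := by
  rw [ex_eq_sum, ex_eq_sum]
  exact Finset.sum_congr rfl fun a ha => by rw [h a ha]

@[simp] theorem ex_const_zero (x : Wt α) : (x.ex fun _ => 0) = 0 := by simp [ex_eq_sum]

theorem ex_add_right (x : Wt α) (φ ψ : α → ℂ) :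
    (x.ex fun a => φ a + ψ a) = x.ex φ + x.ex ψ := by
  simp [ex_eq_sum, mul_add, Finset.sum_add_distrib]

theorem ex_sub_right (x : Wt α) (φ ψ : α → ℂ) :
    (x.ex fun a => φ a - ψ a) = x.ex φ - x.ex ψ := by
  simp [ex_eq_sum, mul_sub, Finset.sum_sub_distrib]

theorem ex_mul_left (x : Wt α) (c : ℂ) (φ : α → ℂ) :
    (x.ex fun a => c * φ a) = c * x.ex φ := by
  simp [ex_eq_sum, Finset.mul_sum, mul_left_comm]

theorem ex_sum_right {ι : Type*} (x : Wt α) (s : Finset ι) (φ : ι → α → ℂ) :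
    (x.ex fun a => ∑ i ∈ s, φ i a) = ∑ i ∈ s, x.ex (φ i) := by
  simp only [ex_eq_sum, Finset.mul_sum]
  rw [Finset.sum_comm]

theorem ex_comm (x : Wt α) (y : Wt β) (φ : α → β → ℂ) :
    (x.ex fun a => y.ex fun b => φ a b) = y.ex fun b => x.ex fun a => φ a b := by
  simp only [ex_eq_sum, Finset.mul_sum]
  rw [Finset.sum_comm]
  exact Finset.sum_congr rfl fun a _ => Finset.sum_congr rfl fun b _ => by ring

open Classical in
theorem coeff_eq_ex (x : Wt α) (a : α) : x.coeff a = x.ex fun b => if b = a then 1 else 0 := by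
  simp only [ex_eq_sum, mul_ite, mul_one, mul_zero, Finset.sum_ite_eq']
  split_ifs with h
  · rfl
  · rwa [mem_supp, not_not] at h

theorem ext_ex {x y : Wt α} (h : ∀ φ, x.ex φ = y.ex φ) : x = y := by
  refine Finsupp.ext fun a => ?_
  change x.coeff a = y.coeff a
  rw [coeff_eq_ex, coeff_eq_ex, h]

theorem coeff_conj (x : Wt α) (a : α) : x.conj.coeff a = starRingEnd ℂ (x.coeff a) :=
  Finsupp.mapRange_apply (hf := map_zero (starRingEnd ℂ)) (f := starRingEnd ℂ) (g := x)

theorem supp_conj (x : Wt α) : x.conj.supp = x.supp := by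
  ext a
  rw [mem_supp, mem_supp, coeff_conj]
  simp

theorem ex_conj (x : Wt α) (φ : α → ℂ) :
    x.conj.ex φ = starRingEnd ℂ (x.ex fun a => starRingEnd ℂ (φ a)) := by
  simp [ex_eq_sum, supp_conj, coeff_conj]

@[simp] theorem conj_zero : (0 : Wt α).conj = 0 := ext_ex fun φ => by simp [ex_conj]

@[simp] theorem conj_pure (a : α) : (pure a : Wt α).conj = pure a :=
  ext_ex fun φ => by simp [ex_conj]

theorem conj_smul (c : ℂ) (x : Wt α) : (c • x).conj = starRingEnd ℂ c • x.conj :=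
  ext_ex fun φ => by simp [ex_conj]

theorem conj_bind (x : Wt α) (f : α → Wt β) : (x >>= f).conj = x.conj >>= fun a => (f a).conj :=
  ext_ex fun φ => by simp [ex_conj]

theorem coeff_bind (x : Wt α) (f : α → Wt β) (b : β) :
    (x >>= f).coeff b = x.ex fun a => (f a).coeff b := by
  rw [coeff_eq_ex, ex_bind]
  exact congrArg _ (funext fun a => (coeff_eq_ex _ _).symm)

open Classical in
theorem coeff_pure (a b : α) : (pure a : Wt α).coeff b = if a = b then 1 else 0 := by
  rw [coeff_eq_ex, ex_pure]

theorem coeff_add (x y : Wt α) (a : α) : (x + y).coeff a = x.coeff a + y.coeff a := rfl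

theorem coeff_smul (c : ℂ) (x : Wt α) (a : α) : (c • x).coeff a = c * x.coeff a := rfl

@[simp] theorem mem_supp_pure {a b : α} : b ∈ (pure a : Wt α).supp ↔ b = a := by
  classical
  rw [mem_supp, coeff_pure]
  simp [eq_comm]

@[simp] theorem not_mem_supp_zero (a : α) : a ∉ (0 : Wt α).supp := by
  rw [mem_supp]
  exact not_not.2 rfl

/-- Weights may cancel in a sequential composition, so that there is no converse. -/
theorem exists_of_mem_supp_bind {x : Wt α} {f : α → Wt β} {b : β} (h : b ∈ (x >>= f).supp) :
    ∃ a ∈ x.supp, b ∈ (f a).supp := by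
  by_contra! hc
  rw [mem_supp, coeff_bind] at h
  refine h ((ex_congr fun a ha => ?_).trans (ex_const_zero x))
  have := hc a ha
  rwa [mem_supp, not_not] at this

theorem mem_or_of_mem_supp_add {x y : Wt α} {a : α} (h : a ∈ (x + y).supp) :
    a ∈ x.supp ∨ a ∈ y.supp := by
  simp only [mem_supp, coeff_add] at *
  by_contra! hc
  exact h (by rw [hc.1, hc.2, add_zero])

theorem mem_of_mem_supp_smul {c : ℂ} {x : Wt α} {a : α} (h : a ∈ (c • x).supp) : a ∈ x.supp := by
  simp only [mem_supp, coeff_smul] at *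
  exact right_ne_zero_of_mul h

theorem prTrue_eq (x : Wt Bool) : x.prTrue = (x.ex fun b => if b then 1 else 0).re := by
  rw [prTrue, coeff_eq_ex]
  exact congrArg Complex.re (ex_congr fun b _ => by cases b <;> simp)

/-- A formal sum with nonnegative real coefficients of total weight one. -/
structure IsDist (x : Wt α) : Prop where
  re_nonneg : ∀ a, 0 ≤ (x.coeff a).re
  im_eq_zero : ∀ a, (x.coeff a).im = 0
  total : (x.ex fun _ => 1) = 1

theorem IsDist.ex_re_nonneg {x : Wt α} (hx : x.IsDist) {φ : α → ℂ}
    (h : ∀ a ∈ x.supp, 0 ≤ (φ a).re) : 0 ≤ (x.ex φ).re := by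
  rw [ex_eq_sum, Complex.re_sum]
  refine Finset.sum_nonneg fun a ha => ?_
  rw [Complex.mul_re, hx.im_eq_zero, zero_mul, sub_zero]
  exact mul_nonneg (hx.re_nonneg a) (h a ha)

theorem IsDist.ex_re_le {x : Wt α} (hx : x.IsDist) {φ ψ : α → ℂ}
    (h : ∀ a ∈ x.supp, (φ a).re ≤ (ψ a).re) : (x.ex φ).re ≤ (x.ex ψ).re := by
  have := hx.ex_re_nonneg (φ := fun a => ψ a - φ a) fun a ha => by
    simpa using h a ha
  rw [ex_sub_right] at this
  simpa using this

/-- A random bit is determined by its probability of `true`. -/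
theorem IsDist.ex_bool {x : Wt Bool} (hx : x.IsDist) (φ : Bool → ℂ) :
    x.ex φ = x.prTrue * φ true + (1 - x.prTrue) * φ false := by
  have h1 : ∀ φ : Bool → ℂ, x.ex φ = x.coeff true * φ true + x.coeff false * φ false := by
    intro φ
    rw [ex_eq_sum_of_subset x φ (Finset.subset_univ _)]
    simp
  have h2 : (x.prTrue : ℂ) = x.coeff true :=
    Complex.ext rfl (by simpa using (hx.im_eq_zero true).symm)
  have h3 := hx.total
  rw [h1] at h3
  rw [h1, h2]
  linear_combination (φ false) * h3

theorem IsDist.prTrue_nonneg {x : Wt Bool} (hx : x.IsDist) : 0 ≤ x.prTrue :=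
  hx.re_nonneg true

theorem IsDist.prTrue_le_one {x : Wt Bool} (hx : x.IsDist) : x.prTrue ≤ 1 := by
  rw [prTrue_eq]
  have := hx.ex_re_le (φ := fun b => if b then 1 else 0) (ψ := fun _ => 1) (by
    intro b _; cases b <;> simp)
  rwa [hx.total, Complex.one_re] at this

end Wt
end SKL

namespace SKL

/-! ### Registers and gates -/

namespace Reg

@[simp] theorem append_empty (r : Reg) : r.append empty = r := by
  simp [append, empty]

@[simp] theorem empty_append (r : Reg) : empty.append r = r := by
  simp [append, empty]

theorem append_assoc (r s t : Reg) : (r.append s).append t = r.append (s.append t) := by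
  simp [append]

theorem Square.append {r s : Reg} (hr : r.Square) (hs : s.Square) : (r.append s).Square := by
  simp only [Square, Reg.append, List.length_append] at *
  omega

theorem Square.take {r : Reg} (hr : r.Square) (k : ℕ) : (r.take k).Square := by
  simp only [Square, Reg.take, List.length_take] at *
  omega

theorem Square.drop {r : Reg} (hr : r.Square) (k : ℕ) : (r.drop k).Square := by
  simp only [Square, Reg.drop, List.length_drop] at *
  omega

theorem square_empty : empty.Square := rfl

@[simp] theorem len_append (r s : Reg) : (r.append s).len = r.len + s.len := by
  simp [append, len]

@[simp] theorem len_empty : empty.len = 0 := rfl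

theorem drop_len {r : Reg} (hr : r.Square) : r.drop r.len = empty := by
  have h : r.bra.length ≤ r.len := hr.ge
  simp [drop, empty, len] at *
  exact h

theorem take_len {r : Reg} (hr : r.Square) : r.take r.len = r := by
  have h : r.bra.length ≤ r.len := hr.ge
  cases r
  simp [take, len] at *
  exact h

end Reg

namespace Gate

/-- The two phases of a Hadamard gate. -/
noncomputable def sgn (b : Bool) : ℂ := if b then -1 else 1

theorem ex_apply_had (i : ℕ) (x : List Bool) (b : Bool) (h : x[i]? = some b)
    (φ : List Bool → ℂ) :
    ((had i).apply x).ex φ =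
      ((1 / Real.sqrt 2 : ℝ) : ℂ) * (φ (x.set i false) + sgn b * φ (x.set i true)) := by
  simp only [apply, h, Wt.ex_add, Wt.ex_smul, Wt.ex_pure, sgn]
  cases b <;> simp <;> ring

theorem ex_conj_apply_had (i : ℕ) (x : List Bool) (b : Bool) (h : x[i]? = some b)
    (φ : List Bool → ℂ) :
    ((had i).apply x).conj.ex φ =
      ((1 / Real.sqrt 2 : ℝ) : ℂ) * (φ (x.set i false) + sgn b * φ (x.set i true)) := by
  rw [Wt.ex_conj, ex_apply_had i x b h]
  simp only [map_mul, map_add, Complex.conj_conj, Complex.conj_ofReal]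
  cases b <;> simp [sgn]

theorem apply_had_none (i : ℕ) (x : List Bool) (h : x[i]? = none) : (had i).apply x = pure x := by
  simp only [apply, h]

theorem apply_cnot (i j : ℕ) (x : List Bool) :
    (cnot i j).apply x = pure (if i ≠ j ∧ x[i]? = some true then x.modify j not else x) := by
  simp only [apply]
  split_ifs <;> rfl

theorem apply_tee (i : ℕ) (x : List Bool) :
    (tee i).apply x =
      (if x[i]? = some true then Complex.exp (Real.pi / 4 * Complex.I) else 1) •
        (pure x : Wt (List Bool)) := by
  by_cases h : x[i]? = some true
  · simp [apply, h]
  · rw [if_neg h, one_smul]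
    simp only [apply]

theorem length_of_mem_supp_apply (g : Gate) (x y : List Bool) (h : y ∈ (g.apply x).supp) :
    y.length = x.length := by
  cases g with
  | had i =>
    rcases hx : x[i]? with _ | b
    · rw [apply_had_none i x hx, Wt.mem_supp_pure] at h
      rw [h]
    · simp only [apply, hx] at h
      rcases Wt.mem_or_of_mem_supp_add h with h | h <;>
      · have h := Wt.mem_of_mem_supp_smul h
        rw [Wt.mem_supp_pure] at h
        simp [h]
  | tee i =>
    rw [apply_tee] at h
    have h := Wt.mem_of_mem_supp_smul h
    rw [Wt.mem_supp_pure] at h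
    rw [h]
  | cnot i j =>
    rw [apply_cnot, Wt.mem_supp_pure] at h
    rw [h]
    split_ifs <;> simp

theorem set_eq_set_iff {x y : List Bool} (i : ℕ) (c : Bool)
    (h : x[i]? = y[i]?) : x.set i c = y.set i c ↔ x = y := by
  refine ⟨fun e => List.ext_getElem? fun j => ?_, fun e => by rw [e]⟩
  by_cases hj : i = j
  · rw [← hj, h]
  · have := congrArg (fun l => l[j]?) e
    simpa [List.getElem?_set_ne hj] using this

theorem set_eq_set_congr {x y : List Bool} (i : ℕ) (c c' : Bool)
    (h : x.set i c = y.set i c) : x.set i c' = y.set i c' := by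
  have := congrArg (fun l => l.set i c') h
  simpa using this

theorem modify_not_involutive (x : List Bool) (j : ℕ) : (x.modify j not).modify j not = x := by
  refine List.ext_getElem? fun k => ?_
  simp only [List.getElem?_modify]
  rcases x[k]? with _ | b
  · simp
  · by_cases h : j = k <;> simp [h]

open Classical in
/-- Gates are unitary. -/
theorem inner_apply (g : Gate) {x y : List Bool} (hxy : x.length = y.length) :
    ((g.apply x).ex fun x' => (g.apply y).conj.ex fun y' => if x' = y' then 1 else 0) =
      if x = y then 1 else 0 := by
  cases g with
  | had i =>
    rcases hx : x[i]? with _ | b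
    · have hy : y[i]? = none := by
        rw [List.getElem?_eq_none_iff] at *
        omega
      simp [apply_had_none _ _ hx, apply_had_none _ _ hy]
    · obtain ⟨c, hy⟩ : ∃ c, y[i]? = some c := by
        obtain ⟨h, -⟩ := List.getElem?_eq_some_iff.1 hx
        exact ⟨y[i]'(hxy ▸ h), List.getElem?_eq_getElem _⟩
      rw [ex_apply_had i x b hx, ex_conj_apply_had i y c hy, ex_conj_apply_had i y c hy]
      have hne : x.set i false ≠ y.set i true := by
        intro e
        have := congrArg (fun l => l[i]?) e
        obtain ⟨h, -⟩ := List.getElem?_eq_some_iff.1 hx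
        simp [h, hxy ▸ h] at this
      have hne' : x.set i true ≠ y.set i false := by
        intro e
        have := congrArg (fun l => l[i]?) e
        obtain ⟨h, -⟩ := List.getElem?_eq_some_iff.1 hx
        simp [h, hxy ▸ h] at this
      have hs : ((1 / Real.sqrt 2 : ℝ) : ℂ) * ((1 / Real.sqrt 2 : ℝ) : ℂ) = 1 / 2 := by
        rw [← Complex.ofReal_mul, div_mul_div_comm, Real.mul_self_sqrt (by norm_num)]
        norm_num
      rw [if_neg hne, if_neg hne']
      by_cases e : x.set i false = y.set i false
      · rw [if_pos e, if_pos (set_eq_set_congr i false true e)]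
        by_cases hbc : b = c
        · rw [if_pos ((set_eq_set_iff i false (by rw [hx, hy, hbc])).1 e)]
          have : sgn b * sgn c = 1 := by subst hbc; cases b <;> simp [sgn]
          linear_combination 2 * hs + ((1 / Real.sqrt 2 : ℝ) : ℂ) * ((1 / Real.sqrt 2 : ℝ) : ℂ) * this
        · rw [if_neg (by rintro rfl; rw [hx] at hy; exact hbc (Option.some.inj hy))]
          have : sgn b * sgn c = -1 := by cases b <;> cases c <;> simp_all [sgn]
          linear_combination ((1 / Real.sqrt 2 : ℝ) : ℂ) * ((1 / Real.sqrt 2 : ℝ) : ℂ) * this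
      · rw [if_neg e, if_neg fun h => e (set_eq_set_congr i true false h), if_neg]
        · ring
        · rintro rfl
          exact e rfl
  | tee i =>
    simp only [apply_tee, Wt.conj_smul, Wt.ex_smul, Wt.ex_pure, Wt.conj_pure]
    by_cases e : x = y
    · subst e
      rw [if_pos rfl, mul_one]
      split_ifs
      · rw [Complex.mul_conj, Complex.normSq_eq_norm_sq]
        have : ‖Complex.exp (Real.pi / 4 * Complex.I)‖ = 1 := by
          have := Complex.norm_exp_ofReal_mul_I (Real.pi / 4)
          push_cast at this
          exact this
        simp [this]
      · simp
    · simp [e]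
  | cnot i j =>
    simp only [apply_cnot, Wt.conj_pure, Wt.ex_pure]
    congr 1
    refine propext ⟨fun e => ?_, fun e => by rw [e]⟩
    by_cases hij : i = j
    · simpa [hij] using e
    have hm : ∀ z : List Bool, (z.modify j not)[i]? = z[i]? := fun z => by
      rw [List.getElem?_modify]
      rcases z[i]? with _ | b <;> simp [Ne.symm hij]
    have hi := congrArg (fun l => l[i]?) e
    simp only [apply_ite (fun l : List Bool => l[i]?), hm, ite_self] at hi
    rw [hi] at e
    by_cases hc : i ≠ j ∧ y[i]? = some true
    · rw [if_pos hc, if_pos hc] at e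
      rw [← modify_not_involutive x j, e, modify_not_involutive]
    · rwa [if_neg hc, if_neg hc] at e

end Gate

end SKL

namespace SKL

/-! ### Running time, and semantics in continuation style -/

theorem Gate.square_of_mem_supp_conjugate {g : Gate} {r s : Reg} (hr : r.Square)
    (h : s ∈ (g.conjugate r).supp) : s.Square ∧ s.len = r.len := by
  obtain ⟨k, hk, h⟩ := Wt.exists_of_mem_supp_bind h
  obtain ⟨b, hb, h⟩ := Wt.exists_of_mem_supp_bind h
  rw [Wt.mem_supp_pure] at h
  rw [Wt.supp_conj] at hb
  have h1 := g.length_of_mem_supp_apply _ _ hk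
  have h2 := g.length_of_mem_supp_apply _ _ hb
  subst h
  simp only [Reg.Square, Reg.len] at *
  omega

theorem square_of_mem_supp_measureReg {i : ℕ} {r : Reg} (hr : r.Square) {x : Data × Reg}
    (h : x ∈ (measureReg i r).supp) :
    x.2.Square ∧ x.2.len ≤ r.len ∧ x.1.size ≤ 1 := by
  unfold measureReg at h
  split at h
  · rename_i a b ha hb
    split_ifs at h with hab
    · rw [Wt.mem_supp_pure] at h
      subst h
      simp only [Reg.Square, Reg.len, List.length_eraseIdx] at *
      refine ⟨by rw [hr], by split_ifs <;> omega, by cases a <;> simp [Data.ofBool, Data.size]⟩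
    · exact absurd h (Wt.not_mem_supp_zero _)
  · rw [Wt.mem_supp_pure] at h
    subst h
    exact ⟨hr, le_rfl, by simp [Data.size]⟩

theorem mem_supp_andThen {o o' : Out} {x : Wt Out} (h : o' ∈ (o.andThen x).supp) :
    ∃ p ∈ x.supp, o' = ⟨p.data, p.reg, o.log ++ p.log, o.time + p.time⟩ := by
  obtain ⟨p, hp, h⟩ := Wt.exists_of_mem_supp_bind h
  exact ⟨p, hp, Wt.mem_supp_pure.1 h⟩

theorem mem_supp_tick {t : ℕ} {o' : Out} {x : Wt Out} (h : o' ∈ (tick t x).supp) :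
    ∃ p ∈ x.supp, o' = ⟨p.data, p.reg, p.log, p.time + t⟩ := by
  obtain ⟨p, hp, h⟩ := Wt.exists_of_mem_supp_bind h
  exact ⟨p, hp, Wt.mem_supp_pure.1 h⟩

@[simp] theorem Data.size_ofNat (n : ℕ) : (Data.ofNat n).size = n := by
  induction n with
  | zero => rfl
  | succ n ih =>
    change 0 + (Data.ofNat n).size + 1 = _
    omega

theorem Data.size_fst_add_snd (d : Data) : d.fst.size + d.snd.size ≤ d.size := by
  cases d <;> simp [fst, snd, size]

/-- A bound for the time of a loop of at most `J` steps, from an invariant `I j` of the state before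
step `j`. -/
theorem foldData_time {f : Data → Reg → Wt Out} {T X J : ℕ} {I : ℕ → Data → Reg → Prop}
    (hstep : ∀ j x d r, j < J → x.size ≤ X → I j d r → ∀ o ∈ (f (.node x d) r).supp,
      o.time ≤ T ∧ I (j + 1) o.data o.reg) (c : Data) (hc : c.size ≤ X) :
    ∀ j d r, j + c.len ≤ J → I j d r → ∀ o ∈ (foldData f c d r).supp, o.time ≤ c.len * T := by
  induction c with
  | nil =>
    intro j d r _ hI o ho
    rw [foldData, Wt.mem_supp_pure] at ho
    subst ho
    simp
  | node x c _ ih =>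
    simp only [Data.size] at hc
    simp only [Data.len]
    intro j d r hj hI o ho
    obtain ⟨p, hp, ho⟩ := Wt.exists_of_mem_supp_bind ho
    obtain ⟨p', hp', rfl⟩ := mem_supp_andThen ho
    obtain ⟨h1, h2⟩ := hstep j x d r (by omega) (by omega) hI p hp
    have h3 := ih (by omega) (j + 1) _ _ (by omega) h2 p' hp'
    rw [Nat.succ_mul]
    simp only
    omega

/-- Data and new qubits have to be paid for with running time. -/
theorem Prog.bounds_of_mem_supp_eval (O : Data → Wt Data) (P : Prog) :
    ∀ (d : Data) (r : Reg), r.Square → ∀ o ∈ (P.eval O d r).supp,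
      o.reg.Square ∧ o.data.size ≤ o.time ∧ o.reg.len ≤ r.len + o.time := by
  have hfs := Data.size_fst_add_snd
  induction P with
  | nil | id =>
    intro d r hr o ho
    rw [eval, Wt.mem_supp_pure] at ho
    subst ho
    simp [hr, Data.size]
  | fst | snd =>
    intro d r hr o ho
    rw [eval, Wt.mem_supp_pure] at ho
    subst ho
    have := hfs d
    exact ⟨hr, by simp only; omega, by simp only; omega⟩
  | size | numQ =>
    intro d r hr o ho
    rw [eval, Wt.mem_supp_pure] at ho
    subst ho
    simp only [Data.size_ofNat]
    exact ⟨hr, by omega, by omega⟩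
  | comp P Q hP hQ =>
    intro d r hr o ho
    obtain ⟨p, hp, ho⟩ := Wt.exists_of_mem_supp_bind ho
    obtain ⟨p', hp', rfl⟩ := mem_supp_andThen ho
    have h1 := hP d r hr p hp
    have h2 := hQ _ _ h1.1 p' hp'
    simp only
    exact ⟨h2.1, by omega, by omega⟩
  | pair P Q hP hQ =>
    intro d r hr o ho
    obtain ⟨o, ho', rfl⟩ := mem_supp_tick ho
    replace ho := ho'
    obtain ⟨p, hp, ho⟩ := Wt.exists_of_mem_supp_bind ho
    obtain ⟨p', hp', rfl⟩ := mem_supp_andThen ho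
    obtain ⟨q, hq, hp'⟩ := Wt.exists_of_mem_supp_bind hp'
    rw [Wt.mem_supp_pure] at hp'
    subst hp'
    have h1 := hP d r hr p hp
    have h2 := hQ _ _ h1.1 q hq
    simp only [Data.size]
    exact ⟨h2.1, by omega, by omega⟩
  | cond P Q hP hQ =>
    intro d r hr o ho
    obtain ⟨o, ho', rfl⟩ := mem_supp_tick ho
    replace ho := ho'
    simp only
    split_ifs at ho
    · have h1 := hP _ r hr o ho
      exact ⟨h1.1, by omega, by omega⟩
    · have h1 := hQ _ r hr o ho
      exact ⟨h1.1, by omega, by omega⟩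
  | fold P hP =>
    intro d r hr o ho
    obtain ⟨o, ho', rfl⟩ := mem_supp_tick ho
    replace ho := ho'
    have key : ∀ (c d : Data) (r : Reg), r.Square → ∀ o ∈ (foldData (P.eval O) c d r).supp,
        o.reg.Square ∧ o.data.size ≤ d.size + o.time ∧ o.reg.len ≤ r.len + o.time := by
      intro c
      induction c with
      | nil =>
        intro d r hr o ho
        rw [foldData, Wt.mem_supp_pure] at ho
        subst ho
        exact ⟨hr, by simp, by simp⟩
      | node x c _ ih =>
        intro d r hr o ho
        obtain ⟨p, hp, ho⟩ := Wt.exists_of_mem_supp_bind ho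
        obtain ⟨p', hp', rfl⟩ := mem_supp_andThen ho
        have h1 := hP _ r hr p hp
        have h2 := ih _ _ h1.1 p' hp'
        simp only
        exact ⟨h2.1, by omega, by omega⟩
    have h1 := key _ _ r hr o ho
    have := hfs d
    simp only
    exact ⟨h1.1, by omega, by omega⟩
  | newQ =>
    intro d r hr o ho
    rw [eval, Wt.mem_supp_pure] at ho
    subst ho
    refine ⟨hr.append rfl, by simp, ?_⟩
    simp only [Reg.len_append]
    simp only [Reg.len, List.length_singleton]
    omega
  | gate =>
    intro d r hr o ho
    obtain ⟨s, hs, ho⟩ := Wt.exists_of_mem_supp_bind ho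
    rw [Wt.mem_supp_pure] at ho
    subst ho
    have := Gate.square_of_mem_supp_conjugate hr hs
    exact ⟨this.1, by simp, by simp only; omega⟩
  | rotate =>
    intro d r hr o ho
    rw [eval, Wt.mem_supp_pure] at ho
    subst ho
    simp only [Reg.Square, Reg.len, List.length_rotate] at *
    exact ⟨hr, by omega, by omega⟩
  | measure =>
    intro d r hr o ho
    obtain ⟨s, hs, ho⟩ := Wt.exists_of_mem_supp_bind ho
    rw [Wt.mem_supp_pure] at ho
    subst ho
    have := square_of_mem_supp_measureReg hr hs
    exact ⟨this.1, by simp only; omega, by simp only; omega⟩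
  | frame P hP =>
    intro d r hr o ho
    obtain ⟨o, ho', rfl⟩ := mem_supp_tick ho
    replace ho := ho'
    obtain ⟨p, hp, ho⟩ := Wt.exists_of_mem_supp_bind ho
    rw [Wt.mem_supp_pure] at ho
    subst ho
    have h1 := hP _ _ (hr.drop _) p hp
    refine ⟨(hr.take _).append h1.1, by simp only; omega, ?_⟩
    simp only [Reg.len_append]
    have h3 := h1.2.2
    simp only [Reg.len, Reg.take, Reg.drop, List.length_take, List.length_drop] at *
    omega
  | query =>
    intro d r hr o ho
    obtain ⟨s, hs, ho⟩ := Wt.exists_of_mem_supp_bind ho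
    rw [Wt.mem_supp_pure] at ho
    subst ho
    exact ⟨hr, by simp only; omega, by simp only; omega⟩

/-- The expectation of `φ` over the final datum, the final qubits and the queries. -/
noncomputable def wp (O : Data → Wt Data) (P : Prog) (d : Data) (r : Reg)
    (φ : Data → Reg → List Data → ℂ) : ℂ :=
  (P.eval O d r).ex fun o => φ o.data o.reg o.log

section wp

variable (O : Data → Wt Data) (P Q : Prog) (d : Data) (r : Reg) (φ : Data → Reg → List Data → ℂ)

theorem ex_andThen (o : Out) (x : Wt Out) (φ : Out → ℂ) :
    (o.andThen x).ex φ = x.ex fun p => φ ⟨p.data, p.reg, o.log ++ p.log, o.time + p.time⟩ := by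
  simp [Out.andThen]

theorem ex_tick (t : ℕ) (x : Wt Out) (φ : Out → ℂ) :
    (tick t x).ex φ = x.ex fun p => φ ⟨p.data, p.reg, p.log, p.time + t⟩ := by
  simp [tick]

@[simp] theorem wp_nil : wp O .nil d r φ = φ .nil r [] := by simp [wp, Prog.eval]

@[simp] theorem wp_id : wp O .id d r φ = φ d r [] := by simp [wp, Prog.eval]

@[simp] theorem wp_fst : wp O .fst d r φ = φ d.fst r [] := by simp [wp, Prog.eval]

@[simp] theorem wp_snd : wp O .snd d r φ = φ d.snd r [] := by simp [wp, Prog.eval]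

@[simp] theorem wp_size : wp O .size d r φ = φ (.ofNat d.size) r [] := by simp [wp, Prog.eval]

@[simp] theorem wp_numQ : wp O .numQ d r φ = φ (.ofNat r.len) r [] := by simp [wp, Prog.eval]

@[simp] theorem wp_comp : wp O (.comp P Q) d r φ =
    wp O P d r fun d' r' l => wp O Q d' r' fun d'' r'' l' => φ d'' r'' (l ++ l') := by
  simp [wp, Prog.eval, ex_andThen]

@[simp] theorem wp_pair : wp O (.pair P Q) d r φ =
    wp O P d r fun a r' l => wp O Q d r' fun b r'' l' => φ (.node a b) r'' (l ++ l') := by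
  simp [wp, Prog.eval, ex_andThen, ex_tick]

@[simp] theorem wp_cond : wp O (.cond P Q) d r φ =
    if d.fst.isNil then wp O P d.snd r φ else wp O Q d.snd r φ := by
  simp only [wp, Prog.eval, ex_tick]
  split_ifs <;> rfl

theorem wp_fold : wp O (.fold P) d r φ = wp O (.fold P) (.node d.fst d.snd) r φ := by
  simp [wp, Prog.eval, ex_tick, Data.fst, Data.snd]

@[simp] theorem wp_fold_nil : wp O (.fold P) (.node .nil d) r φ = φ d r [] := by
  simp [wp, Prog.eval, ex_tick, Data.fst, Data.snd, foldData]

@[simp] theorem wp_fold_node (x c : Data) : wp O (.fold P) (.node (.node x c) d) r φ =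
    wp O P (.node x d) r fun d' r' l => wp O (.fold P) (.node c d') r' fun d'' r'' l' =>
      φ d'' r'' (l ++ l') := by
  simp [wp, Prog.eval, ex_tick, Data.fst, Data.snd, foldData, ex_andThen]

@[simp] theorem wp_newQ :
    wp O .newQ d r φ = φ d (r.append ⟨[!d.isNil], [!d.isNil]⟩) [] := by simp [wp, Prog.eval]

@[simp] theorem wp_gate :
    wp O .gate d r φ = ((Gate.ofData d).conjugate r).ex fun r' => φ d r' [] := by
  simp [wp, Prog.eval]

@[simp] theorem wp_rotate :
    wp O .rotate d r φ = φ d ⟨r.ket.rotate d.len, r.bra.rotate d.len⟩ [] := by simp [wp, Prog.eval]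

@[simp] theorem wp_measure :
    wp O .measure d r φ = (measureReg d.len r).ex fun x => φ x.1 x.2 [] := by
  simp [wp, Prog.eval]

@[simp] theorem wp_frame : wp O (.frame P) d r φ =
    wp O P d.snd (r.drop (r.len - d.fst.len)) fun d' r' l =>
      φ d' ((r.take (r.len - d.fst.len)).append r') l := by
  simp [wp, Prog.eval, ex_tick]

@[simp] theorem wp_query : wp O .query d r φ = (O d).ex fun a => φ a r [d] := by
  simp [wp, Prog.eval]

end wp

theorem wp_congr {O : Data → Wt Data} {P : Prog} {d : Data} {r : Reg} (hr : r.Square)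
    {φ ψ : Data → Reg → List Data → ℂ} (h : ∀ d r l, r.Square → φ d r l = ψ d r l) :
    wp O P d r φ = wp O P d r ψ :=
  Wt.ex_congr fun o ho => h _ _ _ (P.bounds_of_mem_supp_eval O d r hr o ho).1

/-- The program with all oracle queries replaced by the answer `nil`. -/
def Prog.strip : Prog → Prog
  | .comp P Q => .comp P.strip Q.strip
  | .pair P Q => .pair P.strip Q.strip
  | .cond P Q => .cond P.strip Q.strip
  | .fold P => .fold P.strip
  | .frame P => .frame P.strip
  | .query => .nil
  | P => P

/-- Drops the record of the queries. -/
def Out.noLog (o : Out) : Out := ⟨o.data, o.reg, [], o.time⟩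

theorem Prog.ex_eval_strip (O : Data → Wt Data) (P : Prog) :
    ∀ (d : Data) (r : Reg) (φ : Out → ℂ),
      (P.strip.eval O d r).ex φ = (P.eval noOracle d r).ex fun o => φ o.noLog := by
  induction P with
  | comp P Q hP hQ =>
    intro d r φ
    simp [strip, eval, ex_andThen, hP, hQ, Out.noLog]
  | pair P Q hP hQ =>
    intro d r φ
    simp [strip, eval, ex_andThen, ex_tick, hP, hQ, Out.noLog]
  | cond P Q hP hQ =>
    intro d r φ
    simp only [strip, eval, ex_tick]
    split_ifs
    · simp [hP, Out.noLog]
    · simp [hQ, Out.noLog]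
  | fold P hP =>
    intro d r φ
    have key : ∀ (c d : Data) (r : Reg) (φ : Out → ℂ),
        (foldData (P.strip.eval O) c d r).ex φ =
          (foldData (P.eval noOracle) c d r).ex fun o => φ o.noLog := by
      intro c
      induction c with
      | nil => simp [foldData, Out.noLog]
      | node x c _ ih =>
        intro d r φ
        simp [foldData, ex_andThen, hP, ih, Out.noLog]
    simp [strip, eval, ex_tick, key, Out.noLog]
  | frame P hP =>
    intro d r φ
    simp [strip, eval, ex_tick, hP, Out.noLog]
  | query =>
    intro d r φ
    simp [strip, eval, noOracle, Out.noLog, Data.size]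
  | _ =>
    intro d r φ
    simp [strip, eval, Out.noLog]

theorem Prog.eval_strip (O : Data → Wt Data) (P : Prog) (d : Data) (r : Reg) :
    P.strip.eval O d r = (P.eval noOracle d r >>= fun o => pure o.noLog) :=
  Wt.ext_ex fun φ => by simp [P.ex_eval_strip O]

theorem wp_strip (O : Data → Wt Data) (P : Prog) (d : Data) (r : Reg)
    (φ : Data → Reg → List Data → ℂ) :
    wp O P.strip d r φ = (P.exec d r).ex fun x => φ x.1 x.2 [] := by
  simp [wp, P.ex_eval_strip O, Prog.exec, Out.noLog]

theorem ex_exec (P : Prog) (d : Data) (r : Reg) (φ : Data × Reg → ℂ) :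
    (P.exec d r).ex φ = wp noOracle P d r fun a s _ => φ (a, s) := by
  simp [wp, Prog.exec]

theorem mem_supp_exec {P : Prog} {d : Data} {r : Reg} {x : Data × Reg}
    (h : x ∈ (P.exec d r).supp) : ∃ o ∈ (P.eval noOracle d r).supp, x = (o.data, o.reg) := by
  obtain ⟨o, ho, h⟩ := Wt.exists_of_mem_supp_bind h
  exact ⟨o, ho, Wt.mem_supp_pure.1 h⟩

end SKL

namespace SKL

/-! ### Programs are trace preserving and completely positive -/

open Classical in
/-- The trace of `|ket⟩⟨bra|`. -/
noncomputable def Reg.tr (r : Reg) : ℂ := if r.ket = r.bra then 1 else 0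

theorem Reg.tr_append {r s : Reg} (hr : r.Square) : (r.append s).tr = r.tr * s.tr := by
  classical
  simp only [tr, append, ← ite_and, ite_mul, one_mul, zero_mul]
  congr 1
  exact propext ⟨fun h => List.append_inj h hr, fun h => by rw [h.1, h.2]⟩

theorem Reg.tr_take_mul_tr_drop (r : Reg) (hr : r.Square) (k : ℕ) :
    (r.take k).tr * (r.drop k).tr = r.tr := by
  rw [← tr_append (hr.take k)]
  simp [append, take, drop]

theorem Gate.ex_conjugate (g : Gate) (r : Reg) (φ : Reg → ℂ) :
    (g.conjugate r).ex φ =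
      (g.apply r.ket).ex fun k => (g.apply r.bra).conj.ex fun b => φ ⟨k, b⟩ := by
  simp [conjugate]

theorem ex_tr_measureReg (i : ℕ) (r : Reg) :
    ((measureReg i r).ex fun x => x.2.tr) = r.tr := by
  classical
  unfold measureReg
  split
  · rename_i a b ha hb
    have key : r.ket = r.bra ↔ a = b ∧ r.ket.eraseIdx i = r.bra.eraseIdx i := by
      refine ⟨fun h => ⟨?_, by rw [h]⟩, fun ⟨h1, h2⟩ => ?_⟩
      · rw [h, hb] at ha
        exact (Option.some.inj ha).symm
      · subst h1
        obtain ⟨h3, h4⟩ := List.getElem?_eq_some_iff.1 ha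
        obtain ⟨h5, h6⟩ := List.getElem?_eq_some_iff.1 hb
        have e1 : r.ket = (r.ket.eraseIdx i).insertIdx i a := by
          rw [← h4, List.insertIdx_eraseIdx_getElem]
        have e2 : r.bra = (r.bra.eraseIdx i).insertIdx i a := by
          rw [← h6, List.insertIdx_eraseIdx_getElem]
        rw [e1, e2, h2]
    split_ifs with hab
    · simp only [Wt.ex_pure, Reg.tr, key, hab, true_and]
    · simp only [Wt.ex_zero, Reg.tr, key, hab, false_and, if_false]
  · simp

/-- Programs preserve the trace. -/
theorem wp_tr {O : Data → Wt Data} (hO : ∀ d, (O d).IsDist) (P : Prog) :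
    ∀ (d : Data) (r : Reg), r.Square → wp O P d r (fun _ s _ => s.tr) = r.tr := by
  induction P with
  | comp P Q hP hQ =>
    intro d r hr
    rw [wp_comp, ← hP d r hr]
    exact wp_congr hr fun d r _ hr => hQ d r hr
  | pair P Q hP hQ =>
    intro d r hr
    rw [wp_pair, ← hP d r hr]
    exact wp_congr hr fun _ r _ hr => hQ d r hr
  | cond P Q hP hQ =>
    intro d r hr
    rw [wp_cond]
    split_ifs
    · exact hP _ _ hr
    · exact hQ _ _ hr
  | fold P hP =>
    intro d r hr
    rw [wp_fold]
    generalize d.snd = e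
    revert r e
    induction d.fst with
    | nil => simp
    | node x c _ ih =>
      intro r hr e
      rw [wp_fold_node, ← hP (.node x e) r hr]
      exact wp_congr hr fun d r _ hr => ih r hr d
  | newQ =>
    intro d r hr
    rw [wp_newQ, Reg.tr_append hr]
    simp [Reg.tr]
  | gate =>
    intro d r hr
    rw [wp_gate, Gate.ex_conjugate]
    exact Gate.inner_apply _ hr
  | rotate =>
    intro d r hr
    classical
    simp only [wp_rotate, Reg.tr]
    congr 1
    refine propext ⟨fun h => ?_, fun h => by rw [h]⟩
    exact List.rotate_injective d.len h
  | measure =>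
    intro d r hr
    rw [wp_measure]
    exact ex_tr_measureReg _ _
  | frame P hP =>
    intro d r hr
    rw [wp_frame, ← Reg.tr_take_mul_tr_drop r hr (r.len - d.fst.len), ← hP d.snd _ (hr.drop _)]
    simp only [Reg.tr_append (hr.take _)]
    exact Wt.ex_mul_left _ _ _
  | query =>
    intro d r hr
    rw [wp_query]
    have := Wt.ex_mul_left (O d) r.tr fun _ => 1
    rw [(hO d).total] at this
    simpa using this
  | _ =>
    intro d r hr
    simp

/-- Expectations over what a quantum instrument with data and query records as outcomes makes of
`|ket⟩⟨bra|` on `N` qubits, in Kraus form: the operator `K j` leads to the outcome `dat j` with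
queries `lg j`, and to `M j` qubits. -/
def Kraus (N : ℕ) (F : Reg → (Data → Reg → List Data → ℂ) → ℂ) : Prop :=
  ∃ (J : Type) (_ : Fintype J) (dat : J → Data) (lg : J → List Data) (M : J → ℕ)
    (K : J → List Bool → Wt (List Bool)),
    (∀ j k, k.length = N → ∀ y ∈ (K j k).supp, y.length = M j) ∧
    ∀ k b : List Bool, k.length = N → b.length = N → ∀ φ, F ⟨k, b⟩ φ =
      ∑ j, (K j k).ex fun k' => (K j b).conj.ex fun b' => φ (dat j) ⟨k', b'⟩ (lg j)

namespace Kraus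

variable {N : ℕ} {F G : Reg → (Data → Reg → List Data → ℂ) → ℂ}

theorem congr (hF : Kraus N F)
    (h : ∀ r : Reg, r.len = N → r.Square → ∀ φ, G r φ = F r φ) : Kraus N G := by
  obtain ⟨J, i, dat, lg, M, K, h1, h2⟩ := hF
  exact ⟨J, i, dat, lg, M, K, h1, fun k b hk hb φ => by
    rw [h ⟨k, b⟩ hk (hk.trans hb.symm), h2 k b hk hb]⟩

/-- A single Kraus operator. -/
theorem single (d : Data) (l : List Data) (M : ℕ) (K : List Bool → Wt (List Bool))
    (hK : ∀ k, k.length = N → ∀ y ∈ (K k).supp, y.length = M) :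
    Kraus N fun r φ => (K r.ket).ex fun k => (K r.bra).conj.ex fun b => φ d ⟨k, b⟩ l :=
  ⟨Unit, inferInstance, fun _ => d, fun _ => l, fun _ => M, fun _ => K, fun _ => hK,
    fun k b _ _ φ => by simp⟩

theorem relabel (hF : Kraus N F) (g : Data → List Data → Data)
    (h : Data → List Data → List Data) :
    Kraus N fun r φ => F r fun d r l => φ (g d l) r (h d l) := by
  obtain ⟨J, i, dat, lg, M, K, h1, h2⟩ := hF
  exact ⟨J, i, fun j => g (dat j) (lg j), fun j => h (dat j) (lg j), M, K, h1,
    fun k b hk hb φ => h2 k b hk hb _⟩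

theorem bind (hF : Kraus N F) {G : Data → List Data → Reg → (Data → Reg → List Data → ℂ) → ℂ}
    (hG : ∀ d l N, Kraus N (G d l)) : Kraus N fun r φ => F r fun d s l => G d l s φ := by
  obtain ⟨J, i, dat, lg, M, K, h1, h2⟩ := hF
  choose J' i' dat' lg' M' K' h1' h2' using fun j => hG (dat j) (lg j) (M j)
  refine ⟨Σ j, J' j, inferInstance, fun j => dat' _ j.2, fun j => lg' _ j.2, fun j => M' _ j.2,
    fun j k => K j.1 k >>= K' j.1 j.2, ?_, ?_⟩
  · rintro ⟨j, j'⟩ k hk y hy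
    obtain ⟨z, hz, hy⟩ := Wt.exists_of_mem_supp_bind hy
    exact h1' j j' z (h1 j k hk z hz) y hy
  · intro k b hk hb φ
    refine (h2 k b hk hb _).trans ?_
    rw [Fintype.sum_sigma]
    refine Finset.sum_congr rfl fun j _ => ?_
    simp only [Wt.conj_bind, Wt.ex_bind]
    rw [Wt.ex_congr (ψ := fun k' => ∑ j', (K' j j' k').ex fun k'' => (K j b).conj.ex fun b' =>
      (K' j j' b').conj.ex fun b'' => φ (dat' j j') ⟨k'', b''⟩ (lg' j j')), Wt.ex_sum_right]
    intro k' hk'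
    rw [Wt.ex_congr (ψ := fun b' => ∑ j', (K' j j' k').ex fun k'' =>
      (K' j j' b').conj.ex fun b'' => φ (dat' j j') ⟨k'', b''⟩ (lg' j j')), Wt.ex_sum_right]
    · refine Finset.sum_congr rfl fun j' _ => ?_
      exact Wt.ex_comm _ _ _
    · intro b' hb'
      rw [Wt.supp_conj] at hb'
      exact h2' j k' b' (h1 j k hk k' hk') (h1 j b hb b' hb') φ

/-- The first `t` qubits stay out of the operation. -/
theorem frame {t : ℕ} (ht : t ≤ N) (hF : Kraus (N - t) F) :
    Kraus N fun r φ => F (r.drop t) fun d s l => φ d ((r.take t).append s) l := by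
  obtain ⟨J, i, dat, lg, M, K, h1, h2⟩ := hF
  refine ⟨J, i, dat, lg, fun j => t + M j,
    fun j k => K j (k.drop t) >>= fun y => pure (k.take t ++ y), ?_, ?_⟩
  · intro j k hk y hy
    obtain ⟨z, hz, hy⟩ := Wt.exists_of_mem_supp_bind hy
    rw [Wt.mem_supp_pure] at hy
    subst hy
    simp [h1 j _ (by simp [hk]) z hz, hk, ht]
  · intro k b hk hb φ
    simp only [Reg.drop]
    rw [h2 _ _ (by simp [hk]) (by simp [hb])]
    simp [Wt.conj_bind, Reg.take, Reg.append]

end Kraus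

/-- Programs are completely positive. -/
theorem kraus_wp {O : Data → Wt Data} (hO : ∀ d, (O d).IsDist) (P : Prog) :
    ∀ (d : Data) (N : ℕ), Kraus N (wp O P d) := by
  have hid : ∀ (a : Data) (N : ℕ), Kraus N fun r φ => φ a r [] := fun a N =>
    (Kraus.single a [] N pure (by simp)).congr (by simp)
  induction P with
  | nil =>
    exact fun d N => (hid .nil N).congr (by simp)
  | id =>
    exact fun d N => (hid d N).congr (by simp)
  | fst =>
    exact fun d N => (hid d.fst N).congr (by simp)
  | snd =>
    exact fun d N => (hid d.snd N).congr (by simp)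
  | size =>
    exact fun d N => (hid (.ofNat d.size) N).congr (by simp)
  | numQ =>
    intro d N
    refine (hid (.ofNat N) N).congr fun r hr _ φ => by simp [hr]
  | comp P Q hP hQ =>
    intro d N
    refine ((hP d N).bind (G := fun d l r φ => wp O Q d r fun d' r' l' => φ d' r' (l ++ l'))
      fun d l N => ?_).congr (by simp)
    exact (hQ d N).relabel (fun d _ => d) fun _ l' => l ++ l'
  | pair P Q hP hQ =>
    intro d N
    refine ((hP d N).bind
      (G := fun a l r φ => wp O Q d r fun d' r' l' => φ (.node a d') r' (l ++ l'))
      fun a l N => ?_).congr (by simp)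
    exact (hQ d N).relabel (fun d _ => .node a d) fun _ l' => l ++ l'
  | cond P Q hP hQ =>
    intro d N
    by_cases h : d.fst.isNil
    · exact (hP d.snd N).congr (by simp [h])
    · exact (hQ d.snd N).congr (by simp [h])
  | fold P hP =>
    intro d N
    refine Kraus.congr (F := wp O (.fold P) (.node d.fst d.snd)) ?_
      fun r _ _ φ => wp_fold _ _ _ _ _
    generalize d.snd = e
    revert e N
    induction d.fst with
    | nil => exact fun N e => (hid e N).congr (by simp)
    | node x c _ ih =>
      intro N e
      refine ((hP (.node x e) N).bind
        (G := fun d l r φ => wp O (.fold P) (.node c d) r fun d' r' l' => φ d' r' (l ++ l'))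
        fun d l N => ?_).congr (by simp)
      exact (ih N d).relabel (fun d _ => d) fun _ l' => l ++ l'
  | newQ =>
    intro d N
    refine (Kraus.single d [] (N + 1) (fun k => pure (k ++ [!d.isNil])) (by simp)).congr ?_
    simp [Reg.append]
  | gate =>
    intro d N
    refine (Kraus.single d [] N (Gate.ofData d).apply fun k hk y hy => ?_).congr ?_
    · rw [Gate.length_of_mem_supp_apply _ _ _ hy, hk]
    · intro r _ _ φ
      rw [wp_gate, Gate.ex_conjugate]
  | rotate =>
    intro d N
    refine (Kraus.single d [] N (fun k => pure (k.rotate d.len)) (by simp)).congr ?_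
    simp
  | measure =>
    intro d N
    by_cases h : d.len < N
    · classical
      refine ⟨Bool, inferInstance, fun x => .ofBool x, fun _ => [], fun _ => N - 1,
        fun x k => if k[d.len]? = some x then pure (k.eraseIdx d.len) else 0, ?_, ?_⟩
      · intro x k hk y hy
        simp only at hy
        split_ifs at hy
        · rw [Wt.mem_supp_pure] at hy
          rw [hy, List.length_eraseIdx, hk, if_pos h]
        · exact absurd hy (Wt.not_mem_supp_zero _)
      · intro k b hk hb φ
        obtain ⟨x, hx⟩ : ∃ x, k[d.len]? = some x :=
          ⟨k[d.len]'(hk ▸ h), List.getElem?_eq_getElem _⟩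
        obtain ⟨y, hy⟩ : ∃ y, b[d.len]? = some y :=
          ⟨b[d.len]'(hb ▸ h), List.getElem?_eq_getElem _⟩
        rw [wp_measure, measureReg]
        simp only [hx, hy]
        cases x <;> cases y <;> simp
    · refine (hid .nil N).congr fun r hr _ φ => ?_
      have : r.ket[d.len]? = none := List.getElem?_eq_none_iff.2 (by
        rw [Reg.len] at hr
        omega)
      rw [wp_measure, measureReg, this]
      simp
  | frame P hP =>
    intro d N
    refine (Kraus.frame (t := N - d.fst.len) (Nat.sub_le _ _) (hP d.snd _)).congr ?_
    intro r hr _ φ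
    rw [wp_frame, hr]
  | query =>
    intro d N
    classical
    refine ⟨{a // a ∈ (O d).supp}, inferInstance, fun a => a.1, fun _ => [d], fun _ => N,
      fun a k => (Real.sqrt ((O d).coeff a.1).re : ℂ) • pure k, ?_, ?_⟩
    · intro a k hk y hy
      have := Wt.mem_of_mem_supp_smul hy
      rw [Wt.mem_supp_pure] at this
      rw [this, hk]
    · intro k b _ _ φ
      rw [wp_query, Wt.ex_eq_sum, ← Finset.sum_coe_sort]
      refine Finset.sum_congr rfl fun a _ => ?_
      have h1 : (Real.sqrt ((O d).coeff a.1).re : ℂ) * (Real.sqrt ((O d).coeff a.1).re : ℂ) =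
          (O d).coeff a.1 := by
        rw [← Complex.ofReal_mul, Real.mul_self_sqrt ((hO d).re_nonneg _)]
        exact Complex.ext rfl (by simp [(hO d).im_eq_zero])
      simp only [Wt.conj_smul, Wt.conj_pure, Wt.ex_smul, Wt.ex_pure, Complex.conj_ofReal]
      rw [← mul_assoc, h1]

/-- A family of kernels that is positive semidefinite on states of any fixed number of qubits. -/
def PosForm (φ : Reg → ℂ) : Prop :=
  ∀ (N : ℕ) (u : Wt (List Bool)), (∀ k ∈ u.supp, k.length = N) →
    0 ≤ (u.ex fun k => u.conj.ex fun b => φ ⟨k, b⟩).re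

/-- Positive observables have a nonnegative expectation in the final state of a program that starts
without qubits. -/
theorem wp_re_nonneg {O : Data → Wt Data} (hO : ∀ d, (O d).IsDist) (P : Prog) (d : Data)
    {φ : Data → Reg → List Data → ℂ} (hφ : ∀ a l, PosForm fun r => φ a r l) :
    0 ≤ (wp O P d .empty φ).re := by
  obtain ⟨J, i, dat, lg, M, K, h1, h2⟩ := kraus_wp hO P d 0
  have := h2 [] [] rfl rfl φ
  rw [show Reg.empty = ⟨[], []⟩ from rfl, this, Complex.re_sum]
  exact Finset.sum_nonneg fun j _ => hφ (dat j) (lg j) (M j) (K j []) (h1 j [] rfl)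

end SKL

namespace SKL

/-! ### Deterministic polynomial time functions -/

theorem eval_mono (p : ℕ[X]) {a b : ℕ} (h : a ≤ b) : p.eval a ≤ p.eval b := by
  simp only [Polynomial.eval_eq_sum_range]
  exact Finset.sum_le_sum fun i _ => Nat.mul_le_mul_left _ (Nat.pow_le_pow_left h i)

namespace Data

theorem len_le_size (d : Data) : d.len ≤ d.size := by
  induction d with
  | nil => rfl
  | node x c _ ih => simp only [len, size]; omega

theorem size_fst_le (d : Data) : d.fst.size ≤ d.size := by
  have := d.size_fst_add_snd; omega

theorem size_snd_le (d : Data) : d.snd.size ≤ d.size := by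
  have := d.size_fst_add_snd; omega

theorem size_le_fst_add_snd (d : Data) : d.size ≤ d.fst.size + d.snd.size + 1 := by
  cases d <;> simp [fst, snd, size]

@[simp] theorem fst_node (a b : Data) : (node a b).fst = a := rfl
@[simp] theorem snd_node (a b : Data) : (node a b).snd = b := rfl
@[simp] theorem fst_nil : nil.fst = nil := rfl
@[simp] theorem snd_nil : nil.snd = nil := rfl

/-- The left fold over a list. -/
def fold (f : Data → Data) : Data → Data → Data
  | nil, e => e
  | node x c, e => fold f c (f (node x e))

end Data

/-- The function is computed in polynomial time by a program that has nothing to do with qubits and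
oracles. -/
def Det (f : Data → Data) : Prop :=
  ∃ (P : Prog) (t : Data → ℕ) (p : ℕ[X]),
    (∀ O d r, P.eval O d r = pure ⟨f d, r, [], t d⟩) ∧ ∀ d, t d ≤ p.eval d.size

namespace Det

theorem nil : Det fun _ => .nil :=
  ⟨.nil, fun d => d.size + 1, Polynomial.X + 1, fun _ _ _ => rfl, by simp⟩

theorem id : Det fun d => d :=
  ⟨.id, fun d => d.size + 1, Polynomial.X + 1, fun _ _ _ => rfl, by simp⟩

theorem fst : Det Data.fst :=
  ⟨.fst, fun d => d.size + 1, Polynomial.X + 1, fun _ _ _ => rfl, by simp⟩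

theorem snd : Det Data.snd :=
  ⟨.snd, fun d => d.size + 1, Polynomial.X + 1, fun _ _ _ => rfl, by simp⟩

theorem size_le {f : Data → Data} {P : Prog} {t : Data → ℕ}
    (h : ∀ O d r, P.eval O d r = pure ⟨f d, r, [], t d⟩) (d : Data) : (f d).size ≤ t d :=
  (P.bounds_of_mem_supp_eval noOracle d .empty rfl ⟨f d, .empty, [], t d⟩
    (by rw [h, Wt.mem_supp_pure])).2.1

variable {f g : Data → Data}

theorem comp (hf : Det f) (hg : Det g) : Det fun d => g (f d) := by
  obtain ⟨P, t, p, h1, h2⟩ := hf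
  obtain ⟨Q, s, q, h3, h4⟩ := hg
  refine ⟨.comp P Q, fun d => t d + s (f d), p + q.comp p, fun O d r => ?_, fun d => ?_⟩
  · exact Wt.ext_ex fun φ => by simp [Prog.eval, h1, h3, ex_andThen]
  · simp only [Polynomial.eval_add, Polynomial.eval_comp]
    exact add_le_add (h2 d) ((h4 _).trans (eval_mono q ((size_le h1 d).trans (h2 d))))

theorem pair (hf : Det f) (hg : Det g) : Det fun d => .node (f d) (g d) := by
  obtain ⟨P, t, p, h1, h2⟩ := hf
  obtain ⟨Q, s, q, h3, h4⟩ := hg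
  refine ⟨.pair P Q, fun d => t d + s d + (d.size + 1), p + q + (Polynomial.X + 1),
    fun O d r => ?_, fun d => ?_⟩
  · exact Wt.ext_ex fun φ => by simp [Prog.eval, h1, h3, ex_andThen, ex_tick]
  · simp only [Polynomial.eval_add, Polynomial.eval_X, Polynomial.eval_one]
    have := h2 d
    have := h4 d
    omega

theorem cond (hf : Det f) (hg : Det g) :
    Det fun d => if d.fst.isNil then f d.snd else g d.snd := by
  obtain ⟨P, t, p, h1, h2⟩ := hf
  obtain ⟨Q, s, q, h3, h4⟩ := hg
  refine ⟨.cond P Q, fun d => (if d.fst.isNil then t d.snd else s d.snd) + (d.size + 1),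
    p + q + (Polynomial.X + 1), fun O d r => ?_, fun d => ?_⟩
  · refine Wt.ext_ex fun φ => ?_
    simp only [Prog.eval, ex_tick, h1, h3]
    split_ifs <;> simp
  · simp only [Polynomial.eval_add, Polynomial.eval_X, Polynomial.eval_one]
    have := (h2 d.snd).trans (eval_mono p d.size_snd_le)
    have := (h4 d.snd).trans (eval_mono q d.size_snd_le)
    split_ifs <;> omega

/-- A loop stays polynomial if every step adds to the size at most the size of the list entry and
something that is bounded in terms of a part `κ` of the state that does not grow. -/
theorem fold (hf : Det f) (κ : Data → ℕ) (g : ℕ[X]) (hκ : ∀ e, κ e ≤ e.size)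
    (h1 : ∀ x e, κ (f (.node x e)) ≤ κ e)
    (h2 : ∀ x e, (f (.node x e)).size ≤ e.size + x.size + g.eval (κ e)) :
    Det fun d => Data.fold f d.fst d.snd := by
  obtain ⟨P, t, p, h3, h4⟩ := hf
  let T : Data → Data → ℕ := fun c => c.rec (fun _ => 0)
    fun x _ _ ih e => t (.node x e) + ih (f (.node x e))
  have hT : ∀ O c e r, foldData (P.eval O) c e r = pure ⟨Data.fold f c e, r, [], T c e⟩ := by
    intro O c
    induction c with
    | nil => intro e r; rfl
    | node x c _ ih =>
      intro e r
      exact Wt.ext_ex fun φ => by simp [foldData, h3, ex_andThen, ih, Data.fold, T]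
  refine ⟨.fold P, fun d => T d.fst d.snd + (d.size + 1),
    Polynomial.X * p.comp (Polynomial.X + Polynomial.X * g + 1) + (Polynomial.X + 1),
    fun O d r => ?_, fun d => ?_⟩
  · exact Wt.ext_ex fun φ => by simp [Prog.eval, ex_tick, hT]
  · have key : ∀ B G c e, g.eval (κ e) ≤ G → e.size + c.size + c.len * G ≤ B →
        T c e ≤ c.len * p.eval (B + 1) := by
      intro B G c
      induction c with
      | nil => intro e _ _; simp [T]
      | node x c _ ih =>
        intro e hG hB
        simp only [Data.size, Data.len, Nat.succ_mul] at hB ⊢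
        have h5 := ih (f (.node x e)) ((eval_mono g (h1 x e)).trans hG)
          (by have := h2 x e; omega)
        have h6 := (h4 (.node x e)).trans (eval_mono p (b := B + 1) (by simp [Data.size]; omega))
        change t (.node x e) + T c (f (.node x e)) ≤ _
        omega
    simp only [Polynomial.eval_add, Polynomial.eval_mul, Polynomial.eval_comp, Polynomial.eval_X,
      Polynomial.eval_one]
    have h5 := d.size_fst_add_snd
    have h6 := d.fst.len_le_size
    have h7 : d.fst.len * g.eval (κ d.snd) ≤ d.size * g.eval d.size :=
      Nat.mul_le_mul (by omega) (eval_mono g ((hκ _).trans (by omega)))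
    have h8 := key (d.size + d.size * g.eval d.size) _ d.fst d.snd le_rfl (by omega)
    have h9 : d.fst.len * p.eval (d.size + d.size * g.eval d.size + 1) ≤
      d.size * p.eval (d.size + d.size * g.eval d.size + 1) := Nat.mul_le_mul_right _ (by omega)
    omega

end Det

/-! ### Polynomial time operations on qubits, and polynomial time generation of qubits -/

/-- The outcome of a run: datum, qubits and queries. -/
abbrev Res : Type := Data × Reg × List Data

section classes

variable {ι : Type} (F : ι → Data → Wt Data) (w : ι → ℕ)

/-- The operation is computed by a program with oracle `F i`, in time polynomial in the size of the
datum, the number of qubits, and the weight `w i` of the oracle. -/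
def Act (g : ι → Data → Reg → Wt Res) : Prop :=
  ∃ (P : Prog) (p : ℕ[X]), ∀ i d r, r.Square →
    (∀ φ, wp (F i) P d r φ = (g i d r).ex fun x => φ x.1 x.2.1 x.2.2) ∧
    ∀ o ∈ (P.eval (F i) d r).supp, o.time ≤ p.eval (w i + d.size + r.len)

/-- The datum and the new qubits, which are put behind the qubits that are there, are computed by a
program with oracle `F i`, in time polynomial in the size of the datum and the weight `w i`. -/
def Gen (f : ι → Data → Wt Res) : Prop :=
  ∃ (P : Prog) (p : ℕ[X]), ∀ i d r, r.Square →
    (∀ φ, wp (F i) P d r φ = (f i d).ex fun x => φ x.1 (r.append x.2.1) x.2.2) ∧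
    ∀ o ∈ (P.eval (F i) d r).supp, o.time ≤ p.eval (w i + d.size)

end classes

section actions

variable {ι : Type} {F : ι → Data → Wt Data} {w : ι → ℕ}

theorem square_of_wp_eq {O : Data → Wt Data} {P : Prog} {d : Data} {r : Reg} (hr : r.Square)
    {y : Wt Res} (h : ∀ φ, wp O P d r φ = y.ex fun x => φ x.1 x.2.1 x.2.2) :
    ∀ x ∈ y.supp, x.2.1.Square := by
  have : y = (P.eval O d r >>= fun o => pure (o.data, o.reg, o.log)) :=
    Wt.ext_ex fun φ => by
      have := h fun a s l => φ (a, s, l)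
      rw [wp] at this
      simp [this]
  intro x hx
  rw [this] at hx
  obtain ⟨o, ho, hx⟩ := Wt.exists_of_mem_supp_bind hx
  rw [Wt.mem_supp_pure] at hx
  subst hx
  exact (P.bounds_of_mem_supp_eval O d r hr o ho).1

namespace Act

variable {g h : ι → Data → Reg → Wt Res}

theorem congr (hg : Act F w g) (hgh : ∀ i d r, r.Square → h i d r = g i d r) : Act F w h := by
  obtain ⟨P, p, h1⟩ := hg
  exact ⟨P, p, fun i d r hr => by rw [hgh i d r hr]; exact h1 i d r hr⟩

theorem comp (hg : Act F w g) (hh : Act F w h) : Act F w fun i d r => (do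
    let x ← g i d r
    let y ← h i x.1 x.2.1
    pure (y.1, y.2.1, x.2.2 ++ y.2.2)) := by
  obtain ⟨P, p, h1⟩ := hg
  obtain ⟨Q, q, h2⟩ := hh
  refine ⟨.comp P Q, p + q.comp (Polynomial.X + p + p), fun i d r hr => ⟨fun φ => ?_, ?_⟩⟩
  · simp only [wp_comp, Wt.ex_bind, Wt.ex_pure]
    rw [(h1 i d r hr).1]
    refine Wt.ex_congr fun x hx => ?_
    rw [(h2 i _ _ (square_of_wp_eq hr (h1 i d r hr).1 x hx)).1]
  · intro o ho
    obtain ⟨o, ho', ho1⟩ := Wt.exists_of_mem_supp_bind ho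
    obtain ⟨o', ho2, rfl⟩ := mem_supp_andThen ho1
    have h3 := P.bounds_of_mem_supp_eval _ d r hr o ho'
    have h4 := (h1 i d r hr).2 o ho'
    have h5 := ((h2 i _ _ h3.1).2 o' ho2).trans
      (eval_mono q (b := w i + d.size + r.len + p.eval (w i + d.size + r.len) +
        p.eval (w i + d.size + r.len)) (by omega))
    simp only [Polynomial.eval_add, Polynomial.eval_comp, Polynomial.eval_X]
    omega

theorem pair (hg : Act F w g) (hh : Act F w h) : Act F w fun i d r => (do
    let x ← g i d r
    let y ← h i d x.2.1
    pure (.node x.1 y.1, y.2.1, x.2.2 ++ y.2.2)) := by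
  obtain ⟨P, p, h1⟩ := hg
  obtain ⟨Q, q, h2⟩ := hh
  refine ⟨.pair P Q, p + q.comp (Polynomial.X + p) + (Polynomial.X + 1),
    fun i d r hr => ⟨fun φ => ?_, ?_⟩⟩
  · simp only [wp_pair, Wt.ex_bind, Wt.ex_pure]
    rw [(h1 i d r hr).1]
    refine Wt.ex_congr fun x hx => ?_
    rw [(h2 i _ _ (square_of_wp_eq hr (h1 i d r hr).1 x hx)).1]
  · intro o ho
    obtain ⟨o1, ho1, rfl⟩ := mem_supp_tick ho
    obtain ⟨o2, ho', ho2⟩ := Wt.exists_of_mem_supp_bind ho1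
    obtain ⟨o3, ho4, rfl⟩ := mem_supp_andThen ho2
    obtain ⟨o4, ho5, ho3⟩ := Wt.exists_of_mem_supp_bind ho4
    rw [Wt.mem_supp_pure] at ho3
    subst ho3
    have h3 := P.bounds_of_mem_supp_eval _ d r hr o2 ho'
    have h4 := (h1 i d r hr).2 o2 ho'
    have h5 := ((h2 i _ _ h3.1).2 o4 ho5).trans
      (eval_mono q (b := w i + d.size + r.len + p.eval (w i + d.size + r.len)) (by omega))
    simp only [Polynomial.eval_add, Polynomial.eval_comp, Polynomial.eval_X, Polynomial.eval_one]
    omega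

theorem ofDet {f : Data → Data} (hf : Det f) : Act F w fun _ d r => pure (f d, r, []) := by
  obtain ⟨P, t, p, h1, h2⟩ := hf
  refine ⟨P, p, fun i d r _ => ⟨fun φ => by simp [wp, h1], fun o ho => ?_⟩⟩
  rw [h1, Wt.mem_supp_pure] at ho
  subst ho
  exact (h2 d).trans (eval_mono p (by omega))

/-- Instructions with time bounded by the sizes. -/
theorem ofInstr (P : Prog)
    (hP : ∀ i d r, ∀ o ∈ (P.eval (F i) d r).supp, o.time ≤ d.size + r.len + 1) :
    Act F w fun i d r => (do
      let o ← P.eval (F i) d r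
      pure (o.data, o.reg, o.log)) := by
  refine ⟨P, Polynomial.X + 1, fun i d r _ => ⟨fun φ => by simp [wp], fun o ho => ?_⟩⟩
  have := hP i d r o ho
  simp only [Polynomial.eval_add, Polynomial.eval_X, Polynomial.eval_one]
  omega

theorem newQ : Act F w fun _ d r =>
    pure (d, r.append ⟨[!d.isNil], [!d.isNil]⟩, []) :=
  (ofInstr .newQ fun i d r o ho => by
    rw [Prog.eval, Wt.mem_supp_pure] at ho
    subst ho
    simp).congr fun i d r _ => Wt.ext_ex fun φ => by simp [Prog.eval]

theorem gate : Act F w fun _ d r => (do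
    let s ← (Gate.ofData d).conjugate r
    pure (d, s, [])) :=
  (ofInstr .gate fun i d r o ho => by
    obtain ⟨s, _, ho⟩ := Wt.exists_of_mem_supp_bind ho
    rw [Wt.mem_supp_pure] at ho
    subst ho
    simp).congr fun i d r _ => Wt.ext_ex fun φ => by simp [Prog.eval]

theorem measure : Act F w fun _ d r => (do
    let x ← measureReg d.len r
    pure (x.1, x.2, [])) :=
  (ofInstr .measure fun i d r o ho => by
    obtain ⟨s, _, ho⟩ := Wt.exists_of_mem_supp_bind ho
    rw [Wt.mem_supp_pure] at ho
    subst ho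
    simp).congr fun i d r _ => Wt.ext_ex fun φ => by simp [Prog.eval]

theorem ofProg {P : Prog} (hP : P.PolyTime) : Act F w fun _ d r => (do
    let x ← P.exec d r
    pure (x.1, x.2, [])) := by
  obtain ⟨p, hp⟩ := hP
  refine ⟨P.strip, p, fun i d r hr => ⟨fun φ => by simp [wp_strip], fun o ho => ?_⟩⟩
  rw [P.eval_strip] at ho
  obtain ⟨o, ho', ho⟩ := Wt.exists_of_mem_supp_bind ho
  rw [Wt.mem_supp_pure] at ho
  subst ho
  exact (hp d r hr o ho').trans (eval_mono p (by omega))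

/-- The new program works on no qubits, and hides the qubits that are there. -/
theorem toGen (hg : Act F w g) : Gen F w fun i d => g i d .empty := by
  obtain ⟨P, p, h1⟩ := hg
  refine ⟨.comp (.pair .nil .id) (.frame P), p + (4 * Polynomial.X + 5), fun i d r hr => ⟨?_, ?_⟩⟩
  · intro φ
    simp only [wp_comp, wp_pair, wp_nil, wp_id, wp_frame, Data.fst_node, Data.snd_node, Data.len,
      Nat.sub_zero, Reg.drop_len hr, Reg.take_len hr, List.append_nil]
    rw [(h1 i d .empty rfl).1]
    simp
  · intro o ho
    obtain ⟨o1, ho1, ho⟩ := Wt.exists_of_mem_supp_bind ho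
    obtain ⟨o2, ho2, rfl⟩ := mem_supp_andThen ho
    have e : Prog.eval (F i) (.pair .nil .id) d r =
        pure ⟨.node .nil d, r, [], (d.size + 1) + (d.size + 1) + (d.size + 1)⟩ :=
      Wt.ext_ex fun φ => by simp [Prog.eval, ex_tick, ex_andThen]
    rw [e, Wt.mem_supp_pure] at ho1
    subst ho1
    obtain ⟨o3, ho3, rfl⟩ := mem_supp_tick ho2
    obtain ⟨o4, ho4, ho5⟩ := Wt.exists_of_mem_supp_bind ho3
    rw [Wt.mem_supp_pure] at ho5
    subst ho5
    simp only [Data.fst_node, Data.snd_node, Data.len, Nat.sub_zero, Reg.drop_len hr] at ho4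
    have := (h1 i d .empty rfl).2 o4 ho4
    simp only [Reg.len_empty, add_zero] at this
    simp only [Polynomial.eval_add, Polynomial.eval_mul, Polynomial.eval_X, Polynomial.eval_ofNat,
      Data.size]
    omega

end Act

/-- Runs `f` on `node x ctx` for every entry `x` of a list, and puts the outcomes in front of the list
`acc`, so that they are in reverse order. -/
noncomputable def collect (f : Data → Wt Res) (ctx : Data) : Data → Data → Wt Res
  | .nil, acc => pure (acc, .empty, [])
  | .node x c, acc => do
    let y ← f (.node x ctx)
    let z ← collect f ctx c (.node y.1 acc)
    pure (z.1, y.2.1.append z.2.1, y.2.2 ++ z.2.2)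

/-- The body of the loop that computes `collect`. -/
def Prog.collectStep (P : Prog) : Prog :=
  .pair (.comp .snd .fst) (.pair (.comp (.pair .fst (.comp .snd .fst)) P) (.comp .snd .snd))

theorem Prog.ex_eval_collectStep (O : Data → Wt Data) (P : Prog) (x e : Data) (r : Reg)
    (φ : Out → ℂ) :
    ((collectStep P).eval O (.node x e) r).ex φ = (P.eval O (.node x e.fst) r).ex fun o =>
      φ ⟨.node e.fst (.node o.data e.snd), o.reg, o.log,
        o.time + 7 * (Data.node x e).size + 3 * e.size + 10⟩ := by
  simp only [collectStep, eval, ex_tick, ex_andThen, Wt.ex_bind, Wt.ex_pure, Data.fst_node,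
    Data.snd_node, List.append_nil, List.nil_append]
  refine congrArg _ (funext fun o => ?_)
  congr 2
  ring

namespace Gen

variable {f g : ι → Data → Wt Res}

theorem congr (hf : Gen F w f) (h : ∀ i d, g i d = f i d) : Gen F w g := by
  rwa [show g = f from funext fun i => funext fun d => h i d]

theorem toAct (hf : Gen F w f) : Act F w fun i d r => (do
    let x ← f i d
    pure (x.1, r.append x.2.1, x.2.2)) := by
  obtain ⟨P, p, h1⟩ := hf
  refine ⟨P, p, fun i d r hr => ⟨fun φ => ?_, fun o ho => ?_⟩⟩
  · simp [(h1 i d r hr).1]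
  · exact ((h1 i d r hr).2 o ho).trans (eval_mono p (by omega))

theorem ofDet {f : Data → Data} (hf : Det f) : Gen F w fun _ d => pure (f d, .empty, []) :=
  Act.toGen (Act.ofDet hf)

theorem square (hf : Gen F w f) {i : ι} {d : Data} : ∀ x ∈ (f i d).supp, x.2.1.Square := by
  obtain ⟨P, p, h1⟩ := hf
  exact square_of_wp_eq (P := P) (O := F i) (d := d) Reg.square_empty fun φ => by
    simpa using (h1 i d .empty rfl).1 φ

theorem comp (hf : Gen F w f) (hg : Gen F w g) : Gen F w fun i d => (do
    let x ← f i d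
    let y ← g i x.1
    pure (y.1, x.2.1.append y.2.1, x.2.2 ++ y.2.2)) :=
  (hf.toAct.comp hg.toAct).toGen.congr fun i d => Wt.ext_ex fun φ => by simp

theorem pair (hf : Gen F w f) (hg : Gen F w g) : Gen F w fun i d => (do
    let x ← f i d
    let y ← g i d
    pure (.node x.1 y.1, x.2.1.append y.2.1, x.2.2 ++ y.2.2)) :=
  (hf.toAct.pair hg.toAct).toGen.congr fun i d => Wt.ext_ex fun φ => by simp

/-- Further processing of all qubits that were generated. -/
theorem act {h : ι → Data → Reg → Wt Res} (hf : Gen F w f) (hh : Act F w h) :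
    Gen F w fun i d => (do
      let x ← f i d
      let y ← h i x.1 x.2.1
      pure (y.1, y.2.1, x.2.2 ++ y.2.2)) :=
  (hf.toAct.comp hh).toGen.congr fun i d => Wt.ext_ex fun φ => by simp

theorem map (hf : Gen F w f) {h : Data → Data} (hh : Det h) : Gen F w fun i d => (do
    let x ← f i d
    pure (h x.1, x.2.1, x.2.2)) :=
  (hf.comp (ofDet hh)).congr fun i d => Wt.ext_ex fun φ => by simp

theorem comap (hf : Gen F w f) {h : Data → Data} (hh : Det h) : Gen F w fun i d => f i (h d) :=
  ((ofDet hh).comp hf).congr fun i d => Wt.ext_ex fun φ => by simp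

theorem collect (hf : Gen F w f) :
    Gen F w fun i d => collect (f i) d.snd.fst d.fst d.snd.snd := by
  obtain ⟨P, p, h1⟩ := hf
  refine Gen.congr (f := fun i d => (SKL.collect (f i) d.snd.fst d.fst d.snd.snd)) ?_
    fun i d => rfl
  refine ⟨.comp (.fold P.collectStep) .snd,
    2 * (Polynomial.X * (p + 7 * (Polynomial.X + Polynomial.X +
      Polynomial.X * (p + 1) + Polynomial.X + 2) + 3 * (Polynomial.X +
      Polynomial.X * (p + 1) + Polynomial.X + 1) + 10) + (Polynomial.X + 1)) + 1,
    fun i d r hr => ⟨?_, ?_⟩⟩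
  · intro φ
    rw [wp_comp, wp_fold]
    simp only [wp_snd, List.append_nil]
    generalize d.snd = e
    have key : ∀ c (e : Data) r, r.Square → ∀ φ : Data → Reg → List Data → ℂ,
        (wp (F i) (.fold P.collectStep) (.node c e) r fun d' r' l => φ d'.snd r' l) =
          (SKL.collect (f i) e.fst c e.snd).ex fun x => φ x.1 (r.append x.2.1) x.2.2 := by
      intro c
      induction c with
      | nil => intro e r _ φ; simp [SKL.collect]
      | node x c _ ih =>
        intro e r hr φ
        rw [wp_fold_node, wp, Prog.ex_eval_collectStep]
        simp only [SKL.collect, Wt.ex_bind, Wt.ex_pure]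
        have h2 := (h1 i (.node x e.fst) r hr).1 fun a s l =>
          wp (F i) (.fold P.collectStep) (.node c (.node e.fst (.node a e.snd))) s
            fun d'' r'' l' => φ d''.snd r'' (l ++ l')
        rw [wp] at h2
        rw [h2]
        refine Wt.ex_congr fun y hy => ?_
        have hs : (r.append y.2.1).Square := hr.append (square ⟨P, p, h1⟩ y hy)
        rw [ih _ _ hs fun a s l => φ a s (y.2.2 ++ l)]
        simp [Reg.append_assoc]
    exact key d.fst e r hr φ
  · intro o ho
    obtain ⟨o1, ho1, ho⟩ := Wt.exists_of_mem_supp_bind ho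
    obtain ⟨o2, ho2, rfl⟩ := mem_supp_andThen ho
    rw [Prog.eval, Wt.mem_supp_pure] at ho2
    subst ho2
    obtain ⟨o3, ho3, rfl⟩ := mem_supp_tick ho1
    set W := w i + d.size with hW
    have hd := d.size_fst_add_snd
    have hd2 := d.snd.size_fst_add_snd
    have hl := d.fst.len_le_size
    set G := p.eval W with hG
    have hJ : ∀ j, j ≤ d.fst.len → j * (G + 1) ≤ W * (G + 1) := fun j hj =>
      Nat.mul_le_mul_right _ (by omega)
    have hinv := foldData_time (f := P.collectStep.eval (F i)) (X := d.fst.size)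
      (T := G + 7 * (W + W + W * (G + 1) + W + 2) + 3 * (W + W * (G + 1) + W + 1) + 10)
      (J := d.fst.len)
      (I := fun j e r => r.Square ∧ e.fst = d.snd.fst ∧
        e.snd.size ≤ d.snd.snd.size + j * (G + 1)) ?_ d.fst le_rfl 0 d.snd r (by simp)
        ⟨hr, rfl, by simp⟩ o3 ho3
    · have hT : ∀ T, d.fst.len * T ≤ W * T := fun T => Nat.mul_le_mul_right _ (by omega)
      have h5 := hinv.trans (hT _)
      have hsz := ((Prog.fold P.collectStep).bounds_of_mem_supp_eval (F i) d r hr _ ho1).2.1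
      simp only at hsz
      simp only [Polynomial.eval_add, Polynomial.eval_mul, Polynomial.eval_X,
        Polynomial.eval_ofNat, Polynomial.eval_one]
      rw [← hG]
      omega
    · rintro j x e s hj hx ⟨hs, he1, he2⟩ o ho
      have e1 : P.collectStep.eval (F i) (.node x e) s = P.eval (F i) (.node x e.fst) s >>=
          fun o => pure ⟨.node e.fst (.node o.data e.snd), o.reg, o.log,
            o.time + 7 * (Data.node x e).size + 3 * e.size + 10⟩ :=
        Wt.ext_ex fun φ => by rw [Prog.ex_eval_collectStep]; simp
      rw [e1] at ho
      obtain ⟨q, hq, ho⟩ := Wt.exists_of_mem_supp_bind ho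
      rw [Wt.mem_supp_pure] at ho
      subst ho
      have h6 := P.bounds_of_mem_supp_eval _ _ _ hs q hq
      have hx' : x.size + d.snd.size + 1 ≤ d.size := by
        cases d with
        | nil => simp [Data.len] at hj
        | node a b => simp only [Data.size, Data.snd_node, Data.fst_node] at hx ⊢; omega
      have h7 := ((h1 i _ s hs).2 q hq).trans (eval_mono p (b := W) (by
        rw [he1]
        simp only [Data.size]
        omega))
      have h8 := e.size_le_fst_add_snd
      have h9 := hJ j hj.le
      simp only [Data.size, Data.fst_node, Data.snd_node]
      have h10 : (j + 1) * (G + 1) = j * (G + 1) + (G + 1) := Nat.succ_mul _ _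
      refine ⟨by rw [he1] at h8; omega, h6.1, he1, by omega⟩

end Gen

end actions
end SKL

namespace SKL

/-! ### Measuring all qubits, running circuits, and random bits -/

namespace Data

@[simp] theorem toList_ofList (l : List Data) : (ofList l).toList = l := by
  induction l with
  | nil => rfl
  | cons x l ih => simp [ofList, toList, ih]

@[simp] theorem len_ofList (l : List Data) : (ofList l).len = l.length := by
  induction l with
  | nil => rfl
  | cons x l ih => simp [ofList, len, ih]

@[simp] theorem length_toList (d : Data) : d.toList.length = d.len := by
  induction d with
  | nil => rfl
  | node x c _ ih => simp [toList, len, ih]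

@[simp] theorem ofList_toList (d : Data) : ofList d.toList = d := by
  induction d with
  | nil => rfl
  | node x c _ ih => simp [toList, ofList, ih]

@[simp] theorem len_ofNat (n : ℕ) : (ofNat n).len = n := by
  simp [ofNat]

theorem ofNat_succ (n : ℕ) : ofNat (n + 1) = node nil (ofNat n) := rfl

/-- Puts the list of bits in front of the list `acc`. -/
def consBits (x : List Bool) (acc : Data) : Data := x.foldr (fun b a => node (ofBool b) a) acc

theorem consBits_nil (x : List Bool) : consBits x nil = ofBits x := by
  induction x with
  | nil => rfl
  | cons b x ih =>
    change node (ofBool b) (consBits x nil) = _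
    rw [ih]
    rfl

end Data

/-- Measures the last qubit, and puts the outcome in front of a list. -/
def Prog.measureStep : Prog := .pair (.comp .numQ (.comp .snd .measure)) .snd

theorem Prog.ex_eval_measureStep (O : Data → Wt Data) (x e : Data) (r : Reg) (φ : Out → ℂ) :
    (measureStep.eval O (.node x e) r).ex φ = (measureReg (r.len - 1) r).ex fun y =>
      φ ⟨.node y.1 e, y.2, [],
        3 * (Data.node x e).size + r.len + 3 + (Data.ofNat r.len).size +
          (Data.ofNat r.len).snd.size + 2⟩ := by
  have : (Data.ofNat r.len).snd.len = r.len - 1 := by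
    cases r.len <;> simp [Data.ofNat_succ]
    rfl
  simp only [measureStep, eval, ex_tick, ex_andThen, Wt.ex_bind, Wt.ex_pure, Data.snd_node,
    List.append_nil, this]
  refine congrArg _ (funext fun y => ?_)
  congr 2
  ring

namespace Act

variable {ι : Type} {F : ι → Data → Wt Data} {w : ι → ℕ}

open Classical in
/-- Measures all qubits. -/
theorem measureAll : Act F w fun _ _ r =>
    if r.ket = r.bra then pure (.ofBits r.ket, .empty, []) else 0 := by
  refine ⟨.comp (.pair .numQ .nil) (.fold .measureStep),
    100 * (Polynomial.X + 1) ^ 2, fun i d r hr => ⟨fun φ => ?_, ?_⟩⟩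
  · simp only [wp_comp, wp_pair, wp_numQ, wp_nil, List.append_nil, List.nil_append]
    have key : ∀ (N : ℕ) (k b : List Bool) (acc : Data), k.length = N → b.length = N →
        wp (F i) (.fold .measureStep) (.node (.ofNat N) acc) ⟨k, b⟩ φ =
          if k = b then φ (Data.consBits k acc) .empty [] else 0 := by
      intro N
      induction N with
      | zero =>
        intro k b acc hk hb
        rw [List.length_eq_zero_iff] at hk hb
        subst hk hb
        exact wp_fold_nil _ _ _ _ _
      | succ N ih =>
        intro k b acc hk hb
        obtain ⟨k', x, rfl⟩ : ∃ k' x, k = k' ++ [x] :=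
          ⟨_, _, (List.dropLast_append_getLast (by rintro rfl; simp at hk)).symm⟩
        obtain ⟨b', y, rfl⟩ : ∃ b' y, b = b' ++ [y] :=
          ⟨_, _, (List.dropLast_append_getLast (by rintro rfl; simp at hb)).symm⟩
        simp only [List.length_append, List.length_singleton, Nat.add_right_cancel_iff] at hk hb
        rw [Data.ofNat_succ, wp_fold_node, wp, Prog.ex_eval_measureStep]
        have h1 : (k' ++ [x])[N]? = some x := by simp [← hk]
        have h2 : (b' ++ [y])[N]? = some y := by simp [← hb]
        have h3 : (k' ++ [x]).eraseIdx N = k' := by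
          rw [List.eraseIdx_append_of_length_le hk.le]
          simp [hk]
        have h4 : (b' ++ [y]).eraseIdx N = b' := by
          rw [List.eraseIdx_append_of_length_le hb.le]
          simp [hb]
        have h5 : (Reg.mk (k' ++ [x]) (b' ++ [y])).len - 1 = N := by simp [Reg.len, hk]
        rw [h5, measureReg]
        simp only [h1, h2, h3, h4]
        by_cases hxy : x = y
        · subst hxy
          simp [ih k' b' _ hk hb, Data.consBits]
        · have : k' ++ [x] ≠ b' ++ [y] := fun e => hxy (by
            have := (List.append_inj e (hk.trans hb.symm)).2
            simpa using this)
          simp [hxy, this]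
    have := key r.len r.ket r.bra .nil rfl hr.symm
    rw [show (⟨r.ket, r.bra⟩ : Reg) = r from rfl] at this
    rw [this, Data.consBits_nil]
    split_ifs <;> simp
  · intro o ho
    obtain ⟨o1, ho1, ho2⟩ := Wt.exists_of_mem_supp_bind ho
    obtain ⟨o2, ho3, rfl⟩ := mem_supp_andThen ho2
    have e : Prog.eval (F i) (.pair .numQ .nil) d r =
        pure ⟨.node (.ofNat r.len) .nil, r, [], (d.size + r.len + 1) + (d.size + 1) + (d.size + 1)⟩ :=
      Wt.ext_ex fun φ => by simp [Prog.eval, ex_tick, ex_andThen]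
    rw [e, Wt.mem_supp_pure] at ho1
    subst ho1
    obtain ⟨o3, ho4, rfl⟩ := mem_supp_tick ho3
    have hinv := foldData_time (f := Prog.measureStep.eval (F i)) (X := r.len)
      (T := 3 * (r.len + 2 * r.len + 1) + r.len + 3 + r.len + r.len + 2)
      (J := r.len) (I := fun j e s => s.Square ∧ s.len ≤ r.len ∧ e.size ≤ 2 * j) ?_
      (Data.ofNat r.len) (by simp) 0 .nil r (by simp) ⟨hr, le_rfl, by simp [Data.size]⟩ o3 ho4
    · rw [Data.len_ofNat] at hinv
      simp only [Polynomial.eval_add, Polynomial.eval_mul, Polynomial.eval_X,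
        Polynomial.eval_ofNat, Polynomial.eval_one, Polynomial.eval_pow, Data.size,
        Data.size_ofNat]
      set W := w i + d.size + r.len + 1
      have h1 : r.len * (3 * (r.len + 2 * r.len + 1) + r.len + 3 + r.len + r.len + 2) ≤
        W * (20 * W) := Nat.mul_le_mul (by omega) (by omega)
      have h2 : W * (20 * W) = 20 * W ^ 2 := by ring
      have h3 : W ≤ W ^ 2 := Nat.le_self_pow two_ne_zero W
      generalize W ^ 2 = V at *
      omega
    · rintro j x e s hj hx ⟨hs, hl, he⟩ o ho
      have e1 : Prog.measureStep.eval (F i) (.node x e) s = measureReg (s.len - 1) s >>=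
          fun y => pure ⟨.node y.1 e, y.2, [],
            3 * (Data.node x e).size + s.len + 3 + (Data.ofNat s.len).size +
              (Data.ofNat s.len).snd.size + 2⟩ :=
        Wt.ext_ex fun φ => by rw [Prog.ex_eval_measureStep]; simp
      rw [e1] at ho
      obtain ⟨q, hq, ho⟩ := Wt.exists_of_mem_supp_bind ho
      rw [Wt.mem_supp_pure] at ho
      subst ho
      have h1 := square_of_mem_supp_measureReg hs hq
      have h2 := (Data.ofNat s.len).size_snd_le
      simp only [Data.size, Data.size_ofNat] at h2 ⊢
      exact ⟨by omega, h1.1, by omega, by omega⟩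

/-- Applies a list of gates. -/
theorem gates : Act F w fun _ d r => (do
    let k ← runCircuit (d.toList.map Gate.ofData) r.ket
    let b ← (runCircuit (d.toList.map Gate.ofData) r.bra).conj
    pure (.nil, ⟨k, b⟩, [])) := by
  refine ⟨.comp (.pair .id .nil) (.comp (.fold (.comp .fst .gate)) .nil),
    100 * (Polynomial.X + 1) ^ 2, fun i d r hr => ⟨fun φ => ?_, ?_⟩⟩
  · simp only [wp_comp, wp_pair, wp_nil, wp_id, List.append_nil, List.nil_append]
    have key : ∀ (c e : Data) (r : Reg) (l : List Data),
        (wp (F i) (.fold (.comp .fst .gate)) (.node c e) r fun _ r' l' => φ .nil r' (l ++ l')) =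
          (runCircuit (c.toList.map Gate.ofData) r.ket).ex fun k =>
            (runCircuit (c.toList.map Gate.ofData) r.bra).conj.ex fun b => φ .nil ⟨k, b⟩ l := by
      intro c
      induction c with
      | nil => intro e r l; simp [Data.toList, runCircuit]
      | node x c _ ih =>
        intro e r l
        rw [wp_fold_node]
        simp only [wp_comp, wp_fst, Data.fst_node, wp_gate, Gate.ex_conjugate, List.append_nil,
          List.nil_append, ih, Data.toList, List.map_cons, runCircuit, Wt.conj_bind, Wt.ex_bind]
        refine congrArg _ (funext fun k => ?_)
        exact Wt.ex_comm _ _ _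
    have := key d .nil r []
    simpa using this
  · intro o ho
    obtain ⟨o1, ho1, ho2⟩ := Wt.exists_of_mem_supp_bind ho
    obtain ⟨o2, ho3, rfl⟩ := mem_supp_andThen ho2
    have e : Prog.eval (F i) (.pair .id .nil) d r =
        pure ⟨.node d .nil, r, [], (d.size + 1) + (d.size + 1) + (d.size + 1)⟩ :=
      Wt.ext_ex fun φ => by simp [Prog.eval, ex_tick, ex_andThen]
    rw [e, Wt.mem_supp_pure] at ho1
    subst ho1
    obtain ⟨o3, ho4, ho5⟩ := Wt.exists_of_mem_supp_bind ho3
    obtain ⟨o4, ho6, rfl⟩ := mem_supp_andThen ho5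
    rw [Prog.eval, Wt.mem_supp_pure] at ho6
    subst ho6
    have hb := (Prog.fold (.comp .fst .gate)).bounds_of_mem_supp_eval (F i) _ r hr _ ho4
    obtain ⟨o5, ho7, rfl⟩ := mem_supp_tick ho4
    have hinv := foldData_time (f := (Prog.comp .fst .gate).eval (F i)) (X := d.size)
      (T := d.size + d.size + 1 + 1 + d.size + 1) (J := d.len) (I := fun j e s => e.size ≤ d.size) ?_
      d le_rfl 0 .nil r (by simp) (by simp [Data.size]) o5 ho7
    · simp only [Data.size] at hb
      simp only [Polynomial.eval_add, Polynomial.eval_mul, Polynomial.eval_X,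
        Polynomial.eval_ofNat, Polynomial.eval_one, Polynomial.eval_pow, Data.size]
      set W := w i + d.size + r.len + 1
      have h1 : d.len * (d.size + d.size + 1 + 1 + d.size + 1) ≤ W * (10 * W) :=
        Nat.mul_le_mul (by have := d.len_le_size; omega) (by omega)
      have h2 : W * (10 * W) = 10 * W ^ 2 := by ring
      have h4 : W ≤ W ^ 2 := Nat.le_self_pow two_ne_zero W
      generalize W ^ 2 = V at *
      omega
    · intro j x e s hj hx he o ho
      obtain ⟨o1, ho1, ho2⟩ := Wt.exists_of_mem_supp_bind ho
      obtain ⟨o2, ho3, rfl⟩ := mem_supp_andThen ho2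
      rw [Prog.eval, Wt.mem_supp_pure] at ho1
      subst ho1
      obtain ⟨q, hq, ho⟩ := Wt.exists_of_mem_supp_bind ho3
      rw [Wt.mem_supp_pure] at ho
      subst ho
      simp only [Data.size, Data.fst_node]
      exact ⟨by omega, hx⟩

end Act

/-- A uniformly random bit. -/
noncomputable def coin : Wt Bool :=
  (1 / 2 : ℂ) • (pure false : Wt Bool) + (1 / 2 : ℂ) • (pure true : Wt Bool)

namespace Gen

variable {ι : Type} {F : ι → Data → Wt Data} {w : ι → ℕ}

/-- A random bit is the outcome of the measurement of `H|0⟩`. -/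
theorem coin : Gen F w fun _ _ => (do
    let b ← SKL.coin
    pure (.ofBool b, .empty, [])) := by
  have hc : Det fun _ => Data.node .nil .nil := Det.nil.pair Det.nil
  have := ((((Act.ofDet (F := F) (w := w) Det.nil).comp Act.newQ).comp (Act.ofDet hc)).comp
    Act.gate).comp ((Act.ofDet Det.nil).comp Act.measure)
  refine this.toGen.congr fun i d => Wt.ext_ex fun φ => ?_
  have h0 : [false][0]? = some false := rfl
  have hs : ((1 / Real.sqrt 2 : ℝ) : ℂ) * ((1 / Real.sqrt 2 : ℝ) : ℂ) = 1 / 2 := by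
    rw [← Complex.ofReal_mul, div_mul_div_comm, Real.mul_self_sqrt (by norm_num)]
    norm_num
  simp only [Wt.ex_bind, Wt.ex_pure, Gate.ofData, Gate.ex_conjugate, Reg.append, Reg.empty,
    Data.isNil, Data.len, List.nil_append, Bool.not_true, Gate.ex_apply_had 0 [false] false h0,
    Gate.ex_conj_apply_had 0 [false] false h0, SKL.coin, Wt.ex_add, Wt.ex_smul]
  simp only [List.set_cons_zero, measureReg, List.getElem?_cons_zero, if_true, Wt.ex_pure,
    Bool.false_eq_true, Bool.true_eq_false, if_false, Wt.ex_zero, List.eraseIdx_zero,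
    List.tail_cons, Gate.sgn]
  linear_combination (-(φ (Data.ofBool false, ⟨[], []⟩, [])) - φ (Data.ofBool true, ⟨[], []⟩, [])) * hs

/-- A basis state of one qubit. -/
theorem newQ : Gen F w fun _ d => pure (.nil, ⟨[!d.isNil], [!d.isNil]⟩, []) :=
  (Act.newQ.comp (Act.ofDet Det.nil)).toGen.congr fun i d => Wt.ext_ex fun φ => by simp

theorem exec {P : Prog} (hP : P.PolyTime) : Gen F w fun _ d => (do
    let x ← P.exec d .empty
    pure (x.1, x.2, [])) :=
  (Act.ofProg hP).toGen

/-- The qubits that are traced out may as well be measured. -/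
theorem run {P : Prog} (hP : P.PolyTime) : Gen F w fun _ d => (do
    let a ← P.run d .empty
    pure (a, .empty, [])) := by
  have := (Act.ofProg (F := F) (w := w) hP).comp
    (((Act.ofDet Det.id).pair Act.measureAll).comp (Act.ofDet Det.fst))
  refine this.toGen.congr fun i d => Wt.ext_ex fun φ => ?_
  simp only [Prog.run, Wt.ex_bind, Wt.ex_pure, List.append_nil, traceOut]
  refine congrArg _ (funext fun x => ?_)
  split_ifs <;> simp

theorem query {p : ℕ[X]}
    (hp : ∀ i d, ∀ a ∈ (F i d).supp, a.size ≤ p.eval (w i + d.size)) :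
    Gen F w fun i d => (do
      let a ← F i d
      pure (a, .empty, [d])) := by
  refine ⟨.query, Polynomial.X + p + 1, fun i d r _ => ⟨fun φ => by simp, fun o ho => ?_⟩⟩
  obtain ⟨a, ha, ho⟩ := Wt.exists_of_mem_supp_bind ho
  rw [Wt.mem_supp_pure] at ho
  subst ho
  have := hp i d a ha
  simp only [Polynomial.eval_add, Polynomial.eval_X, Polynomial.eval_one]
  omega

end Gen

end SKL

namespace SKL

/-! ### Uniformly random strings -/

theorem Wt.IsDist.pure {α : Type} (a : α) : (Pure.pure a : Wt α).IsDist := by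
  classical
  refine ⟨fun b => ?_, fun b => ?_, by simp⟩ <;> rw [Wt.coeff_pure] <;> split_ifs <;> simp

theorem Wt.IsDist.bind {α β : Type} {x : Wt α} {f : α → Wt β} (hx : x.IsDist)
    (hf : ∀ a, (f a).IsDist) : (x >>= f).IsDist := by
  refine ⟨fun b => ?_, fun b => ?_, ?_⟩
  · rw [Wt.coeff_bind]
    exact hx.ex_re_nonneg fun a _ => (hf a).re_nonneg b
  · rw [Wt.coeff_bind, Wt.ex_eq_sum, Complex.im_sum]
    refine Finset.sum_eq_zero fun a _ => ?_
    rw [Complex.mul_im, hx.im_eq_zero, (hf a).im_eq_zero]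
    ring
  · simp only [Wt.ex_bind, (hf _).total, hx.total]

theorem isDist_coin : coin.IsDist := by
  classical
  refine ⟨fun b => ?_, fun b => ?_, by simp [coin]; norm_num⟩ <;>
  simp only [coin, Wt.coeff_add, Wt.coeff_smul, Wt.coeff_pure] <;> cases b <;> simp

theorem ex_coin (φ : Bool → ℂ) : coin.ex φ = 1 / 2 * φ false + 1 / 2 * φ true := by
  simp [coin]

/-- A uniformly random bit string of length `k`. -/
noncomputable def unif : ℕ → Wt (List Bool)
  | 0 => pure []
  | k + 1 => do
    let b ← coin
    let x ← unif k
    pure (b :: x)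

theorem isDist_unif (k : ℕ) : (unif k).IsDist := by
  induction k with
  | zero => exact .pure _
  | succ k ih => exact isDist_coin.bind fun b => ih.bind fun x => .pure _

theorem ex_unif_succ (k : ℕ) (φ : List Bool → ℂ) :
    (unif (k + 1)).ex φ = coin.ex fun b => (unif k).ex fun x => φ (b :: x) := by
  simp [unif]

theorem ex_unif_succ' (k : ℕ) : ∀ φ : List Bool → ℂ,
    (unif (k + 1)).ex φ = coin.ex fun b => (unif k).ex fun x => φ (x ++ [b]) := by
  induction k with
  | zero => intro φ; simp [unif]
  | succ k ih =>
    intro φ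
    conv_lhs => rw [ex_unif_succ]; simp only [ih]; rw [Wt.ex_comm]
    conv_rhs => simp only [ex_unif_succ]
    rfl

theorem ex_unif (k : ℕ) : ∀ φ : List Bool → ℂ,
    (unif k).ex φ = (1 / 2 ^ k : ℂ) * ∑ m : Fin k → Bool, φ (List.ofFn m) := by
  induction k with
  | zero => intro φ; simp [unif]
  | succ k ih =>
    intro φ
    rw [ex_unif_succ, ex_coin, ih, ih, ← (Fin.consEquiv fun _ => Bool).sum_comp,
      Fintype.sum_prod_type]
    simp only [Fin.consEquiv_apply, List.ofFn_succ, Fin.cons_zero, Fin.cons_succ, Fintype.univ_bool,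
      Finset.mem_singleton, Bool.true_eq_false, not_false_eq_true, Finset.sum_insert,
      Finset.sum_singleton]
    rw [pow_succ]
    field_simp
    ring

namespace Data

theorem ofBits_cons (b : Bool) (x : List Bool) : ofBits (b :: x) = node (ofBool b) (ofBits x) := rfl

theorem toList_ofBits (x : List Bool) : (ofBits x).toList = x.map ofBool := by simp [ofBits]

@[simp] theorem isNil_ofBool (b : Bool) : (ofBool b).isNil = !b := by cases b <;> rfl

/-- A list of data as a list of bits. -/
def toBits (d : Data) : List Bool := d.toList.map fun x => !x.isNil

@[simp] theorem toBits_ofBits (x : List Bool) : (ofBits x).toBits = x := by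
  simp [toBits, toList_ofBits, Function.comp_def]

/-- The list without as many entries as the first list has. -/
def drop (c l : Data) : Data := fold (fun d => d.snd.snd) c l

theorem toList_drop (c : Data) : ∀ l : Data, (drop c l).toList = l.toList.drop c.len := by
  induction c with
  | nil => exact fun l => rfl
  | node x c _ ih =>
    intro l
    change (drop c l.snd).toList = _
    rw [ih]
    cases l <;> simp [toList, len]

theorem len_drop (c l : Data) : (drop c l).len = l.len - c.len := by
  rw [← length_toList, toList_drop, List.length_drop, length_toList]

theorem fst_eq_getD (l : Data) : l.fst = l.toList.getD 0 nil := by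
  cases l <;> rfl

theorem fst_drop (c l : Data) : (drop c l).fst = l.toList.getD c.len nil := by
  rw [fst_eq_getD, toList_drop]
  simp [List.getD_eq_getElem?_getD]

/-- Reverses a list of pairs, keeps the first components only, and puts them in front of the
list `m`. -/
def revMapFst (l m : Data) : Data := fold (fun d => node d.fst.fst d.snd) l m

theorem revMapFst_ofList (l : List Data) : ∀ m : List Data,
    revMapFst (ofList l) (ofList m) = ofList ((l.map fst).reverse ++ m) := by
  induction l with
  | nil => intro m; rfl
  | cons x l ih =>
    intro m
    change revMapFst (ofList l) (ofList (x.fst :: m)) = _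
    rw [ih]
    simp

end Data

namespace Det

variable {f g : Data → Data}

theorem drop (hf : Det f) (hg : Det g) : Det fun d => Data.drop (f d) (g d) := by
  have h := (Det.snd.comp Det.snd).fold (fun _ => 0) 0 (by simp) (by simp) (fun x e => by
    have := e.size_snd_le
    simp
    omega)
  exact (hf.pair hg).comp h

theorem revMapFst (hf : Det f) (hg : Det g) : Det fun d => Data.revMapFst (f d) (g d) := by
  have h := ((Det.fst.comp Det.fst).pair Det.snd).fold (fun _ => 0) 1 (by simp) (by simp)
    (fun x e => by
      have := x.size_fst_le
      simp [Data.size]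
      omega)
  exact (hf.pair hg).comp h

end Det

/-! ### Reading the output of a circuit -/

namespace Data

/-- The stack of a machine that reads a bit string from right to left, and pushes a leaf for `0`, and
joins the two top trees for `1`. -/
def stack : List Bool → Data
  | [] => nil
  | false :: x => node nil (stack x)
  | true :: x => node (node (stack x).fst (stack x).snd.fst) (stack x).snd.snd

theorem length_parse_le (k : ℕ) : ∀ x, (parse k x).2.length ≤ x.length := by
  induction k with
  | zero => intro x; simp [parse]
  | succ k ih =>
    intro x
    match x with
    | [] => simp [parse]
    | false :: x => simp [parse]
    | true :: x =>
      have h1 := ih x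
      have h2 := ih (parse k x).2
      simp [parse]
      omega

theorem stack_eq (k : ℕ) : ∀ x, x.length ≤ k →
    (stack x).fst = (parse k x).1 ∧ (stack x).snd = stack (parse k x).2 := by
  induction k with
  | zero =>
    intro x hx
    rw [Nat.le_zero, List.length_eq_zero_iff] at hx
    subst hx
    exact ⟨rfl, rfl⟩
  | succ k ih =>
    intro x hx
    match x with
    | [] => exact ⟨rfl, rfl⟩
    | false :: x => exact ⟨rfl, rfl⟩
    | true :: x =>
      simp only [List.length_cons, Nat.add_le_add_iff_right] at hx
      have h1 := ih x hx
      have h2 := ih (parse k x).2 ((length_parse_le k x).trans hx)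
      simp only [stack, parse, fst_node, snd_node, h1, h2, and_self]

theorem ofCode_eq_stack (x : List Bool) : ofCode x = (stack x).fst :=
  (stack_eq _ x le_rfl).1.symm

/-- One step of the machine: a bit and the stack before. -/
def stackStep (d : Data) : Data :=
  if d.fst.isNil then node nil d.snd else node (node d.snd.fst d.snd.snd.fst) d.snd.snd.snd

theorem fold_stackStep (x : List Bool) : ∀ y : List Bool,
    fold stackStep (ofBits x) (stack y) = stack (x.reverse ++ y) := by
  induction x with
  | nil => intro y; rfl
  | cons b x ih =>
    intro y
    change fold stackStep (ofBits x) (stackStep (node (ofBool b) (stack y))) = _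
    rw [show stackStep (node (ofBool b) (stack y)) = stack (b :: y) by cases b <;> rfl, ih]
    simp

/-- Reverse list of the entries of the list `z` at the places in the list `c`. -/
def select (c z : Data) : Data :=
  (fold (fun d => node d.snd.fst (node (drop d.fst d.snd.fst).fst d.snd.snd)) c (node z nil)).snd

theorem select_ofBits (c : Data) (x : List Bool) :
    select c (ofBits x) = ofBits (c.toList.map fun i => x.getD i.len false).reverse := by
  have : ∀ (c : Data) (y : List Bool),
      (fold (fun d => node d.snd.fst (node (drop d.fst d.snd.fst).fst d.snd.snd)) c
        (node (ofBits x) (ofBits y))).snd =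
        ofBits ((c.toList.map fun i => x.getD i.len false).reverse ++ y) := by
    intro c
    induction c with
    | nil => intro y; rfl
    | node i c _ ih =>
      intro y
      have h : (drop i (ofBits x)).fst = ofBool (x.getD i.len false) := by
        rw [fst_drop, toList_ofBits]
        simp only [List.getD_eq_getElem?_getD, List.getElem?_map]
        cases x[i.len]? <;> rfl
      simp only [fold, fst_node, snd_node, h]
      rw [← ofBits_cons, ih]
      simp [toList]
  exact (this c []).trans (by rw [List.append_nil])

/-- The datum that the outcome `z` of the measurement of all qubits stands for, if `c` is the list of
the output qubits. -/
def readOut (c z : Data) : Data := (fold stackStep (select c z) nil).fst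

theorem readOut_ofBits (c : Data) (x : List Bool) :
    readOut c (ofBits x) = ofCode (c.toList.map fun i => x.getD i.len false) := by
  rw [readOut, select_ofBits, ofCode_eq_stack]
  have := fold_stackStep (c.toList.map fun i => x.getD i.len false).reverse []
  rw [List.reverse_reverse, List.append_nil] at this
  rw [← this]
  rfl

/-- The code of a tree with two branches starts with the code of the left branch, after one bit. -/
theorem ofCode_tail {x : List Bool} {a b : Data} (h : ofCode x = node a b) : ofCode x.tail = a := by
  match x with
  | [] => exact absurd h (by simp [ofCode, parse])
  | false :: x => exact absurd h (by simp [ofCode, parse])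
  | true :: x => exact (node.inj h).1

end Data

namespace Det

variable {f g : Data → Data}

theorem readOut (hf : Det f) (hg : Det g) : Det fun d => Data.readOut (f d) (g d) := by
  have h1 : Det fun d => Data.node d.snd.fst (.node (Data.drop d.fst d.snd.fst).fst d.snd.snd) :=
    (Det.snd.comp Det.fst).pair
      (((Det.fst.drop (Det.snd.comp Det.fst)).comp Det.fst).pair (Det.snd.comp Det.snd))
  have hd : ∀ c l : Data, (Data.drop c l).size ≤ l.size := by
    intro c
    induction c with
    | nil => exact fun l => le_rfl
    | node x c _ ih => exact fun l => (ih l.snd).trans l.size_snd_le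
  have h2 := h1.fold (fun e => e.fst.size) (Polynomial.X + 2) (fun e => e.size_fst_le)
    (fun x e => by simp) (fun x e => by
      have h1 := (Data.drop x e.fst).size_fst_le.trans (hd x e.fst)
      have h2 := e.size_fst_add_snd
      simp [Data.size]
      omega)
  have h3 : Det fun d => Data.select (f d) (g d) :=
    ((hf.pair (hg.pair Det.nil)).comp h2).comp Det.snd
  have h4 : Det Data.stackStep := (Det.nil.pair Det.id).cond
    ((Det.fst.pair (Det.snd.comp Det.fst)).pair (Det.snd.comp Det.snd))
  have h5 := h4.fold (fun _ => 0) 2 (by simp) (by simp) (fun x e => by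
    have h1 := e.size_fst_add_snd
    have h2 := e.snd.size_fst_add_snd
    have h3 := Data.size_le_fst_add_snd e
    rw [Data.stackStep, Data.fst_node, Data.snd_node, Polynomial.eval_ofNat]
    by_cases hx : x.isNil = true
    · rw [if_pos hx]
      simp only [Data.size]
      omega
    · rw [if_neg hx]
      simp only [Data.size]
      omega)
  exact ((h3.pair Det.nil).comp h5).comp Det.fst

end Det

namespace Gen

variable {ι : Type} {F : ι → Data → Wt Data} {w : ι → ℕ}

theorem unif : Gen F w fun _ d => (do
    let x ← SKL.unif d.len
    pure (.ofBits x, .empty, [])) := by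
  refine ((Gen.coin (F := F) (w := w)).collect.comap
    (Det.id.pair (Det.nil.pair Det.nil))).congr fun i d => Wt.ext_ex fun φ => ?_
  have : ∀ (c ctx : Data) (y : List Bool) (φ : Res → ℂ),
      (SKL.collect (fun _ => do let b ← SKL.coin; pure (.ofBool b, .empty, [])) ctx c
        (.ofBits y)).ex φ = (SKL.unif c.len).ex fun x => φ (.ofBits (x ++ y), .empty, []) := by
    intro c ctx
    induction c with
    | nil => intro y φ; simp [SKL.collect, SKL.unif, Data.len]
    | node x c _ ih =>
      intro y φ
      simp only [SKL.collect, Wt.ex_bind, Wt.ex_pure, ← Data.ofBits_cons, ih, Data.len,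
        ex_unif_succ', Reg.empty_append, List.nil_append, List.append_assoc, List.singleton_append]
  have := this d .nil [] φ
  simp only [List.append_nil] at this
  simp only [Data.fst_node, Data.snd_node, Wt.ex_bind, Wt.ex_pure]
  exact this.symm

/-- Basis states of qubits, one for each entry of the list `f`. -/
theorem qubits {f : Data → Data} (hf : Det f) : Gen F w fun _ d =>
    pure (.nil, ⟨(f d).toBits, (f d).toBits⟩, []) := by
  refine ((((newQ (F := F) (w := w)).comap Det.fst).collect.comap
    (hf.pair (Det.nil.pair Det.nil))).map Det.nil).congr fun i d => Wt.ext_ex fun φ => ?_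
  have : ∀ (c acc : Data) (φ : Reg → List Data → ℂ),
      ((SKL.collect (fun d => pure (.nil, ⟨[!d.fst.isNil], [!d.fst.isNil]⟩, [])) .nil c acc).ex
        fun x => φ x.2.1 x.2.2) = φ ⟨c.toBits, c.toBits⟩ [] := by
    intro c
    induction c with
    | nil => intro acc φ; simp [SKL.collect, Data.toBits, Data.toList, Reg.empty]
    | node x c _ ih =>
      intro acc φ
      simp only [SKL.collect, Wt.ex_bind, Wt.ex_pure, Data.fst_node]
      rw [ih (.node .nil acc) fun s l => φ ((⟨[!x.isNil], [!x.isNil]⟩ : Reg).append s) ([] ++ l)]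
      simp [Data.toBits, Data.toList, Reg.append]
  simp only [Wt.ex_bind, Wt.ex_pure, Data.fst_node, Data.snd_node]
  exact (this (f d) .nil fun s l => φ (.nil, s, l)).symm

end Gen

end SKL

namespace SKL

/-! ### Random choice from a list -/

theorem Det.ite {c f g : Data → Data} (hc : Det c) (hf : Det f) (hg : Det g) :
    Det fun d => if (c d).isNil then f d else g d :=
  (hc.pair Det.id).comp (hf.cond hg)

namespace Data

/-- Deals the entries of a list alternately to two lists. -/
def deal (l : Data) : Data := fold (fun d => node (node d.fst d.snd.snd) d.snd.fst) l (node nil nil)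

/-- One half of the list `l`, depending on the bit `b`; a list with at most one entry is kept. -/
def halve (b l : Data) : Data :=
  if l.snd.isNil then l else if b.isNil then (deal l).fst else (deal l).snd

/-- Halves the list `l` as often as there are entries in `R`. -/
def sieve (R l : Data) : Data := fold (fun d => halve d.fst d.snd) R l

/-- All proper tails of a list. -/
def tails (c : Data) : Data :=
  (fold (fun d => node d.snd.fst.snd (node d.snd.fst.snd d.snd.snd)) c (node c nil)).snd

/-- A proper tail of the list `c` that is selected by the random bits `R`. -/
def choose (R c : Data) : Data := (sieve R (tails c)).fst

/-- The list of as many leaves as the list `c` has entries. -/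
def leaves (c : Data) : Data := fold (fun d => node nil d.snd) c nil

theorem toList_ofNat (n : ℕ) : (ofNat n).toList = List.replicate n nil := by simp [ofNat]

theorem leaves_eq (c : Data) : leaves c = ofNat c.len := by
  have : ∀ c e : Data, (fold (fun d => node nil d.snd) c e) =
      ofList (List.replicate c.len nil ++ e.toList) := by
    intro c
    induction c with
    | nil => intro e; simp [fold, len]
    | node x c _ ih =>
      intro e
      change fold _ c (node nil e) = _
      rw [ih]
      simp only [toList, len, List.replicate_succ', List.append_assoc, List.singleton_append]
  exact (this c nil).trans (by simp [toList, ofNat])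

theorem deal_aux (l : Data) : ∀ e o : Data, o.len ≤ e.len → e.len ≤ o.len + 1 →
    ∃ e' o' : Data, fold (fun d => node (node d.fst d.snd.snd) d.snd.fst) l (node e o) = node e' o' ∧
      o'.len ≤ e'.len ∧ e'.len ≤ o'.len + 1 ∧ e'.len + o'.len = e.len + o.len + l.len ∧
      (∀ t, t ∈ e'.toList ∨ t ∈ o'.toList ↔ t ∈ e.toList ∨ t ∈ o.toList ∨ t ∈ l.toList) ∧
      e'.size + o'.size = e.size + o.size + l.size := by
  induction l with
  | nil => exact fun e o h1 h2 => ⟨e, o, rfl, h1, h2, rfl, by simp [toList], rfl⟩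
  | node x l _ ih =>
    intro e o h1 h2
    obtain ⟨e', o', h3, h4, h5, h6, h7, h8⟩ := ih (node x o) e (by simp [len]; omega)
      (by simp [len]; omega)
    refine ⟨e', o', h3, h4, h5, by rw [h6]; simp only [len]; omega, fun t => ?_,
      by rw [h8]; simp only [size]; omega⟩
    rw [h7]
    simp only [toList, List.mem_cons]
    tauto

theorem deal_spec (l : Data) : ∃ e o : Data, deal l = node e o ∧ o.len ≤ e.len ∧
    e.len ≤ o.len + 1 ∧ e.len + o.len = l.len ∧
    (∀ t, t ∈ e.toList ∨ t ∈ o.toList ↔ t ∈ l.toList) ∧ e.size + o.size = l.size := by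
  obtain ⟨e, o, h1, h2, h3, h4, h5, h6⟩ := deal_aux l nil nil le_rfl (by simp)
  exact ⟨e, o, h1, h2, h3, by simpa [len] using h4, by simpa [toList] using h5,
    by simpa [size] using h6⟩

theorem isNil_snd_iff (l : Data) : l.snd.isNil ↔ l.len ≤ 1 := by
  match l with
  | nil => simp [isNil, len]
  | node x nil => simp [isNil, len]
  | node x (node y l) => simp [isNil, len]

theorem size_halve_le (b l : Data) : (halve b l).size ≤ l.size := by
  obtain ⟨e, o, h1, -, -, -, -, h2⟩ := deal_spec l
  rw [halve, h1]
  split_ifs <;> simp <;> omega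

/-- A nonempty list stays nonempty, and no entries are added. -/
theorem halve_spec (b l : Data) (hl : l ≠ nil) :
    halve b l ≠ nil ∧ ∀ t ∈ (halve b l).toList, t ∈ l.toList := by
  obtain ⟨e, o, h1, h2, h3, h4, h5, -⟩ := deal_spec l
  have h6 := isNil_snd_iff l
  rw [halve, h1]
  split_ifs with h h'
  · exact ⟨hl, fun t ht => ht⟩
  · refine ⟨?_, fun t ht => (h5 t).1 (Or.inl ht)⟩
    rintro rfl
    have h0 : nil.len = 0 := rfl
    rw [h6] at h
    omega
  · refine ⟨?_, fun t ht => (h5 t).1 (Or.inr ht)⟩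
    rintro rfl
    have h0 : nil.len = 0 := rfl
    rw [h6] at h
    omega

theorem sieve_spec (R : Data) : ∀ l : Data, l ≠ nil →
    sieve R l ≠ nil ∧ ∀ t ∈ (sieve R l).toList, t ∈ l.toList := by
  induction R with
  | nil => exact fun l hl => ⟨hl, fun t ht => ht⟩
  | node b R _ ih =>
    intro l hl
    have h1 := halve_spec b l hl
    have h2 := ih (halve b l) h1.1
    exact ⟨h2.1, fun t ht => h1.2 t (h2.2 t ht)⟩

theorem tails_ofNat (q : ℕ) : (tails (ofNat q)).toList = (List.range q).map ofNat := by
  have : ∀ (q : ℕ) (acc : Data),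
      (fold (fun d => node d.snd.fst.snd (node d.snd.fst.snd d.snd.snd)) (ofNat q)
        (node (ofNat q) acc)).snd.toList = (List.range q).map ofNat ++ acc.toList := by
    intro q
    induction q with
    | zero => intro acc; rfl
    | succ q ih =>
      intro acc
      have h : (ofNat (q + 1)).snd = ofNat q := rfl
      rw [ofNat_succ]
      simp only [fold, snd_node, fst_node]
      rw [ih, List.range_succ]
      simp [toList]
  exact (this q nil).trans (by simp [toList])

theorem choose_spec {q : ℕ} (hq : q ≠ 0) (R : Data) : ∃ j < q, choose R (ofNat q) = ofNat j := by
  have h0 : tails (ofNat q) ≠ nil := fun h => by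
    have := tails_ofNat q
    rw [h] at this
    simp [toList, hq] at this
  obtain ⟨h1, h2⟩ := sieve_spec R _ h0
  have h3 : choose R (ofNat q) ∈ (sieve R (tails (ofNat q))).toList := by
    rw [choose]
    revert h1
    cases sieve R (tails (ofNat q)) <;> simp [toList]
  have h4 := h2 _ h3
  rw [tails_ofNat, List.mem_map] at h4
  obtain ⟨j, hj, h5⟩ := h4
  exact ⟨j, List.mem_range.1 hj, h5.symm⟩

end Data

/-- Every entry of a list of length at most `2 ^ c` survives `c` random halvings with probability at
least `1 / 2 ^ c`. -/
theorem sieve_prob (ψ : Data → ℝ) (hψ : ∀ d, 0 ≤ ψ d) (t : Data) (k : ℕ) : ∀ (c : ℕ) (l : Data),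
    c ≤ k → l.len ≤ 2 ^ c → t ∈ l.toList →
    ψ (.node t .nil) / 2 ^ c ≤ ((unif k).ex fun R => (ψ (Data.sieve (.ofBits R) l) : ℂ)).re := by
  have hone : ∀ l : Data, l.len ≤ 1 → t ∈ l.toList → l = .node t .nil := by
    intro l h1 h2
    match l with
    | .nil => simp [Data.toList] at h2
    | .node x .nil => simp [Data.toList] at h2; rw [h2]
    | .node x (.node y l) => simp [Data.len] at h1
  induction k with
  | zero =>
    intro c l hc hl ht
    obtain rfl := Nat.le_zero.1 hc
    simp [unif, Data.sieve, Data.ofBits, Data.ofList, Data.fold, hone l (by simpa using hl) ht]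
  | succ k ih =>
    intro c l hc hl ht
    have hstep : ∀ b R, Data.sieve (.ofBits (b :: R)) l =
        Data.sieve (.ofBits R) (Data.halve (.ofBool b) l) := fun b R => rfl
    rw [ex_unif_succ, ex_coin]
    simp only [hstep]
    have hre : ∀ b, 0 ≤ ((unif k).ex fun R =>
        (ψ (Data.sieve (.ofBits R) (Data.halve (.ofBool b) l)) : ℂ)).re := fun b =>
      (isDist_unif k).ex_re_nonneg fun R _ => by simpa using hψ _
    have h2 : ∀ z : ℂ, (1 / 2 * z).re = z.re / 2 := fun z => by
      rw [show (1 / 2 : ℂ) = ((1 / 2 : ℝ) : ℂ) by push_cast; rfl, Complex.re_ofReal_mul]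
      ring
    rw [Complex.add_re, h2, h2]
    by_cases h : l.len ≤ 1
    · have hl1 := hone l h ht
      have hk : ∀ b, Data.halve b l = l := fun b => by
        rw [Data.halve, if_pos ((Data.isNil_snd_iff l).2 h)]
      simp only [hk]
      have h3 := ih 0 l (Nat.zero_le _) (by simpa using h) ht
      have h4 : ψ (.node t .nil) / 2 ^ c ≤ ψ (.node t .nil) / 2 ^ 0 :=
        div_le_div_of_nonneg_left (hψ _) (by norm_num) (by gcongr <;> simp)
      linarith
    · obtain ⟨c, rfl⟩ : ∃ c', c = c' + 1 := by
        refine Nat.exists_eq_succ_of_ne_zero ?_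
        rintro rfl
        exact h (by simpa using hl)
      obtain ⟨e, o, h3, h4, h5, h6, h7, -⟩ := Data.deal_spec l
      have hb : ∀ b, Data.halve (.ofBool b) l = if b then o else e := fun b => by
        rw [Data.halve, if_neg (by rw [Data.isNil_snd_iff]; exact h), h3]
        cases b <;> rfl
      rw [pow_succ] at hl
      rw [pow_succ, ← div_div]
      rcases (h7 t).2 ht with hm | hm
      · have h8 := ih c e (by omega) (by omega) hm
        have h9 := hre true
        simp only [hb, if_true, Bool.false_eq_true, if_false] at h9 ⊢
        linarith
      · have h8 := ih c o (by omega) (by omega) hm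
        have h9 := hre false
        simp only [hb, if_true, Bool.false_eq_true, if_false] at h9 ⊢
        linarith

/-- A random number below `q`. The distribution is uniform only up to a factor of two, since random
bits of a polynomial time program are fair coins. -/
noncomputable def pick (q : ℕ) : Wt ℕ := do
  let R ← unif q
  pure (Data.choose (.ofBits R) (.ofNat q)).len

theorem isDist_pick (q : ℕ) : (pick q).IsDist := (isDist_unif q).bind fun _ => .pure _

/-- Every number is picked with probability at least `1 / (2 * q)`. -/
theorem pick_prob {q j : ℕ} (hj : j < q) (ψ : ℕ → ℝ) (hψ : ∀ d, 0 ≤ ψ d) :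
    ψ j / (2 * q) ≤ ((pick q).ex fun i => (ψ i : ℂ)).re := by
  have h1 := sieve_prob (fun d => ψ d.fst.len) (fun _ => hψ _) (.ofNat j) q (Nat.clog 2 q)
    (Data.tails (.ofNat q))
    ((Nat.clog_le_iff_le_pow one_lt_two).2 Nat.lt_two_pow_self.le)
    (by rw [← Data.length_toList, Data.tails_ofNat]
        simpa using Nat.le_pow_clog one_lt_two q)
    (by rw [Data.tails_ofNat]
        exact List.mem_map_of_mem (List.mem_range.2 hj))
  have h2 : ((pick q).ex fun i => (ψ i : ℂ)) = (unif q).ex fun R =>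
      (ψ (Data.sieve (.ofBits R) (Data.tails (.ofNat q))).fst.len : ℂ) := by
    simp [pick, Data.choose]
  rw [h2]
  refine le_trans ?_ h1
  simp only [Data.fst_node, Data.len_ofNat]
  refine div_le_div_of_nonneg_left (hψ _) (by positivity) ?_
  have h3 : 2 ^ Nat.clog 2 q ≤ 2 * q := by
    rcases Nat.lt_or_ge 1 q with h | h
    · have h4 := Nat.pow_pred_clog_lt_self one_lt_two h
      have h5 : 0 < Nat.clog 2 q := Nat.clog_pos one_lt_two h
      obtain ⟨c, hc⟩ := Nat.exists_eq_succ_of_ne_zero h5.ne'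
      rw [hc] at h4 ⊢
      simp only [Nat.pred_succ] at h4
      rw [pow_succ]
      omega
    · have : q = 1 := by omega
      simp [this]
  exact_mod_cast h3

namespace Det

variable {f g : Data → Data}

theorem leaves (hf : Det f) : Det fun d => Data.leaves (f d) := by
  have h := (Det.nil.pair Det.snd).fold (fun _ => 0) 1 (by simp) (by simp)
    (fun x e => by simp [Data.size])
  exact (hf.pair Det.nil).comp h

theorem choose (hf : Det f) (hg : Det g) : Det fun d => Data.choose (f d) (g d) := by
  have h1 := ((Det.fst.pair (Det.snd.comp Det.snd)).pair (Det.snd.comp Det.fst)).fold (fun _ => 0) 2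
    (by simp) (by simp) (fun x e => by
      have := e.size_fst_add_snd
      simp [Data.size]
      omega)
  have hd : Det Data.deal := (Det.id.pair (Det.nil.pair Det.nil)).comp h1
  have hh : Det fun d => Data.halve d.fst d.snd :=
    (Det.snd.comp Det.snd).ite Det.snd (Det.fst.ite
      ((Det.snd.comp hd).comp Det.fst) ((Det.snd.comp hd).comp Det.snd))
  have hs := hh.fold (fun _ => 0) 0 (by simp) (by simp) (fun x e => by
    have := Data.size_halve_le x e
    simp
    omega)
  have h2 := (((Det.snd.comp Det.fst).comp Det.snd).pair
    (((Det.snd.comp Det.fst).comp Det.snd).pair (Det.snd.comp Det.snd))).fold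
    (fun e => e.fst.size) (Polynomial.X + 2) (fun e => e.size_fst_le)
    (fun x e => by simpa using e.fst.size_snd_le) (fun x e => by
      have h1 := e.fst.size_snd_le
      have h2 := e.size_fst_add_snd
      simp [Data.size]
      omega)
  have ht : Det Data.tails := ((Det.id.pair (Det.id.pair Det.nil)).comp h2).comp Det.snd
  exact ((hf.pair (hg.comp ht)).comp hs).comp Det.fst

end Det

end SKL

namespace SKL
open scoped ComplexOrder

/-! ### Observables that are given by matrices -/

section spectral

variable {κ : Type} [Fintype κ] [DecidableEq κ]

open scoped MatrixOrder in
/-- A positive semidefinite matrix dominates its spectral projections. -/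
theorem posSemidef_sub_smul_spectralProj {E : Matrix κ κ ℂ} (hE : E.PosSemidef) {t : ℝ} :
    (E - t • spectralProj E t).PosSemidef := by
  have hfin := fun f : ℝ → ℝ => (Matrix.finite_real_spectrum (A := E)).continuousOn f
  have hsa : IsSelfAdjoint E := hE.1
  rw [← Matrix.le_iff, spectralProj, ← cfc_const_mul t _ E (hfin _)]
  conv_rhs => rw [← cfc_id ℝ E]
  rw [cfc_le_iff _ _ E (hfin _) (hfin _)]
  intro x hx
  have := spectrum_nonneg_of_nonneg hE.nonneg hx
  simp only [id]
  split_ifs with h <;> linarith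

open scoped MatrixOrder in
/-- An effect is at most `t`, up to its spectral projection to the eigenvalues that are at least
`t`. -/
theorem posSemidef_spectralProj_add_sub {E : Matrix κ κ ℂ} (hE : E.PosSemidef)
    (hE1 : (1 - E).PosSemidef) {t : ℝ} (ht : 0 ≤ t) :
    (spectralProj E t + t • (1 : Matrix κ κ ℂ) - E).PosSemidef := by
  have hfin := fun f : ℝ → ℝ => (Matrix.finite_real_spectrum (A := E)).continuousOn f
  have hsa : IsSelfAdjoint E := hE.1
  have h1 : t • (1 : Matrix κ κ ℂ) = cfc (fun _ : ℝ => t) E := by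
    rw [cfc_const t E, Algebra.algebraMap_eq_smul_one]
  rw [← Matrix.le_iff, spectralProj, h1, ← cfc_add E _ _ (hfin _) (hfin _)]
  conv_lhs => rw [← cfc_id ℝ E]
  rw [cfc_le_iff _ _ E (hfin _) (hfin _)]
  intro x hx
  have h2 : E ≤ 1 := Matrix.le_iff.2 hE1
  rw [CFC.le_one_iff (R := ℝ) E] at h2
  have := h2 x hx
  simp only [id]
  split_ifs with h <;> linarith

open scoped MatrixOrder in
theorem posSemidef_spectralProj (E : Matrix κ κ ℂ) (t : ℝ) : (spectralProj E t).PosSemidef := by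
  rw [← Matrix.nonneg_iff_posSemidef, spectralProj]
  refine cfc_nonneg fun x _ => ?_
  split_ifs <;> norm_num

end spectral

open Classical in
/-- The trace of `|ket⟩⟨bra|` against the matrix for the number of qubits at hand. -/
noncomputable def matForm (M : ∀ N : ℕ, Matrix (Fin N → Bool) (Fin N → Bool) ℂ) (r : Reg) : ℂ :=
  if r.Square then M r.len (fun i => r.bra.getD i false) (fun i => r.ket.getD i false) else 0

theorem ofFn_getD {N : ℕ} {k : List Bool} (h : k.length = N) :
    (List.ofFn fun i : Fin N => k.getD i false) = k := by
  subst h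
  refine List.ext_getElem (by simp) fun i h1 h2 => ?_
  simp [List.getD_eq_getElem?_getD]

theorem getD_ofFn {N : ℕ} (x : Fin N → Bool) : (fun i : Fin N => (List.ofFn x).getD i false) = x := by
  funext i
  simp [List.getD_eq_getElem?_getD]

/-- Expectations over strings of length `N`. -/
theorem ex_eq_sum_ofFn {u : Wt (List Bool)} {N : ℕ} (h : ∀ k ∈ u.supp, k.length = N)
    (φ : List Bool → ℂ) :
    u.ex φ = ∑ x : Fin N → Bool, u.coeff (List.ofFn x) * φ (List.ofFn x) := by
  classical
  have hsub : u.supp ⊆ (Finset.univ : Finset (Fin N → Bool)).image List.ofFn := fun k hk =>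
    Finset.mem_image.2 ⟨_, Finset.mem_univ _, ofFn_getD (h k hk)⟩
  rw [Wt.ex_eq_sum_of_subset u φ hsub, Finset.sum_image]
  exact fun x _ y _ h => List.ofFn_injective h

theorem matForm_ofFn (M : ∀ N : ℕ, Matrix (Fin N → Bool) (Fin N → Bool) ℂ) {N : ℕ}
    (x y : Fin N → Bool) : matForm M ⟨List.ofFn x, List.ofFn y⟩ = M N y x := by
  have : ∀ (L : ℕ) (h : L = N), M L (fun i => (List.ofFn y).getD i false)
      (fun i => (List.ofFn x).getD i false) = M N y x := by
    rintro L rfl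
    rw [getD_ofFn, getD_ofFn]
  rw [matForm, if_pos (by simp [Reg.Square])]
  exact this _ (by simp [Reg.len])

theorem posForm_matForm {M : ∀ N : ℕ, Matrix (Fin N → Bool) (Fin N → Bool) ℂ}
    (hM : ∀ N, (M N).PosSemidef) : PosForm (matForm M) := by
  intro N u hu
  have h1 : (u.ex fun k => u.conj.ex fun b => matForm M ⟨k, b⟩) =
      star (fun x : Fin N → Bool => u.coeff (List.ofFn x)) ⬝ᵥ
        (M N).mulVec (fun x : Fin N → Bool => u.coeff (List.ofFn x)) := by
    rw [Wt.ex_comm, ex_eq_sum_ofFn (N := N) (by rwa [Wt.supp_conj])]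
    simp only [ex_eq_sum_ofFn hu, matForm_ofFn, Wt.coeff_conj, dotProduct, Matrix.mulVec]
    refine Finset.sum_congr rfl fun x _ => ?_
    refine congrArg _ (Finset.sum_congr rfl fun y _ => mul_comm _ _)
  rw [h1]
  exact (RCLike.le_iff_re_im.1 ((hM N).dotProduct_mulVec_nonneg _)).1

theorem PosForm.congr {φ ψ : Reg → ℂ} (hφ : PosForm φ) (h : ∀ r, r.Square → ψ r = φ r) :
    PosForm ψ := by
  intro N u hu
  have := hφ N u hu
  rw [Wt.ex_congr (ψ := fun k => u.conj.ex fun b => φ ⟨k, b⟩)]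
  · exact this
  · intro k hk
    refine Wt.ex_congr fun b hb => h _ ?_
    rw [Wt.supp_conj] at hb
    exact (hu k hk).trans (hu b hb).symm

theorem PosForm.add {φ ψ : Reg → ℂ} (hφ : PosForm φ) (hψ : PosForm ψ) :
    PosForm fun r => φ r + ψ r := by
  intro N u hu
  simp only [Wt.ex_add_right, Complex.add_re]
  exact add_nonneg (hφ N u hu) (hψ N u hu)

theorem PosForm.mul {φ : Reg → ℂ} (hφ : PosForm φ) {c : ℝ} (hc : 0 ≤ c) :
    PosForm fun r => (c : ℂ) * φ r := by
  intro N u hu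
  simp only [Wt.ex_mul_left, Complex.re_ofReal_mul]
  exact mul_nonneg hc (hφ N u hu)

theorem PosForm.zero : PosForm fun _ => 0 := by
  intro N u hu
  simp

theorem PosForm.sum {κ : Type*} {s : Finset κ} {φ : κ → Reg → ℂ} (h : ∀ i ∈ s, PosForm (φ i)) :
    PosForm fun r => ∑ i ∈ s, φ i r := by
  intro N u hu
  simp only [Wt.ex_sum_right, Complex.re_sum]
  exact Finset.sum_nonneg fun i hi => h i hi N u hu

/-! ### The effect of a quantum program -/

theorem length_of_mem_supp_runCircuit (gs : List Gate) : ∀ {x y : List Bool},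
    y ∈ (runCircuit gs x).supp → y.length = x.length := by
  induction gs with
  | nil =>
    intro x y h
    rw [runCircuit, Wt.mem_supp_pure] at h
    rw [h]
  | cons g gs ih =>
    intro x y h
    obtain ⟨z, hz, h⟩ := Wt.exists_of_mem_supp_bind h
    rw [ih h, g.length_of_mem_supp_apply _ _ hz]

open Classical in
/-- Circuits are unitary. -/
theorem inner_runCircuit (gs : List Gate) : ∀ {x y : List Bool}, x.length = y.length →
    ((runCircuit gs x).ex fun x' => (runCircuit gs y).conj.ex fun y' =>
      if x' = y' then 1 else 0) = if x = y then 1 else 0 := by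
  induction gs with
  | nil => intro x y _; simp [runCircuit]
  | cons g gs ih =>
    intro x y hxy
    simp only [runCircuit, Wt.conj_bind, Wt.ex_bind]
    rw [← g.inner_apply hxy]
    refine Wt.ex_congr fun x' hx' => ?_
    rw [Wt.ex_comm]
    refine Wt.ex_congr fun y' hy' => ?_
    rw [Wt.supp_conj] at hy'
    exact ih ((g.length_of_mem_supp_apply _ _ hx').trans
      (hxy.trans (g.length_of_mem_supp_apply _ _ hy').symm))

namespace QProgram

/-- The effect on `k` program qubits of the following event: the program is run on a uniformly random
message `m` of length `l`, all qubits are measured with outcome `z`, and `m` and `z` are accepted,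
which has probability `g m z`. -/
noncomputable def form (U : QProgram) (l : ℕ) (g : List Bool → List Bool → ℝ) (k : ℕ) :
    Matrix (Fin k → Bool) (Fin k → Bool) ℂ :=
  Matrix.of fun i j =>
    (1 / 2 ^ l : ℂ) * ∑ m : Fin l → Bool, ∑ z : Fin (l + k + U.anc) → Bool,
      (starRingEnd ℂ) ((U.final (List.ofFn m) (List.ofFn i)).coeff (List.ofFn z)) *
        (g (List.ofFn m) (List.ofFn z) : ℂ) *
        (U.final (List.ofFn m) (List.ofFn j)).coeff (List.ofFn z)

theorem effect_eq_form (U : QProgram) (l : ℕ) (acc : Data → Data → ℝ) (k : ℕ) :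
    U.effect l acc k = U.form l (fun m z => acc (.ofBits m) (U.output z)) k := rfl

variable (U : QProgram) (l : ℕ)

theorem form_add (g h : List Bool → List Bool → ℝ) (k : ℕ) :
    U.form l (fun m z => g m z + h m z) k = U.form l g k + U.form l h k := by
  ext i j
  simp only [form, Matrix.of_apply, Matrix.add_apply, ← mul_add, ← Finset.sum_add_distrib]
  push_cast
  refine congrArg _ (Finset.sum_congr rfl fun m _ => Finset.sum_congr rfl fun z _ => ?_)
  ring

theorem form_sub (g h : List Bool → List Bool → ℝ) (k : ℕ) :
    U.form l (fun m z => g m z - h m z) k = U.form l g k - U.form l h k := by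
  rw [eq_sub_iff_add_eq, ← form_add]
  simp

theorem posSemidef_form {g : List Bool → List Bool → ℝ} (hg : ∀ m z, 0 ≤ g m z) (k : ℕ) :
    (U.form l g k).PosSemidef := by
  let B : Matrix ((Fin l → Bool) × (Fin (l + k + U.anc) → Bool)) (Fin k → Bool) ℂ :=
    Matrix.of fun p j => (Real.sqrt (1 / 2 ^ l * g (List.ofFn p.1) (List.ofFn p.2)) : ℂ) *
      (U.final (List.ofFn p.1) (List.ofFn j)).coeff (List.ofFn p.2)
  have : U.form l g k = B.conjTranspose * B := by
    ext i j
    simp only [form, Matrix.of_apply, Matrix.mul_apply, Matrix.conjTranspose_apply, B,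
      Fintype.sum_prod_type, Finset.mul_sum]
    refine Finset.sum_congr rfl fun m _ => Finset.sum_congr rfl fun z _ => ?_
    have h1 : (Real.sqrt (1 / 2 ^ l * g (List.ofFn m) (List.ofFn z)) : ℂ) *
        (Real.sqrt (1 / 2 ^ l * g (List.ofFn m) (List.ofFn z)) : ℂ) =
        1 / 2 ^ l * g (List.ofFn m) (List.ofFn z) := by
      rw [← Complex.ofReal_mul, Real.mul_self_sqrt (mul_nonneg (by positivity) (hg _ _))]
      push_cast
      rfl
    simp only [star_mul', RCLike.star_def, Complex.conj_ofReal]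
    linear_combination -(starRingEnd ℂ) ((U.final (List.ofFn m) (List.ofFn i)).coeff (List.ofFn z)) *
      (U.final (List.ofFn m) (List.ofFn j)).coeff (List.ofFn z) * h1
  rw [this]
  exact Matrix.posSemidef_conjTranspose_mul_self B

/-- If acceptance does not depend on the measured qubits, the effect is a multiple of the
identity, as the circuit is unitary. -/
theorem form_const (g : List Bool → ℝ) (k : ℕ) : U.form l (fun m _ => g m) k =
    ((1 / 2 ^ l : ℝ) * ∑ m : Fin l → Bool, g (List.ofFn m)) • 1 := by
  classical
  ext i j
  have key : ∀ m : Fin l → Bool, (∑ z : Fin (l + k + U.anc) → Bool,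
      (starRingEnd ℂ) ((U.final (List.ofFn m) (List.ofFn i)).coeff (List.ofFn z)) *
        (g (List.ofFn m) : ℂ) * (U.final (List.ofFn m) (List.ofFn j)).coeff (List.ofFn z)) =
      if i = j then (g (List.ofFn m) : ℂ) else 0 := by
    intro m
    have hlen : ∀ i : Fin k → Bool, ∀ y ∈ (U.final (List.ofFn m) (List.ofFn i)).supp,
        y.length = l + k + U.anc := fun i y hy => by
      rw [length_of_mem_supp_runCircuit _ hy]
      simp [add_assoc]
    have h1 := inner_runCircuit U.gates
      (x := List.ofFn m ++ List.ofFn j ++ List.replicate U.anc false)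
      (y := List.ofFn m ++ List.ofFn i ++ List.replicate U.anc false) (by simp)
    change ((U.final (List.ofFn m) (List.ofFn j)).ex fun x' =>
      (U.final (List.ofFn m) (List.ofFn i)).conj.ex fun y' => if x' = y' then 1 else 0) = _ at h1
    rw [ex_eq_sum_ofFn (hlen j)] at h1
    simp only [ex_eq_sum_ofFn (u := (U.final (List.ofFn m) (List.ofFn i)).conj)
      (by rw [Wt.supp_conj]; exact hlen i), List.ofFn_inj, Wt.coeff_conj, mul_ite, mul_one,
      mul_zero, Finset.sum_ite_eq, Finset.mem_univ, if_true, List.append_cancel_right_eq,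
      List.append_cancel_left_eq] at h1
    have h2 : (if i = j then (g (List.ofFn m) : ℂ) else 0) =
        g (List.ofFn m) * if j = i then 1 else 0 := by
      by_cases h : i = j <;> simp [h, eq_comm]
    rw [h2, ← h1, Finset.mul_sum]
    exact Finset.sum_congr rfl fun z _ => by ring
  simp only [form, Matrix.of_apply, key, Matrix.smul_apply, Matrix.one_apply]
  by_cases h : i = j
  · simp [h]
  · simp [h]

theorem form_one (k : ℕ) : U.form l (fun _ _ => 1) k = 1 := by
  rw [form_const U l fun _ => 1]
  simp

/-- Running the program and measuring all qubits realizes the effect. -/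
theorem ex_run (g : List Bool → List Bool → ℝ) {r : Reg} (hr : r.Square) :
    ((unif l).ex fun m =>
      (runCircuit U.gates (m ++ r.ket ++ List.replicate U.anc false)).ex fun z =>
        (runCircuit U.gates (m ++ r.bra ++ List.replicate U.anc false)).conj.ex fun z' =>
          if z = z' then (g m z : ℂ) else 0) = matForm (U.form l g) r := by
  classical
  rw [ex_unif, matForm, if_pos hr, form, Matrix.of_apply]
  refine congrArg _ (Finset.sum_congr rfl fun m _ => ?_)
  rw [ofFn_getD (N := r.len) (k := r.ket) rfl, ofFn_getD (N := r.len) (k := r.bra) hr.symm]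
  have h1 : ∀ x : List Bool, x.length = r.len → ∀ y ∈ (runCircuit U.gates
      (List.ofFn m ++ x ++ List.replicate U.anc false)).supp, y.length = l + r.len + U.anc := by
    intro x hx y hy
    rw [length_of_mem_supp_runCircuit _ hy]
    simp [hx, add_assoc]
  rw [ex_eq_sum_ofFn (h1 r.ket rfl)]
  refine Finset.sum_congr rfl fun z _ => ?_
  rw [ex_eq_sum_ofFn (N := l + r.len + U.anc) (by rw [Wt.supp_conj]; exact h1 r.bra hr.symm)]
  simp only [List.ofFn_inj, mul_ite, mul_zero, Finset.sum_ite_eq, Finset.mem_univ, if_true,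
    Wt.coeff_conj, final]
  ring

end QProgram

theorem ex_projTest (r : Reg)
    (M : ∀ N : ℕ, Matrix (Fin N → Bool) (Fin N → Bool) ℂ) :
    ((projTest r (M r.len)).ex fun b => if b then 1 else 0) = matForm M r := by
  rw [projTest, matForm]
  split_ifs <;> simp

end SKL

namespace SKL

/-! ### Programs that simulate the compiled scheme -/

namespace Gen

variable {ι : Type} {F : ι → Data → Wt Data} {w : ι → ℕ} {S : DSSKL} {D : DigSig}

theorem digGen (hD : D.Efficient) : Gen F w fun _ d => (do
    let k ← D.gen d.len
    pure (.node k.1 k.2, .empty, [])) := by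
  obtain ⟨P, hP, h⟩ := hD.gen
  refine ((run hP).comap (Det.leaves Det.id)).congr fun i d => Wt.ext_ex fun φ => ?_
  rw [Data.leaves_eq, h]
  simp

theorem digSign (hD : D.Efficient) : Gen F w fun _ d => (do
    let s ← D.sign d.fst.len d.snd.fst d.snd.snd
    pure (s, .empty, [])) := by
  obtain ⟨P, hP, h⟩ := hD.sign
  refine ((run hP).comap ((Det.leaves Det.fst).pair
    ((Det.snd.comp Det.fst).pair (Det.snd.comp Det.snd)))).congr fun i d => ?_
  rw [Data.leaves_eq, h]

theorem msgLen (hS : S.Efficient) : Gen F w fun _ d =>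
    pure (.ofNat (S.msgLen d.len), .empty, []) := by
  obtain ⟨P, hP, h⟩ := hS.msgLen
  refine ((run hP).comap (Det.leaves Det.id)).congr fun i d => Wt.ext_ex fun φ => ?_
  rw [Data.leaves_eq, h]
  simp

theorem setup (hS : S.Efficient) : Gen F w fun _ d => (do
    let k ← S.setup d.len (some 1)
    pure (.node k.1 (.node k.2.1 k.2.2), .empty, [])) := by
  obtain ⟨P, hP, h⟩ := hS.setup
  refine ((run hP).comap ((Det.leaves Det.id).pair (Det.nil.pair (Det.nil.pair Det.nil)))).congr
    fun i d => Wt.ext_ex fun φ => ?_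
  have : P.run (.node (.ofNat d.len) (.node .nil (.node .nil .nil))) .empty = _ := h d.len (some 1)
  rw [Data.leaves_eq, this]
  simp

/-- The leased key is returned together with its number of qubits. -/
theorem keyGen (hS : S.Efficient) : Gen F w fun _ d => (do
    let k ← S.keyGen d.fst.len d.snd
    pure (.node (.node k.1 k.2.1) (.ofNat k.2.2.len), k.2.2, [])) := by
  obtain ⟨P, hP, h⟩ := hS.keyGen
  have hn : Act F w fun _ _ r => pure (.ofNat r.len, r, []) :=
    (Act.ofInstr .numQ fun i d r o ho => by
      rw [Prog.eval, Wt.mem_supp_pure] at ho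
      subst ho
      simp).congr fun i d r _ => Wt.ext_ex fun φ => by simp [Prog.eval]
  refine (((exec hP).act ((Act.ofDet Det.id).pair hn)).comap
    ((Det.leaves Det.fst).pair Det.snd)).congr fun i d => Wt.ext_ex fun φ => ?_
  rw [Data.leaves_eq, h]
  simp

end Gen

/-- A leased key of the compiled scheme, where `sg` signs the verification key of the fresh instance
of `S`. The datum consists of the classical part of the leased key with its number of qubits, the
verification key of the instance, and the key that verifies the deletion certificate. -/
noncomputable def entry (S : DSSKL) (n : ℕ) (sg : Data → Wt Data) : Wt (Data × Reg) := do
  let k ← S.setup n (some 1)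
  let l ← S.keyGen n k.1
  let s ← sg k.2.2
  pure (.node (.node (.node l.2.1 (.node k.2.2 s)) (.ofNat l.2.2.len)) (.node k.2.2 l.1), l.2.2)

/-- Independent leased keys, with all their qubits. -/
noncomputable def entries (S : DSSKL) (n : ℕ) (sg : Data → Wt Data) : ℕ → Wt (List Data × Reg)
  | 0 => pure ([], .empty)
  | q + 1 => do
    let x ← entry S n sg
    let y ← entries S n sg q
    pure (x.1 :: y.1, x.2.append y.2)

theorem ex_entries_add (S : DSSKL) (n : ℕ) (sg : Data → Wt Data) (b a : ℕ)
    (φ : List Data × Reg → ℂ) : (entries S n sg (b + a)).ex φ =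
      (entries S n sg b).ex fun x => (entries S n sg a).ex fun y =>
        φ (x.1 ++ y.1, x.2.append y.2) := by
  induction b generalizing φ with
  | zero => simp [entries]
  | succ b ih =>
    rw [Nat.add_right_comm]
    simp [entries, ih, Reg.append_assoc]

theorem length_of_mem_supp_entries {S : DSSKL} {n : ℕ} {sg : Data → Wt Data} {q : ℕ} :
    ∀ {x : List Data × Reg}, x ∈ (entries S n sg q).supp → x.1.length = q := by
  induction q with
  | zero =>
    intro x hx
    rw [entries, Wt.mem_supp_pure] at hx
    simp [hx]
  | succ q ih =>
    intro x hx
    obtain ⟨y, -, hx⟩ := Wt.exists_of_mem_supp_bind hx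
    obtain ⟨z, hz, hx⟩ := Wt.exists_of_mem_supp_bind hx
    rw [Wt.mem_supp_pure] at hx
    simp [hx, ih hz]

namespace Gen

variable {ι : Type} {F : ι → Data → Wt Data} {w : ι → ℕ} {S : DSSKL}
  {sg : ι → Data → Data → Wt Data} {lg : Data → List Data}

theorem entry (hS : S.Efficient)
    (hsg : Gen F w fun i d => (do
      let s ← sg i d.fst d.snd
      pure (s, .empty, lg d.snd))) :
    Gen F w fun i d => (do
      let x ← SKL.entry S d.fst.len (sg i d)
      pure (x.1, x.2, lg x.1.snd.fst)) := by
  -- the context, then the outcomes of `setup`, of `keyGen` and of the signer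
  have h1 := (ofDet (F := F) (w := w) Det.id).pair ((setup hS).comap Det.fst)
  have h2 := h1.comp ((ofDet Det.id).pair ((keyGen hS).comap
    ((Det.fst.comp Det.fst).pair (Det.snd.comp Det.fst))))
  have h3 := h2.comp ((ofDet Det.id).pair (hsg.comap
    ((Det.fst.comp Det.fst).pair (((Det.fst.comp Det.snd).comp Det.snd).comp Det.snd))))
  have hk : Det fun d => d.fst.snd.fst.snd := ((Det.fst.comp Det.snd).comp Det.fst).comp Det.snd
  have hv : Det fun d => d.fst.fst.snd.snd.snd :=
    (((Det.fst.comp Det.fst).comp Det.snd).comp Det.snd).comp Det.snd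
  have hl : Det fun d => d.fst.snd.snd := (Det.fst.comp Det.snd).comp Det.snd
  have hc : Det fun d => d.fst.snd.fst.fst := ((Det.fst.comp Det.snd).comp Det.fst).comp Det.fst
  refine (h3.map (((hk.pair (hv.pair Det.snd)).pair hl).pair (hv.pair hc))).congr
    fun i d => Wt.ext_ex fun φ => ?_
  simp [SKL.entry]

/-- The data of the keys are returned in reverse order. -/
theorem entries (hS : S.Efficient)
    (hsg : Gen F w fun i d => (do
      let s ← sg i d.fst d.snd
      pure (s, .empty, lg d.snd))) :
    Gen F w fun i d => (do
      let x ← SKL.entries S d.fst.fst.len (sg i d.fst) d.snd.len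
      pure (.ofList x.1.reverse, x.2, (x.1.map fun e => lg e.snd.fst).flatten)) := by
  refine (((entry hS hsg).comap Det.snd).collect.comap
    (Det.snd.pair (Det.fst.pair Det.nil))).congr fun i d => Wt.ext_ex fun φ => ?_
  simp only [Data.fst_node, Data.snd_node]
  generalize d.fst = ctx
  have key : ∀ (c : Data) (l : List Data) (φ : Res → ℂ),
      (SKL.collect (fun d => (do
        let x ← SKL.entry S d.snd.fst.len (sg i d.snd)
        pure (x.1, x.2, lg x.1.snd.fst))) ctx c (.ofList l)).ex φ =
      (SKL.entries S ctx.fst.len (sg i ctx) c.len).ex fun x =>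
        φ (.ofList (x.1.reverse ++ l), x.2, (x.1.map fun e => lg e.snd.fst).flatten) := by
    intro c
    induction c with
    | nil => intro l φ; simp [SKL.collect, SKL.entries, Data.len]
    | node x c _ ih =>
      intro l φ
      simp only [SKL.collect, Wt.ex_bind, Wt.ex_pure, Data.snd_node, Data.len, SKL.entries]
      refine congrArg _ (funext fun y => ?_)
      exact (ih (y.1 :: l) _).trans (by simp)
  have := key d.snd [] φ
  simp only [List.append_nil] at this
  simp only [Wt.ex_bind, Wt.ex_pure]
  exact this.symm

end Gen

/-- Classical data and qubits after an attack: the outcome of the first stage, the data of the leased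
keys, and the outcome of the second stage. -/
structure Transcript : Type where
  a : Data
  keys : List Data
  out : Data
  reg : Reg

/-- The attack of `A` on the compiled scheme, where `sg` provides the signatures, and the number of
leased keys is the length of `H a`, if `A` asks for `a`. -/
noncomputable def attack (S : DSSKL) (A : KLAdversary) (H : Data → Data) (sg : Data → Wt Data)
    (ν vk : Data) : Wt Transcript := do
  let x ← A.first.exec (.node ν vk) .empty
  let y ← entries S ν.len sg (H x.1.fst).len
  let z ← A.second.exec (.node ν (.node x.1.snd (.ofList (y.1.map Data.fst)))) (x.2.append y.2)
  pure ⟨x.1, y.1, z.1, z.2⟩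

/-- The attack is simulated by a program. -/
theorem Gen.attack {ι : Type} {F : ι → Data → Wt Data} {w : ι → ℕ} {S : DSSKL}
    {sg : ι → Data → Data → Wt Data} {lg : Data → List Data} (hS : S.Efficient)
    (hsg : Gen F w fun i d => (do
      let s ← sg i d.fst d.snd
      pure (s, .empty, lg d.snd))) (A : KLAdversary) {H : Data → Data} (hH : Det H) :
    Gen F w fun i d => (do
      let t ← SKL.attack S A H (sg i d) d.fst d.snd.fst
      pure (.node (.node t.a (.ofList t.keys.reverse)) t.out, t.reg,
        (t.keys.map fun e => lg e.snd.fst).flatten)) := by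
  have h1 := (Gen.ofDet (F := F) (w := w) Det.id).pair
    ((Gen.exec A.first_polyTime).comap (Det.fst.pair (Det.snd.comp Det.fst)))
  have h2 := h1.comp ((Gen.ofDet Det.id).pair ((Gen.entries hS hsg).comap
    (Det.fst.pair ((Det.snd.comp Det.fst).comp hH))))
  have hν : Det fun d => d.fst.fst.fst := (Det.fst.comp Det.fst).comp Det.fst
  have ha : Det fun d => d.fst.snd := Det.fst.comp Det.snd
  have h3 := h2.act (((Act.ofDet (ha.pair Det.snd)).pair ((Act.ofDet (hν.pair
    ((ha.comp Det.snd).pair (Det.snd.revMapFst Det.nil)))).comp (Act.ofProg A.second_polyTime))))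
  refine h3.congr fun i d => Wt.ext_ex fun φ => ?_
  simp [SKL.attack, show Data.nil = Data.ofList [] from rfl, Data.revMapFst_ofList]

end SKL

namespace SKL

/-! ### Probabilities -/

open Classical in
/-- The trace is a positive observable. -/
theorem posForm_tr {c : ℂ} (hc : 0 ≤ c.re) : PosForm fun r => c * r.tr := by
  intro N u _
  have h1 : ∀ k, (u.conj.ex fun b => c * Reg.tr ⟨k, b⟩) = c * starRingEnd ℂ (u.coeff k) := by
    intro k
    rw [Wt.ex_mul_left, ← Wt.coeff_conj, Wt.coeff_eq_ex]
    refine congrArg _ (Wt.ex_congr fun b _ => ?_)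
    simp only [Reg.tr, eq_comm]
  simp only [h1]
  rw [Wt.ex_eq_sum, Complex.re_sum]
  refine Finset.sum_nonneg fun k _ => ?_
  rw [mul_left_comm, Complex.mul_conj, Complex.re_mul_ofReal]
  exact mul_nonneg hc (Complex.normSq_nonneg _)

theorem isDist_noOracle (d : Data) : (noOracle d).IsDist := Wt.IsDist.pure _

/-- The outcome of a program is a random variable. -/
theorem isDist_run (P : Prog) (d : Data) : (P.run d .empty).IsDist := by
  classical
  have hex : ∀ φ : Data → ℂ, (P.run d .empty).ex φ = wp noOracle P d .empty fun a r _ =>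
      φ a * r.tr := by
    intro φ
    simp only [Prog.run, Wt.ex_bind, ex_exec, Wt.ex_pure]
    refine congrArg _ (funext fun a => funext fun r => funext fun _ => ?_)
    simp only [traceOut, Reg.tr]
    split_ifs <;> simp
  have hc : ∀ (c : ℂ) (a : Data), 0 ≤ c.re → 0 ≤ (c * (P.run d .empty).coeff a).re := by
    intro c a hc
    rw [Wt.coeff_eq_ex, ← Wt.ex_mul_left, hex]
    refine wp_re_nonneg isDist_noOracle P d fun b _ => posForm_tr ?_
    split_ifs <;> simp [hc]
  refine ⟨fun a => by simpa using hc 1 a (by simp), fun a => ?_, ?_⟩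
  · have h1 := hc Complex.I a (by simp)
    have h2 := hc (-Complex.I) a (by simp)
    simp at h1 h2
    linarith
  · rw [hex]
    simpa [Reg.tr, Reg.empty] using wp_tr isDist_noOracle P d .empty rfl

theorem Wt.coeff_map {α β : Type} {f : α → β} (hf : Function.Injective f) (x : Wt α) (a : α) :
    (x >>= fun a => pure (f a)).coeff (f a) = x.coeff a := by
  classical
  rw [Wt.coeff_eq_ex, Wt.coeff_eq_ex]
  simp [hf.eq_iff]

theorem Wt.IsDist.of_map {α β : Type} {f : α → β} (hf : Function.Injective f) {x : Wt α}
    (h : (x >>= fun a => Pure.pure (f a)).IsDist) : x.IsDist :=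
  ⟨fun a => by rw [← Wt.coeff_map hf]; exact h.1 _, fun a => by rw [← Wt.coeff_map hf]; exact h.2 _,
    by simpa using h.3⟩

theorem Data.ofBool_injective : Function.Injective Data.ofBool := by
  intro a b h
  cases a <;> cases b <;> simp_all [Data.ofBool]

theorem Data.ofList_injective : Function.Injective Data.ofList := fun a b h => by
  rw [← toList_ofList a, h, toList_ofList]


variable {S : DSSKL} {D : DigSig}

theorem DigSig.Efficient.isDist_gen (hD : D.Efficient) (n : ℕ) : (D.gen n).IsDist := by
  obtain ⟨P, -, h⟩ := hD.gen
  refine Wt.IsDist.of_map (f := fun k : Data × Data => Data.node k.1 k.2) ?_ (h n ▸ isDist_run P _)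
  rintro ⟨a, b⟩ ⟨c, d⟩ h
  simpa using h

theorem DigSig.Efficient.isDist_vrfy (hD : D.Efficient) (n : ℕ) (vk m σ : Data) :
    (D.vrfy n vk m σ).IsDist := by
  obtain ⟨P, -, h⟩ := hD.vrfy
  exact .of_map Data.ofBool_injective (h n vk m σ ▸ isDist_run P _)

theorem DSSKL.Efficient.isDist_vrfy (hS : S.Efficient) (n : ℕ) (vk cert : Data) :
    (S.vrfy n vk cert).IsDist := by
  obtain ⟨P, -, h⟩ := hS.vrfy
  exact .of_map Data.ofBool_injective (h n vk cert ▸ isDist_run P _)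

theorem DSSKL.Efficient.isDist_sigVrfy (hS : S.Efficient) (n : ℕ) (svk m σ : Data) :
    (S.sigVrfy n svk m σ).IsDist := by
  obtain ⟨P, -, h⟩ := hS.sigVrfy
  exact .of_map Data.ofBool_injective (h n svk m σ ▸ isDist_run P _)

theorem DSSKL.Efficient.isDist_vrfyAll (hS : S.Efficient) (n : ℕ) (vks certs : List Data) :
    (S.vrfyAll n vks certs).IsDist := by
  induction vks generalizing certs with
  | nil => exact .pure _
  | cons vk vks ih =>
    cases certs with
    | nil => exact .pure _
    | cons c cs => exact (hS.isDist_vrfy n vk c).bind fun _ => (ih cs).bind fun _ => .pure _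

/-! ### The state after an attack -/

namespace Gen

variable {ι : Type} {F : ι → Data → Wt Data} {w : ι → ℕ} {f : ι → Data → Wt Res}

theorem re_nonneg (hf : Gen F w f) {i : ι} (hO : ∀ d, (F i d).IsDist) (d : Data)
    {φ : Res → ℂ} (h : ∀ a l, PosForm fun r => φ (a, r, l)) : 0 ≤ ((f i d).ex φ).re := by
  obtain ⟨P, p, h1⟩ := hf
  have h2 := (h1 i d .empty rfl).1 fun a r l => φ (a, r, l)
  simp only [Reg.empty_append] at h2
  rw [← h2]
  exact wp_re_nonneg hO P d h

theorem ex_tr (hf : Gen F w f) {i : ι} (hO : ∀ d, (F i d).IsDist) (d : Data) :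
    ((f i d).ex fun x => x.2.1.tr) = 1 := by
  obtain ⟨P, p, h1⟩ := hf
  have h2 := (h1 i d .empty rfl).1 fun a r l => r.tr
  simp only [Reg.empty_append] at h2
  rw [← h2, wp_tr hO P d .empty rfl]
  simp [Reg.tr, Reg.empty]

/-- The attack with signatures that are made with the secret key. -/
theorem attackSign (hS : S.Efficient) (hD : D.Efficient) (A : KLAdversary) {H : Data → Data}
    (hH : Det H) : Gen F w fun _ d => (do
      let t ← SKL.attack S A H (D.sign d.fst.len d.snd.snd) d.fst d.snd.fst
      pure (.node (.node t.a (.ofList t.keys.reverse)) t.out, t.reg, [])) := by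
  have h := Gen.attack (F := F) (w := w) (lg := fun _ => [])
    (sg := fun _ d => D.sign d.fst.len d.snd.snd) hS
    (((digSign hD).comap ((Det.fst.comp Det.fst).pair
      (((Det.fst.comp Det.snd).comp Det.snd).pair Det.snd))).congr fun i d => by simp) A hH
  refine h.congr fun i d => Wt.ext_ex fun φ => ?_
  simp

end Gen

section attack

variable (hS : S.Efficient) (hD : D.Efficient) (A : KLAdversary) {H : Data → Data}
  (hH : Det H) (n : ℕ) (sk vk : Data)

include hS hD hH

theorem square_of_mem_supp_attack {t : Transcript}
    (ht : t ∈ (attack S A H (D.sign n sk) (.ofNat n) vk).supp) : t.reg.Square := by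
  have h := (Gen.attackSign (ι := Unit) (F := fun _ => noOracle) (w := fun _ => 0) hS hD A hH).square
    (i := ()) (d := .node (.ofNat n) (.node vk sk))
  simp only [Data.fst_node, Data.snd_node, Data.len_ofNat] at h
  refine h (.node (.node t.a (.ofList t.keys.reverse)) t.out, t.reg, []) ?_
  rw [Wt.mem_supp, Wt.coeff_map (f := fun t : Transcript =>
    (Data.node (.node t.a (.ofList t.keys.reverse)) t.out, t.reg, ([] : List Data)))]
  · exact Wt.mem_supp.1 ht
  · rintro ⟨a, K, o, r⟩ ⟨a', K', o', r'⟩ h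
    simp only [Prod.mk.injEq, Data.node.injEq, Data.ofList_injective.eq_iff, List.reverse_inj] at h
    simp [h]

omit hS hD hH in
theorem of_mem_supp_attack {sg : Data → Wt Data} {ν : Data} {t : Transcript}
    (ht : t ∈ (attack S A H sg ν vk).supp) :
    (∃ r, (t.a, r) ∈ (A.first.exec (.node ν vk) .empty).supp) ∧
      t.keys.length = (H t.a.fst).len := by
  obtain ⟨x, hx, ht⟩ := Wt.exists_of_mem_supp_bind ht
  obtain ⟨y, hy, ht⟩ := Wt.exists_of_mem_supp_bind ht
  obtain ⟨z, hz, ht⟩ := Wt.exists_of_mem_supp_bind ht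
  rw [Wt.mem_supp_pure] at ht
  subst ht
  exact ⟨⟨x.2, hx⟩, length_of_mem_supp_entries hy⟩

/-- Positive observables have a nonnegative expectation after the attack. -/
theorem attack_re_nonneg {φ : Transcript → ℂ}
    (hφ : ∀ a K o, (∃ r, (a, r) ∈ (A.first.exec (.node (.ofNat n) vk) .empty).supp) →
      K.length = (H a.fst).len → PosForm fun r => φ ⟨a, K, o, r⟩) :
    0 ≤ ((attack S A H (D.sign n sk) (.ofNat n) vk).ex φ).re := by
  classical
  let c : Data → List Data → Prop := fun a K =>
    (∃ r, (a, r) ∈ (A.first.exec (.node (.ofNat n) vk) .empty).supp) ∧ K.length = (H a.fst).len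
  have h := (Gen.attackSign (ι := Unit) (F := fun _ => noOracle) (w := fun _ => 0) hS hD A
    hH).re_nonneg (i := ()) isDist_noOracle (.node (.ofNat n) (.node vk sk))
    (φ := fun x => if c x.1.fst.fst x.1.fst.snd.toList.reverse then
      φ ⟨x.1.fst.fst, x.1.fst.snd.toList.reverse, x.1.snd, x.2.1⟩ else 0) fun a l => by
        by_cases h : c a.fst.fst a.fst.snd.toList.reverse
        · simpa [h] using hφ _ _ _ h.1 h.2
        · simpa [h] using PosForm.zero
  simp only [Data.fst_node, Data.snd_node, Data.len_ofNat, Wt.ex_bind, Wt.ex_pure,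
    Data.toList_ofList, List.reverse_reverse] at h
  rwa [Wt.ex_congr fun t ht => if_pos (of_mem_supp_attack A vk ht)] at h

theorem attack_tr : ((attack S A H (D.sign n sk) (.ofNat n) vk).ex fun t => t.reg.tr) = 1 := by
  have h := (Gen.attackSign (ι := Unit) (F := fun _ => noOracle) (w := fun _ => 0) hS hD A
    hH).ex_tr (i := ()) isDist_noOracle (.node (.ofNat n) (.node vk sk))
  simpa using h

end attack

end SKL

namespace SKL

/-! ### Forgers -/

variable {S : DSSKL} {D : DigSig}

theorem Data.toBits_ofNat (k : ℕ) : (ofNat k).toBits = List.replicate k false := by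
  simp [toBits, toList_ofNat, isNil]

open Classical in
/-- Runs the attack and then the program of the adversary on a random message, and measures all
qubits. Returns the message, the transcript of the attack, and the outcome of the measurement. -/
noncomputable def play (S : DSSKL) (A : KLAdversary) (H : Data → Data) (sg : Data → Wt Data)
    (ν vk : Data) : Wt (List Bool × Transcript × List Bool) := do
  let m ← unif (S.msgLen ν.len)
  let t ← attack S A H sg ν vk
  let U := QProgram.ofData t.out.snd
  let k ← runCircuit U.gates (m ++ t.reg.ket ++ List.replicate U.anc false)
  let b ← (runCircuit U.gates (m ++ t.reg.bra ++ List.replicate U.anc false)).conj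
  if k = b then pure (m, t, k) else 0

theorem ex_play (A : KLAdversary) (H : Data → Data) (sg : Data → Wt Data) (ν vk : Data)
    (hsq : ∀ t ∈ (attack S A H sg ν vk).supp, t.reg.Square)
    (g : List Bool → Transcript → List Bool → ℝ) :
    ((play S A H sg ν vk).ex fun x => (g x.1 x.2.1 x.2.2 : ℂ)) =
      (attack S A H sg ν vk).ex fun t =>
        matForm ((QProgram.ofData t.out.snd).form (S.msgLen ν.len) fun m z => g m t z) t.reg := by
  classical
  simp only [play, Wt.ex_bind]
  rw [Wt.ex_comm]
  refine Wt.ex_congr fun t ht => ?_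
  rw [← QProgram.ex_run _ _ _ (hsq t ht)]
  refine congrArg _ (funext fun m => congrArg _ (funext fun k => congrArg _ (funext fun b => ?_)))
  split_ifs <;> simp

/-- The outcome consists of the message and the output of the program. -/
theorem Gen.play {ι : Type} {F : ι → Data → Wt Data} {w : ι → ℕ}
    {sg : ι → Data → Data → Wt Data} {lg : Data → List Data} (hS : S.Efficient)
    (hsg : Gen F w fun i d => (do
      let s ← sg i d.fst d.snd
      pure (s, .empty, lg d.snd))) (A : KLAdversary) {H : Data → Data} (hH : Det H) :
    Gen F w fun i d => (do
      let x ← SKL.play S A H (sg i d) d.fst d.snd.fst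
      pure (.node (.ofBits x.1) ((QProgram.ofData x.2.1.out.snd).output x.2.2), .empty,
        (x.2.1.keys.map fun e => lg e.snd.fst).flatten)) := by
  classical
  have h1 := (Gen.ofDet (F := F) (w := w) Det.id).pair
    (((Gen.msgLen hS).comp Gen.unif).comap Det.fst)
  have h2 := h1.comp ((Gen.ofDet Det.id).pair (Gen.qubits Det.snd))
  have h3 := h2.comp ((Gen.ofDet Det.id).pair ((Gen.attack hS hsg A hH).comap
    (Det.fst.comp Det.fst)))
  have hp : Det fun d => d.snd.snd.snd := (Det.snd.comp Det.snd).comp Det.snd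
  have h4 := h3.comp ((Gen.ofDet Det.id).pair
    (Gen.qubits (Det.leaves ((hp.comp Det.snd).comp Det.snd))))
  have h5 := h4.act ((Act.ofDet Det.id).pair ((Act.ofDet ((Det.fst.comp hp).comp Det.fst)).comp
    Act.gates))
  have h6 := h5.act ((Act.ofDet Det.id).pair Act.measureAll)
  have h3' : Det fun d => d.fst.fst.fst := (Det.fst.comp Det.fst).comp Det.fst
  refine (h6.map (((h3'.comp Det.fst).comp (Det.fst.comp Det.snd)).pair
    (Det.readOut ((h3'.comp hp).comp (Det.snd.comp Det.fst)) Det.snd))).congr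
    fun i d => Wt.ext_ex fun φ => ?_
  simp only [SKL.play, Wt.ex_bind, Wt.ex_pure, Data.fst_node, Data.snd_node, Data.len_ofNat,
    List.append_nil, List.nil_append, Data.toBits_ofBits,
    Data.leaves_eq, Data.toBits_ofNat, Reg.append]
  refine congrArg _ (funext fun m => congrArg _ (funext fun t => congrArg _ (funext fun k =>
    congrArg _ (funext fun b => ?_))))
  split_ifs
  · simp [Data.readOut_ofBits, QProgram.output, QProgram.ofData, Function.comp_def]
  · simp

open Classical in
/-- The indicator of the event that `m` was not queried. -/
noncomputable def fresh (m : Data) (l : List Data) : ℝ := if m ∉ l then 1 else 0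

/-- A procedure that runs with the signing oracle is a forger. -/
theorem exists_forger (hD : D.Efficient) {f : ℕ × Data → Data → Wt Res}
    (hf : Gen (fun i : ℕ × Data => D.sign i.1 i.2) (fun i => i.1 + i.2.size) f) :
    ∃ B : Forger D, ∀ n, (D.forgeExp B n).prTrue = ((D.gen n).ex fun k =>
      (f (n, k.1) (.node (.ofNat n) k.2)).ex fun x => x.2.1.tr *
        (((D.vrfy n k.2 x.1.fst x.1.snd).prTrue * fresh x.1.fst x.2.2 : ℝ) : ℂ)).re := by
  obtain ⟨P, p, h⟩ := hf
  refine ⟨⟨P, p.comp (3 * Polynomial.X + 1), fun n sk vk o ho => ?_⟩, fun n => ?_⟩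
  · refine ((h (n, sk) _ .empty rfl).2 o ho).trans ?_
    rw [Polynomial.eval_comp]
    refine eval_mono p ?_
    simp [Data.size, Data.size_ofNat]
    omega
  · rw [Wt.prTrue_eq, DigSig.forgeExp, Wt.ex_bind]
    refine congrArg Complex.re (congrArg _ (funext fun k => ?_))
    have h1 := (h (n, k.1) (.node (.ofNat n) k.2) .empty rfl).1 fun a r l => r.tr *
      (((D.vrfy n k.2 a.fst a.snd).prTrue * fresh a.fst l : ℝ) : ℂ)
    simp only [Reg.empty_append] at h1
    rw [← h1, wp]
    simp only [Wt.ex_bind, Wt.ex_pure]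
    refine congrArg _ (funext fun o => ?_)
    simp only [traceOut, Reg.tr, fresh, (hD.isDist_vrfy n k.2 o.data.fst o.data.snd).ex_bool]
    split_ifs <;> simp_all

theorem DigSig.Efficient.size_sign_le (hD : D.Efficient) : ∃ p : ℕ[X], ∀ n sk m,
    ∀ a ∈ (D.sign n sk m).supp, a.size ≤ p.eval (n + sk.size + m.size) := by
  obtain ⟨P, ⟨p, hp⟩, h⟩ := hD.sign
  refine ⟨p.comp (2 * Polynomial.X + 2), fun n sk m a ha => ?_⟩
  rw [← h] at ha
  obtain ⟨x, hx, ha⟩ := Wt.exists_of_mem_supp_bind ha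
  obtain ⟨o, ho, rfl⟩ := mem_supp_exec hx
  obtain ⟨u, hu, ha⟩ := Wt.exists_of_mem_supp_bind ha
  rw [Wt.mem_supp_pure] at ha
  subst ha
  have h1 := (P.bounds_of_mem_supp_eval _ _ _ Reg.square_empty o ho).2.1
  refine (h1.trans (hp _ _ Reg.square_empty o ho)).trans ?_
  rw [Polynomial.eval_comp]
  refine eval_mono p ?_
  simp [Data.size, Data.size_ofNat]
  omega

/-- The attack, with the signing oracle in the place of the secret key. -/
theorem Gen.playQuery {ι : Type} {F : ι → Data → Wt Data} {w : ι → ℕ} (hS : S.Efficient)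
    (A : KLAdversary) {p : ℕ[X]}
    (hp : ∀ i d, ∀ a ∈ (F i d).supp, a.size ≤ p.eval (w i + d.size)) :
    Gen F w fun i d => (do
      let x ← SKL.play S A (fun d => d) (F i) d.fst d.snd
      pure (.node (.ofBits x.1) ((QProgram.ofData x.2.1.out.snd).output x.2.2), .empty,
        x.2.1.keys.map fun e => e.snd.fst)) := by
  have hq := (Gen.query hp).comap Det.snd
  have h1 := Gen.play (sg := fun i _ m => F i m) (lg := fun m => [m]) hS hq A
    (H := fun d => d) Det.id
  have h2 := h1.comap (Det.fst.pair (Det.snd.pair Det.nil))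
  refine h2.congr fun i d => ?_
  have h3 : ∀ l : List Data, (l.map fun e => [e.snd.fst]).flatten = l.map fun e => e.snd.fst :=
    fun l => by rw [← List.flatMap_def, List.map_eq_flatMap]
  simp only [h3, Data.fst_node, Data.snd_node]

/-- A forger that signs a random message with the program of the adversary. -/
theorem exists_forger_message (hS : S.Efficient) (hD : D.Efficient) (A : KLAdversary) :
    ∃ B : Forger D, ∀ n, (D.forgeExp B n).prTrue = ((D.gen n).ex fun k =>
      (attack S A (fun d => d) (D.sign n k.1) (.ofNat n) k.2).ex fun t =>
        matForm ((QProgram.ofData t.out.snd).form (S.msgLen n) fun m z =>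
          (D.vrfy n k.2 (.ofBits m) ((QProgram.ofData t.out.snd).output z)).prTrue *
            fresh (.ofBits m) (t.keys.map fun e => e.snd.fst)) t.reg).re := by
  obtain ⟨p, hp⟩ := hD.size_sign_le
  obtain ⟨B, hB⟩ := exists_forger hD (Gen.playQuery hS A fun i d => hp i.1 i.2 d)
  refine ⟨B, fun n => (hB n).trans ?_⟩
  refine congrArg Complex.re (congrArg _ (funext fun k => ?_))
  have := ex_play (S := S) A (fun d => d) (D.sign n k.1) (.ofNat n) k.2
    (fun t => square_of_mem_supp_attack hS hD A Det.id n k.1 k.2) fun m t z =>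
    (D.vrfy n k.2 (.ofBits m) ((QProgram.ofData t.out.snd).output z)).prTrue *
            fresh (.ofBits m) (t.keys.map fun e => e.snd.fst)
  rw [Data.len_ofNat] at this
  rw [← this]
  simp only [Wt.ex_bind, Wt.ex_pure, Data.fst_node, Data.snd_node, Reg.tr, Reg.empty, if_true,
    one_mul]

/-- A forger that takes the verification key of a fresh instance of `S` and its signature from the
output of the program. -/
theorem exists_forger_key (hS : S.Efficient) (hD : D.Efficient) (A : KLAdversary) :
    ∃ B : Forger D, ∀ n, (D.forgeExp B n).prTrue = ((D.gen n).ex fun k =>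
      (attack S A (fun d => d) (D.sign n k.1) (.ofNat n) k.2).ex fun t =>
        matForm ((QProgram.ofData t.out.snd).form (S.msgLen n) fun _ z =>
          (D.vrfy n k.2 ((QProgram.ofData t.out.snd).output z).snd.fst
            ((QProgram.ofData t.out.snd).output z).snd.snd).prTrue *
            fresh ((QProgram.ofData t.out.snd).output z).snd.fst (t.keys.map fun e => e.snd.fst)) t.reg).re := by
  obtain ⟨p, hp⟩ := hD.size_sign_le
  obtain ⟨B, hB⟩ := exists_forger hD
    ((Gen.playQuery hS A fun i d => hp i.1 i.2 d).map (Det.snd.comp Det.snd))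
  refine ⟨B, fun n => (hB n).trans ?_⟩
  refine congrArg Complex.re (congrArg _ (funext fun k => ?_))
  have := ex_play (S := S) A (fun d => d) (D.sign n k.1) (.ofNat n) k.2
    (fun t => square_of_mem_supp_attack hS hD A Det.id n k.1 k.2) fun _ t z =>
    (D.vrfy n k.2 ((QProgram.ofData t.out.snd).output z).snd.fst
            ((QProgram.ofData t.out.snd).output z).snd.snd).prTrue *
            fresh ((QProgram.ofData t.out.snd).output z).snd.fst (t.keys.map fun e => e.snd.fst)
  rw [Data.len_ofNat] at this
  rw [← this]
  simp only [Wt.ex_bind, Wt.ex_pure, Data.fst_node, Data.snd_node, Reg.tr, Reg.empty, if_true,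
    one_mul]

end SKL

namespace SKL

/-! ### The attack on a single instance -/

variable {S : DSSKL} {D : DigSig}

namespace Data

/-- A list with as many entries as `c`, but at least one. -/
def nonempty (c : Data) : Data := if c.isNil then node nil nil else c

theorem len_nonempty (c : Data) : (nonempty c).len = max c.len 1 := by
  cases c <;> simp [nonempty, isNil, len]

/-- The description of a program without its first output qubit. In the code of a signature
`node σ (node svk s)` this qubit is the constructor, and the code of `σ` comes next, so that the new
program outputs `σ`. -/
def shave (p : Data) : Data := node p.fst (node p.snd.fst.snd p.snd.snd)

end Data

theorem Det.nonempty {f : Data → Data} (hf : Det f) : Det fun d => (f d).nonempty :=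
  hf.ite (Det.nil.pair Det.nil) hf

/-- Stage one for an instance with verification key `svk`, where the input is `node ν svk`: generates
the keys of the compiled scheme, runs the first stage of `A`, chooses the place of the instance
among the leased keys, and generates the leased keys before it. -/
noncomputable def embedFirst (S : DSSKL) (D : DigSig) (A : KLAdversary) (d : Data) : Wt Res := do
  let k ← D.gen d.fst.len
  let x ← A.first.exec (.node d.fst k.2) .empty
  let R ← unif x.1.fst.nonempty.len
  let c := Data.ofNat x.1.fst.nonempty.len
  let j := Data.choose (.ofBits R) c
  let y ← entries S d.fst.len (D.sign d.fst.len k.1) (Data.drop j c.snd).len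
  pure (.node .nil (.node (.node d.snd (.node k.1 k.2))
    (.node x.1.snd (.node j (.ofList y.1.reverse)))), x.2.append y.2, [])

theorem Gen.embedFirst {ι : Type} {F : ι → Data → Wt Data} {w : ι → ℕ} (hS : S.Efficient)
    (hD : D.Efficient) (A : KLAdversary) : Gen F w fun _ d => SKL.embedFirst S D A d := by
  have h1 := (Gen.ofDet (F := F) (w := w) Det.id).pair ((Gen.digGen hD).comap Det.fst)
  have h2 := h1.comp ((Gen.ofDet Det.id).pair ((Gen.exec A.first_polyTime).comap
    ((Det.fst.comp Det.fst).pair (Det.snd.comp Det.snd))))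
  have hc : Det fun d => d.snd.fst.nonempty := (Det.snd.comp Det.fst).nonempty
  have h3 := h2.comp ((Gen.ofDet Det.id).pair (Gen.unif.comap hc))
  have hl : Det fun d => d.fst.snd.fst.nonempty.leaves := ((Det.fst.comp hc).leaves)
  have h4 := h3.map (Det.id.pair (Det.choose Det.snd hl))
  have hs := Gen.entries (F := F) (w := w) (lg := fun _ => [])
    (sg := fun _ d => D.sign d.fst.len d.snd.fst) hS
    (((digSign hD).comap ((Det.fst.comp Det.fst).pair
      (((Det.fst.comp Det.snd).comp Det.fst).pair Det.snd))).congr fun i d => by simp)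
  have hb : Det fun d => d.fst.fst.fst := (Det.fst.comp Det.fst).comp Det.fst
  have h5 := h4.comp ((Gen.ofDet Det.id).pair (hs.comap
    (((hb.comp (Det.fst.comp Det.fst)).pair (hb.comp Det.snd)).pair
      (Det.snd.drop ((Det.fst.comp hl).comp Det.snd)))))
  have hb' : Det fun d => d.fst.fst.fst.fst := Det.fst.comp hb
  refine (h5.map (Det.nil.pair (((hb'.comp (Det.fst.comp Det.snd)).pair (hb'.comp Det.snd)).pair
    (((hb.comp Det.snd).comp Det.snd).pair ((Det.fst.comp Det.snd).pair Det.snd))))).congr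
    fun i d => Wt.ext_ex fun φ => ?_
  simp [SKL.embedFirst, Data.leaves_eq]

/-- Stage two: the leased key of the instance is completed to a leased key of the compiled scheme,
the leased keys after it are generated, and the second stage of `A` is run. The outcome consists of
the certificate for the instance, and the program with the part of its output that is a signature of
the instance. -/
noncomputable def embedSecond (S : DSSKL) (D : DigSig) (A : KLAdversary) (d : Data) (r : Reg) :
    Wt Res := do
  let s ← D.sign d.fst.len d.snd.fst.fst.snd.fst d.snd.fst.fst.fst
  let y ← entries S d.fst.len (D.sign d.fst.len d.snd.fst.fst.snd.fst) d.snd.fst.snd.snd.fst.len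
  let key := Data.node (.node d.snd.snd.fst.fst (.node d.snd.fst.fst.fst s)) d.snd.snd.fst.snd
  let z ← A.second.exec (.node d.fst (.node d.snd.fst.snd.fst
    (Data.revMapFst d.snd.fst.snd.snd.snd (.node key (.ofList (y.1.map Data.fst))))))
    (r.append y.2)
  pure (.node (.node (Data.drop d.snd.fst.snd.snd.snd z.1.fst).fst .nil) z.1.snd.shave, z.2, [])

theorem Act.embedSecond {ι : Type} {F : ι → Data → Wt Data} {w : ι → ℕ} (hS : S.Efficient)
    (hD : D.Efficient) (A : KLAdversary) : Act F w fun _ d r => SKL.embedSecond S D A d r := by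
  have hst : Det fun d => d.snd.fst.snd := (Det.snd.comp Det.fst).comp Det.snd
  have hk : Det fun d => d.snd.fst.fst := (Det.snd.comp Det.fst).comp Det.fst
  have hsk : Det fun d => d.snd.fst.fst.snd.fst := (hk.comp Det.snd).comp Det.fst
  have hsv : Det fun d => d.snd.fst.fst.fst := hk.comp Det.fst
  have h1 := (Act.ofDet (F := F) (w := w) Det.id).pair
    ((Gen.digSign hD).comap (Det.fst.pair (hsk.pair hsv))).toAct
  have hs := Gen.entries (F := F) (w := w) (lg := fun _ => [])
    (sg := fun _ d => D.sign d.fst.len d.snd) hS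
    (((Gen.digSign hD).comap ((Det.fst.comp Det.fst).pair
      ((Det.fst.comp Det.snd).pair Det.snd))).congr fun i d => by simp)
  have h2 := h1.comp ((Act.ofDet Det.id).pair (hs.comap
    (((Det.fst.comp Det.fst).pair (Det.fst.comp hsk)).pair
      (Det.fst.comp ((hst.comp Det.snd).comp Det.fst)))).toAct)
  have hd : Det fun d => d.fst.fst := Det.fst.comp Det.fst
  have hc : Det fun d => d.snd.snd.fst := (Det.snd.comp Det.snd).comp Det.fst
  have hkey : Det fun d => Data.node (.node d.fst.fst.snd.snd.fst.fst
      (.node d.fst.fst.snd.fst.fst.fst d.fst.snd)) d.fst.fst.snd.snd.fst.snd :=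
    (((hd.comp hc).comp Det.fst).pair ((hd.comp hsv).pair (Det.fst.comp Det.snd))).pair
      ((hd.comp hc).comp Det.snd)
  have hys : Det fun d => d.snd.fst.snd.snd.snd := (hst.comp Det.snd).comp Det.snd
  have h3 := h2.comp ((Act.ofDet Det.id).pair ((Act.ofDet ((hd.comp Det.fst).pair
    ((hd.comp (hst.comp Det.fst)).pair ((hd.comp hys).revMapFst
      (hkey.pair (Det.snd.revMapFst Det.nil)))))).comp (Act.ofProg A.second_polyTime)))
  have hp : Det fun d => d.snd.snd.shave := by
    have hp := Det.snd.comp Det.snd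
    exact (hp.comp Det.fst).pair (((hp.comp Det.snd).comp (Det.fst.comp Det.snd)).pair
      ((hp.comp Det.snd).comp Det.snd))
  refine (h3.comp (Act.ofDet ((((((Det.fst.comp hd).comp hys).drop
    (Det.snd.comp Det.fst)).comp Det.fst).pair Det.nil).pair hp))).congr
    fun i d r _ => Wt.ext_ex fun φ => ?_
  simp only [SKL.embedSecond, Wt.ex_bind, Wt.ex_pure, Data.fst_node, Data.snd_node,
    Reg.append_empty, List.append_nil, List.nil_append]
  refine congrArg _ (funext fun s => congrArg _ (funext fun y => ?_))
  have := Data.revMapFst_ofList y.1.reverse []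
  rw [List.map_reverse, List.reverse_reverse, List.append_nil] at this
  rw [show Data.nil = Data.ofList [] from rfl, this]
  simp

theorem Act.exists_prog {g : Unit → Data → Reg → Wt Res}
    (hg : Act (fun _ : Unit => noOracle) (fun _ => 0) g) : ∃ P : Prog, P.PolyTime ∧
      ∀ d r, r.Square → ∀ φ : Data × Reg → ℂ,
        (P.exec d r).ex φ = (g () d r).ex fun x => φ (x.1, x.2.1) := by
  obtain ⟨P, p, h⟩ := hg
  refine ⟨P, ⟨p, fun d r hr o ho => ?_⟩, fun d r hr φ => ?_⟩
  · simpa using (h () d r hr).2 o ho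
  · rw [ex_exec]
    exact (h () d r hr).1 fun a s _ => φ (a, s)

end SKL

namespace SKL

variable {S : DSSKL} {D : DigSig}

/-! ### Both experiments in terms of the attack -/

/-- The experiment for one leased key. -/
theorem ex_stdKLAExp_one (S : DSSKL) (B : KLAdversary) (ε : ℝ) (n : ℕ) (φ : Bool → ℂ) :
    (S.stdKLAExp (some fun _ => 1) B ε n).ex φ = (S.setup n (some 1)).ex fun κ =>
      (B.first.exec (.node (.ofNat n) κ.2.2) .empty).ex fun x => (S.keyGen n κ.1).ex fun l =>
        (B.second.exec (.node (.ofNat n) (.node x.1.snd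
          (.node (.node l.2.1 (.ofNat l.2.2.len)) .nil))) (x.2.append l.2.2)).ex fun z =>
          (S.vrfyAll n [l.1] z.1.fst.toList).ex fun v =>
            (S.goodTest n κ.2.2 ε (.ofData z.1.snd) z.2).ex fun g => φ (v && g) := by
  rw [DSSKL.stdKLAExp, Wt.ex_bind]
  refine congrArg _ (funext fun ⟨msk, ssk, svk⟩ => ?_)
  simp only [Wt.ex_bind]
  refine congrArg _ (funext fun ⟨a, st⟩ => ?_)
  simp only [DSSKL.leaseKeys, Wt.ex_bind]
  refine congrArg _ (funext fun ⟨vk, c, r⟩ => ?_)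
  simp [Data.ofList]

/-- The experiment for the compiled scheme. -/
theorem ex_stdKLAExp_compile (S : DSSKL) (D : DigSig) (A : KLAdversary) (ε : ℝ) (n : ℕ)
    (φ : Bool → ℂ) : ((compile S D).stdKLAExp none A ε n).ex φ = (D.gen n).ex fun k =>
      (attack S A (fun d => d) (D.sign n k.1) (.ofNat n) k.2).ex fun t =>
        (S.vrfyAll n (t.keys.map fun e => e.snd.snd) t.out.fst.toList).ex fun v =>
          ((compile S D).goodTest n k.2 ε (.ofData t.out.snd) t.reg).ex fun g => φ (v && g) := by
  have hl : ∀ (k : Data × Data) (q : ℕ) (ψ : List Data × List Data × Reg → ℂ),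
      ((compile S D).leaseKeys n (.node k.1 k.2) q).ex ψ =
        (entries S n (D.sign n k.1) q).ex fun y =>
          ψ (y.1.map fun e => e.snd.snd, y.1.map Data.fst, y.2) := by
    intro k q
    induction q with
    | zero => intro ψ; simp [DSSKL.leaseKeys, entries]
    | succ q ih =>
      intro ψ
      simp only [DSSKL.leaseKeys, entries, entry, Wt.ex_bind, Wt.ex_pure, compile]
      refine congrArg _ (funext fun ⟨a, b, c⟩ => ?_)
      dsimp only
      refine congrArg _ (funext fun ⟨a', b', c'⟩ => ?_)
      dsimp only
      refine congrArg _ (funext fun s => ?_)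
      refine (ih _).trans ?_
      simp
  have hv : ∀ vks certs, (compile S D).vrfyAll n vks certs = S.vrfyAll n vks certs := by
    intro vks
    induction vks with
    | nil => intro certs; rfl
    | cons vk vks ih =>
      intro certs
      cases certs with
      | nil => rfl
      | cons c cs =>
        rw [DSSKL.vrfyAll, DSSKL.vrfyAll]
        simp only [ih]
        rfl
  rw [DSSKL.stdKLAExp, Wt.ex_bind]
  simp only [compile, Wt.ex_bind]
  refine congrArg _ (funext fun k => ?_)
  simp only [attack, Wt.ex_bind, Wt.ex_pure]
  refine congrArg _ (funext fun x => ?_)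
  refine (hl k _ _).trans ?_
  simp only [Data.len_ofNat]
  refine congrArg _ (funext fun y => ?_)
  refine congrArg _ (funext fun z => ?_)
  exact congrArg₂ _ (hv _ _) rfl

theorem ex_and {x y : Wt Bool} (hx : x.IsDist) :
    (x.ex fun v => y.ex fun g => if v && g then 1 else 0) =
      x.prTrue * y.ex fun g => if g then 1 else 0 := by
  rw [hx.ex_bool]
  simp

theorem ex_goodTest (S : DSSKL) (n : ℕ) (svk : Data) (ε : ℝ) (U : QProgram) (r : Reg) :
    ((S.goodTest n svk ε U r).ex fun b => if b then 1 else 0) = matForm (fun N =>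
      spectralProj (U.effect (S.msgLen n) (fun m y => (S.sigVrfy n svk m y).prTrue) N) (0 + ε)) r :=
  ex_projTest r fun N =>
    spectralProj (U.effect (S.msgLen n) (fun m y => (S.sigVrfy n svk m y).prTrue) N) (0 + ε)

/-- The trace, after the attack, against the event that the certificate for the key at place `i` is
valid, and the program, without its first output qubit, is tested to be `ε`-good for this key. -/
noncomputable def win (S : DSSKL) (n : ℕ) (ε : ℝ) (t : Transcript) (i : ℕ) : ℂ :=
  (S.vrfy n (t.keys.getD i .nil).snd.snd (t.out.fst.toList.getD i .nil)).prTrue *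
    matForm (fun N => spectralProj ((QProgram.ofData t.out.snd.shave).effect (S.msgLen n)
      (fun m y => (S.sigVrfy n (t.keys.getD i .nil).snd.fst m y).prTrue) N) (0 + ε)) t.reg

theorem DSSKL.Efficient.square_keyGen (hS : S.Efficient) {n : ℕ} {msk : Data}
    {l : Data × Data × Reg} (hl : l ∈ (S.keyGen n msk).supp) : l.2.2.Square := by
  obtain ⟨P, -, h⟩ := hS.keyGen
  have h1 : (Data.node l.1 l.2.1, l.2.2) ∈ (P.exec (.node (.ofNat n) msk) .empty).supp := by
    rw [h, Wt.mem_supp, Wt.coeff_map (f := fun l : Data × Data × Reg =>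
      (Data.node l.1 l.2.1, l.2.2))]
    · exact Wt.mem_supp.1 hl
    · rintro ⟨a, b, c⟩ ⟨a', b', c'⟩ h
      simpa [and_assoc] using h
  obtain ⟨o, ho, he⟩ := mem_supp_exec h1
  have := (P.bounds_of_mem_supp_eval _ _ _ Reg.square_empty o ho).1
  rwa [show l.2.2 = o.reg from congrArg Prod.snd he]

/-- An adversary against a single instance of `S`, which embeds the instance at a random place
among the leased keys of the compiled scheme. -/
theorem exists_reduction (hS : S.Efficient) (hD : D.Efficient) (A : KLAdversary) :
    ∃ B : KLAdversary, ∀ ε n, (S.stdKLAExp (some fun _ => 1) B ε n).prTrue =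
      ((D.gen n).ex fun k =>
        (attack S A Data.nonempty (D.sign n k.1) (.ofNat n) k.2).ex fun t =>
          (pick t.a.fst.nonempty.len).ex fun j => win S n ε t (t.a.fst.nonempty.len - 1 - j)).re := by
  obtain ⟨P, hP, h1⟩ := (Gen.embedFirst (F := fun _ : Unit => noOracle) (w := fun _ => 0) hS hD
    A).toAct.exists_prog
  obtain ⟨Q, hQ, h2⟩ := (Act.embedSecond (F := fun _ : Unit => noOracle) (w := fun _ => 0) hS hD
    A).exists_prog
  refine ⟨⟨P, Q, hP, hQ⟩, fun ε n => ?_⟩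
  rw [Wt.prTrue_eq, ex_stdKLAExp_one]
  refine congrArg Complex.re ?_
  have hstep : ∀ (κ : Data × Data × Data) (x : Data × Reg), x ∈ (P.exec (.node (.ofNat n) κ.2.2) .empty).supp →
      ∀ l ∈ (S.keyGen n κ.1).supp, (x.2.append l.2.2).Square := by
    intro κ x hx l hl
    obtain ⟨o, ho, rfl⟩ := mem_supp_exec hx
    exact (P.bounds_of_mem_supp_eval _ _ _ Reg.square_empty o ho).1.append
      (hS.square_keyGen hl)
  rw [Wt.ex_congr (x := S.setup n (some 1)) fun κ _ => Wt.ex_congr fun x hx => Wt.ex_congr fun l hl =>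
    h2 _ _ (hstep κ x hx l hl) _]
  simp only [h1 _ _ Reg.square_empty, Wt.ex_bind, Wt.ex_pure, embedFirst, embedSecond, Reg.empty_append,
    Data.fst_node, Data.snd_node, Data.len_ofNat]
  -- the instance, generated before everything else in the experiment for `B`, is independent of what
  -- precedes its place in the attack
  rw [Wt.ex_comm]
  refine congrArg _ (funext fun k => ?_)
  rw [Wt.ex_comm]
  simp only [attack, Wt.ex_bind, Wt.ex_pure, Data.len_ofNat]
  refine congrArg _ (funext fun x => ?_)
  set q := x.1.fst.nonempty.len
  rw [Wt.ex_comm]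
  trans (pick q).ex fun j => (entries S n (D.sign n k.1) q).ex fun y =>
    (A.second.exec (.node (.ofNat n) (.node x.1.snd (.ofList (y.1.map Data.fst))))
      (x.2.append y.2)).ex fun z => win S n ε ⟨x.1, y.1, z.1, z.2⟩ (q - 1 - j)
  · simp only [pick, Wt.ex_bind, Wt.ex_pure]
    refine congrArg _ (funext fun R => ?_)
    obtain ⟨j, hj, hR⟩ := Data.choose_spec (q := q) (by have := x.1.fst.len_nonempty; omega)
      (.ofBits R)
    rw [hR]
    clear_value q
    -- `b` leased keys come before the instance, and `j` after it
    obtain ⟨b, rfl⟩ : ∃ b, q = b + (1 + j) := ⟨q - 1 - j, by omega⟩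
    have hb : b + (1 + j) - 1 - j = b := by omega
    have hb' : (Data.ofNat (b + (1 + j))).snd.len = b + j := by
      rw [← add_assoc, add_right_comm, Data.ofNat_succ, Data.snd_node, Data.len_ofNat]
    simp only [Data.len_drop, Data.len_ofNat, hb, hb', Nat.add_sub_cancel]
    rw [ex_entries_add, Wt.ex_comm]
    refine Wt.ex_congr fun y hy => ?_
    rw [ex_entries_add]
    simp only [entries, entry, Wt.ex_bind, Wt.ex_pure, Reg.append_empty]
    refine congrArg _ (funext fun κ => congrArg _ (funext fun l => congrArg _ (funext fun s =>
      congrArg _ (funext fun y' => ?_))))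
    have h3 := Data.revMapFst_ofList y.1.reverse
      (.node (.node l.2.1 (.node κ.2.2 s)) (.ofNat l.2.2.len) :: y'.1.map Data.fst)
    rw [List.map_reverse, List.reverse_reverse, Data.ofList] at h3
    rw [h3]
    simp only [List.map_append, List.map_cons, List.singleton_append, Data.fst_node,
      Reg.append_assoc]
    refine congrArg _ (funext fun z => ?_)
    have hlen := length_of_mem_supp_entries hy
    have hv : S.vrfyAll n [l.1] (((Data.ofList y.1.reverse).drop z.1.fst).fst.node .nil).toList =
        S.vrfy n l.1 (z.1.fst.toList.getD b .nil) := by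
      rw [Data.fst_drop, Data.len_ofList, List.length_reverse, hlen]
      exact Wt.ext_ex fun φ => by simp [Data.toList, DSSKL.vrfyAll]
    have hk : ∀ e, (y.1 ++ e :: y'.1).getD b .nil = e := fun e => by
      simp [List.getD_eq_getElem?_getD, ← hlen]
    rw [hv, ex_and (hS.isDist_vrfy _ _ _), ex_goodTest, win, hk]
    rfl
  · rw [Wt.ex_comm]
    refine congrArg _ (funext fun y => ?_)
    rw [Wt.ex_comm]

end SKL

namespace SKL
open scoped ComplexOrder

/-! ### Comparison of the success probabilities -/

section matForm

variable (M M' : ∀ N : ℕ, Matrix (Fin N → Bool) (Fin N → Bool) ℂ) (r : Reg)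

theorem matForm_add : matForm (fun N => M N + M' N) r = matForm M r + matForm M' r := by
  unfold matForm
  split_ifs <;> simp

theorem matForm_sub : matForm (fun N => M N - M' N) r = matForm M r - matForm M' r := by
  unfold matForm
  split_ifs <;> simp

theorem matForm_smul (c : ℝ) : matForm (fun N => c • M N) r = c * matForm M r := by
  unfold matForm
  split_ifs <;> simp

theorem matForm_one (c : ℝ) : matForm (fun _ => c • 1) r = c * r.tr := by
  classical
  rw [matForm_smul]
  congr 1
  unfold matForm Reg.tr
  by_cases hr : r.Square
  · rw [if_pos hr]
    change (1 : Matrix (Fin r.len → Bool) (Fin r.len → Bool) ℂ) _ _ = _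
    rw [Matrix.one_apply]
    refine if_congr ⟨fun h => ?_, fun h => by rw [h]⟩ rfl rfl
    rw [← ofFn_getD (N := r.len) (k := r.ket) rfl, ← ofFn_getD (N := r.len) (k := r.bra) hr.symm, h]
  · rw [if_neg hr, if_neg]
    exact fun h => hr (congrArg List.length h)

end matForm

namespace QProgram

variable (U : QProgram) (l : ℕ)

theorem matForm_form_sum {κ : Type} (s : Finset κ) (g : κ → List Bool → List Bool → ℝ) (r : Reg) :
    matForm (U.form l fun m z => ∑ i ∈ s, g i m z) r = ∑ i ∈ s, matForm (U.form l (g i)) r := by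
  classical
  induction s using Finset.induction_on with
  | empty =>
    simp only [Finset.sum_empty]
    have := matForm_one r 0
    simp only [zero_smul, Complex.ofReal_zero, zero_mul] at this
    rw [← this]
    refine congrArg₂ _ (funext fun N => ?_) rfl
    rw [form_const U l fun _ => 0]
    simp
  | insert i s hi ih =>
    simp only [Finset.sum_insert hi, ← ih]
    rw [← matForm_add]
    exact congrArg₂ _ (funext fun N => form_add U l _ _ N) rfl

/-- A larger probability of acceptance gives a larger effect. -/
theorem posForm_form_sub {g h : List Bool → List Bool → ℝ} (hgh : ∀ m z, g m z ≤ h m z) :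
    PosForm fun r => matForm (U.form l h) r - matForm (U.form l g) r := by
  refine (posForm_matForm (M := U.form l fun m z => h m z - g m z) fun N =>
    U.posSemidef_form l (fun m z => sub_nonneg.2 (hgh m z)) N).congr fun r _ => ?_
  rw [← matForm_sub]
  exact congrArg₂ _ (funext fun N => (form_sub U l _ _ N).symm) rfl

theorem posForm_form {g : List Bool → List Bool → ℝ} (hg : ∀ m z, 0 ≤ g m z) :
    PosForm (matForm (U.form l g)) :=
  posForm_matForm fun N => U.posSemidef_form l hg N

end QProgram

variable {S : DSSKL} {D : DigSig}

theorem fresh_nonneg (m : Data) (l : List Data) : 0 ≤ fresh m l := by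
  unfold fresh; split_ifs <;> norm_num

/-- The probability that a random message is one of given data. -/
theorem sum_not_fresh_le (k : ℕ) (l : List Data) :
    ∑ m : Fin k → Bool, (1 - fresh (.ofBits (List.ofFn m)) l) ≤ l.length := by
  classical
  have h1 : ∀ m : Fin k → Bool, 1 - fresh (.ofBits (List.ofFn m)) l =
      if Data.ofBits (List.ofFn m) ∈ l.toFinset then (1 : ℝ) else 0 := fun m => by
    simp only [fresh, List.mem_toFinset]
    split_ifs <;> simp_all
  simp only [h1, Finset.sum_boole]
  refine Nat.cast_le.2 (le_trans ?_ (List.toFinset_card_le l))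
  refine Finset.card_le_card_of_injOn (fun m => Data.ofBits (List.ofFn m)) (fun m hm => by
    simpa using hm) fun a _ b _ h => ?_
  have := congrArg Data.toBits h
  simpa using this

/-- A signature that the compiled scheme accepts for `m` contains a signature of `m` by `D`, or a
signature by `D` of the verification key of an instance of `S`, and a signature of `m` by the
instance. -/
theorem prTrue_sigVrfy_compile_le (hS : S.Efficient) (hD : D.Efficient) (n : ℕ) (vk m : Data)
    (U : Data) (z : List Bool) (svks : List Data) :
    ((compile S D).sigVrfy n vk m ((QProgram.ofData U).output z)).prTrue ≤
      (D.vrfy n vk m ((QProgram.ofData U).output z)).prTrue * fresh m svks + (1 - fresh m svks) +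
      (D.vrfy n vk ((QProgram.ofData U).output z).snd.fst
        ((QProgram.ofData U).output z).snd.snd).prTrue *
        fresh ((QProgram.ofData U).output z).snd.fst svks +
      ∑ i ∈ Finset.range svks.length,
        (S.sigVrfy n (svks.getD i .nil) m ((QProgram.ofData U.shave).output z)).prTrue := by
  set y := (QProgram.ofData U).output z with hy
  have h0 : ∀ i ∈ Finset.range svks.length,
      0 ≤ (S.sigVrfy n (svks.getD i .nil) m ((QProgram.ofData U.shave).output z)).prTrue :=
    fun i _ => (hS.isDist_sigVrfy _ _ _ _).prTrue_nonneg
  have h1 : (D.vrfy n vk m y).prTrue ≤ (D.vrfy n vk m y).prTrue * fresh m svks +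
      (1 - fresh m svks) := by
    have := (hD.isDist_vrfy n vk m y).prTrue_le_one
    unfold fresh
    split_ifs <;> linarith
  have h1' := (hD.isDist_vrfy n vk m y).prTrue_nonneg
  have h1'' := (hD.isDist_vrfy n vk m y).prTrue_le_one
  have h2 : 0 ≤ (D.vrfy n vk y.snd.fst y.snd.snd).prTrue * fresh y.snd.fst svks :=
    mul_nonneg (hD.isDist_vrfy _ _ _ _).prTrue_nonneg (fresh_nonneg _ _)
  have h3 := Finset.sum_nonneg h0
  have hle : ∀ x : Wt Bool, ((compile S D).sigVrfy n vk m y) = (do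
      let b ← D.vrfy n vk m y
      if b then pure true else x) →
      ((compile S D).sigVrfy n vk m y).prTrue =
        (D.vrfy n vk m y).prTrue + (1 - (D.vrfy n vk m y).prTrue) * x.prTrue := by
    intro x hx
    rw [hx, Wt.prTrue_eq, Wt.ex_bind, (hD.isDist_vrfy n vk m y).ex_bool, x.prTrue_eq]
    simp [Complex.mul_re]
  have hfalse : (pure false : Wt Bool).prTrue = 0 := by simp [Wt.prTrue_eq]
  have hrest : ∀ x : Wt Bool, 0 ≤ x.prTrue →
      (1 - (D.vrfy n vk m y).prTrue) * x.prTrue ≤ x.prTrue := fun x hx => by nlinarith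
  clear_value y
  match y, hy, h1', h1'', hle, hrest with
  | .nil, _, _, _, hle, hrest =>
    rw [hle (pure false) rfl, hfalse]
    linarith
  | .node σ .nil, _, _, _, hle, hrest =>
    rw [hle (pure false) rfl, hfalse]
    linarith
  | .node σ (.node svk s), hy, _, _, hle, hrest =>
    rw [hle _ rfl]
    have hx : (do
        let b₁ ← D.vrfy n vk svk s
        let b₂ ← S.sigVrfy n svk m σ
        pure (b₁ && b₂) : Wt Bool).prTrue =
        (D.vrfy n vk svk s).prTrue * (S.sigVrfy n svk m σ).prTrue := by
      have h := ex_and (y := S.sigVrfy n svk m σ) (hD.isDist_vrfy n vk svk s)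
      rw [Wt.prTrue_eq, (S.sigVrfy n svk m σ).prTrue_eq, ← Complex.re_ofReal_mul, ← h]
      simp
    have ha := (hD.isDist_vrfy n vk svk s).prTrue_nonneg
    have hb := (hD.isDist_vrfy n vk svk s).prTrue_le_one
    have hc := (hS.isDist_sigVrfy n svk m σ).prTrue_nonneg
    have hd := (hS.isDist_sigVrfy n svk m σ).prTrue_le_one
    have he := hrest _ (hx ▸ mul_nonneg ha hc)
    rw [hx] at he ⊢
    simp only [Data.snd_node, Data.fst_node] at *
    -- a signed verification key belongs to one of the instances; any other one is a forgery
    by_cases hmem : svk ∈ svks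
    · obtain ⟨i, hi, hsvk⟩ := List.getElem_of_mem hmem
      have ho : (QProgram.ofData U.shave).output z = σ := by
        refine Eq.trans ?_ (Data.ofCode_tail hy.symm)
        simp only [QProgram.output, QProgram.ofData, Data.shave, Data.fst_node, Data.snd_node]
        cases U.snd.fst <;> simp [Data.toList]
      have hi' := Finset.single_le_sum h0 (Finset.mem_range.2 hi)
      rw [ho] at hi' ⊢
      have : svks.getD i .nil = svk := by simp [List.getD_eq_getElem?_getD, hi, hsvk]
      rw [this] at hi'
      nlinarith
    · have : fresh svk svks = 1 := by simp [fresh, hmem]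
      rw [this] at h2 ⊢
      nlinarith

/-- If all certificates are valid, then each of them is. -/
theorem prTrue_vrfyAll_le (hS : S.Efficient) (n : ℕ) (vks : List Data) : ∀ (certs : List Data) (i : ℕ),
    i < vks.length → (S.vrfyAll n vks certs).prTrue ≤
      (S.vrfy n (vks.getD i .nil) (certs.getD i .nil)).prTrue := by
  induction vks with
  | nil => intro _ _ h; simp at h
  | cons vk vks ih =>
    intro certs i hi
    have h0 := (hS.isDist_vrfy n ((vk :: vks).getD i .nil) (certs.getD i .nil)).prTrue_nonneg
    cases certs with
    | nil =>
      have : (S.vrfyAll n (vk :: vks) []).prTrue = 0 := by simp [DSSKL.vrfyAll, Wt.prTrue_eq]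
      rw [this]
      exact h0
    | cons c certs =>
      have h1 : (S.vrfyAll n (vk :: vks) (c :: certs)).prTrue =
          (S.vrfy n vk c).prTrue * (S.vrfyAll n vks certs).prTrue := by
        have h := ex_and (y := S.vrfyAll n vks certs) (hS.isDist_vrfy n vk c)
        rw [Wt.prTrue_eq, (S.vrfyAll n vks certs).prTrue_eq, ← Complex.re_ofReal_mul, ← h]
        simp [DSSKL.vrfyAll]
      have ha := (hS.isDist_vrfy n vk c).prTrue_nonneg
      have hb := (hS.isDist_vrfy n vk c).prTrue_le_one
      have hc := (hS.isDist_vrfyAll n vks certs).prTrue_nonneg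
      have hd := (hS.isDist_vrfyAll n vks certs).prTrue_le_one
      rw [h1]
      cases i with
      | zero => simpa using by nlinarith
      | succ i =>
        have := ih certs i (by simpa using hi)
        simp only [List.getD_cons_succ]
        nlinarith

end SKL

namespace SKL
open scoped ComplexOrder

variable {S : DSSKL} {D : DigSig}

/-! ### Comparison of the effects -/

/-- The trace, after the attack, against the event that the program signs a random message with a new
signature of `D`. -/
noncomputable def winMessage (S : DSSKL) (D : DigSig) (n : ℕ) (vk : Data) (t : Transcript) : ℂ :=
  matForm ((QProgram.ofData t.out.snd).form (S.msgLen n) fun m z =>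
    (D.vrfy n vk (.ofBits m) ((QProgram.ofData t.out.snd).output z)).prTrue *
      fresh (.ofBits m) (t.keys.map fun e => e.snd.fst)) t.reg

/-- The trace, after the attack, against the event that the output of the program contains a new
signature of `D`. -/
noncomputable def winKey (S : DSSKL) (D : DigSig) (n : ℕ) (vk : Data) (t : Transcript) : ℂ :=
  matForm ((QProgram.ofData t.out.snd).form (S.msgLen n) fun _ z =>
    (D.vrfy n vk ((QProgram.ofData t.out.snd).output z).snd.fst
      ((QProgram.ofData t.out.snd).output z).snd.snd).prTrue *
      fresh ((QProgram.ofData t.out.snd).output z).snd.fst (t.keys.map fun e => e.snd.fst)) t.reg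

/-- The trace, after the attack, against the event that the attack on the compiled scheme
succeeds. -/
noncomputable def winAll (S : DSSKL) (D : DigSig) (n : ℕ) (vk : Data) (ε : ℝ) (t : Transcript) : ℂ :=
  (S.vrfyAll n (t.keys.map fun e => e.snd.snd) t.out.fst.toList).prTrue *
    matForm (fun N => spectralProj ((QProgram.ofData t.out.snd).effect (S.msgLen n)
      (fun m y => ((compile S D).sigVrfy n vk m y).prTrue) N) (0 + ε)) t.reg

theorem QProgram.posSemidef_effect (U : QProgram) (l : ℕ) {acc : Data → Data → ℝ}
    (h : ∀ m y, 0 ≤ acc m y) (N : ℕ) : (U.effect l acc N).PosSemidef :=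
  U.posSemidef_form l (g := fun m z => acc (.ofBits m) (U.output z)) (fun _ _ => h _ _) N

theorem QProgram.posSemidef_one_sub_effect (U : QProgram) (l : ℕ) {acc : Data → Data → ℝ}
    (h : ∀ m y, acc m y ≤ 1) (N : ℕ) : (1 - U.effect l acc N).PosSemidef := by
  rw [← U.form_one l, U.effect_eq_form, ← form_sub]
  exact U.posSemidef_form l (fun _ _ => sub_nonneg.2 (h _ _)) N

theorem isDist_sigVrfy_compile (hS : S.Efficient) (hD : D.Efficient) (n : ℕ) (vk m σ : Data) :
    ((compile S D).sigVrfy n vk m σ).IsDist := by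
  refine (hD.isDist_vrfy n vk m σ).bind fun b => ?_
  split_ifs
  · exact .pure _
  · split
    · exact (hD.isDist_vrfy _ _ _ _).bind fun _ => (hS.isDist_sigVrfy _ _ _ _).bind fun _ => .pure _
    · exact .pure _

/-- The effect of acceptance by the compiled scheme is at most the sum of the effects of both kinds
of forgeries, the event that the message is one of the signed verification keys, and the events that
the message is signed by one of the instances of `S`. -/
theorem posForm_effect_compile (hS : S.Efficient) (hD : D.Efficient) (n : ℕ) (vk a : Data)
    (K : List Data) (o : Data) : PosForm fun r =>
      winMessage S D n vk ⟨a, K, o, r⟩ + winKey S D n vk ⟨a, K, o, r⟩ +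
        ((K.length / 2 ^ S.msgLen n : ℝ) : ℂ) * r.tr +
        (∑ i ∈ Finset.range K.length, matForm ((QProgram.ofData o.snd.shave).effect (S.msgLen n)
          fun m y => (S.sigVrfy n (K.getD i .nil).snd.fst m y).prTrue) r) -
        matForm ((QProgram.ofData o.snd).effect (S.msgLen n)
          fun m y => ((compile S D).sigVrfy n vk m y).prTrue) r := by
  set U := QProgram.ofData o.snd with hU
  set l := S.msgLen n with hl
  set svks := K.map fun e => e.snd.fst with hsvks
  have hlen : svks.length = K.length := by simp [hsvks]
  have h1 := U.posForm_form_sub l (fun m z =>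
    prTrue_sigVrfy_compile_le hS hD n vk (.ofBits m) o.snd z svks)
  set c : ℝ := 1 / 2 ^ l * ∑ m : Fin l → Bool, (1 - fresh (.ofBits (List.ofFn m)) svks) with hc
  have hcle : c ≤ K.length / 2 ^ l := by
    have := sum_not_fresh_le l svks
    rw [hlen] at this
    rw [hc, div_mul_eq_mul_div, one_mul]
    gcongr
  have h2 : PosForm fun r => (((K.length / 2 ^ l - c : ℝ)) : ℂ) * r.tr :=
    posForm_tr (by rw [Complex.ofReal_re]; exact sub_nonneg.2 hcle)
  refine (h1.add h2).congr fun r _ => ?_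
  have hadd : ∀ g h : List Bool → List Bool → ℝ, matForm (U.form l fun m z => g m z + h m z) r =
      matForm (U.form l g) r + matForm (U.form l h) r := fun g h => by
    rw [← matForm_add]
    exact congrArg₂ _ (funext fun N => U.form_add l g h N) rfl
  have hconst : matForm (U.form l fun m _ => 1 - fresh (.ofBits m) svks) r = c * r.tr := by
    rw [← matForm_one]
    exact congrArg₂ _ (funext fun N =>
      U.form_const l (fun m => 1 - fresh (.ofBits m) svks) N) rfl
  have hsum := U.matForm_form_sum l (Finset.range svks.length) (fun i m z =>
    (S.sigVrfy n (svks.getD i .nil) (.ofBits m) ((QProgram.ofData o.snd.shave).output z)).prTrue) r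
  have hi : ∀ i ∈ Finset.range K.length, svks.getD i .nil = (K.getD i .nil).snd.fst := fun i hi => by
    rw [Finset.mem_range] at hi
    simp [hsvks, List.getD_eq_getElem?_getD, hi]
  have hi' : ∀ i ∈ Finset.range K.length, matForm (U.form l fun m z =>
      (S.sigVrfy n (svks.getD i .nil) (.ofBits m)
        ((QProgram.ofData o.snd.shave).output z)).prTrue) r = matForm (U.form l fun m z =>
      (S.sigVrfy n (K.getD i .nil).snd.fst (.ofBits m)
        ((QProgram.ofData o.snd.shave).output z)).prTrue) r := fun i hi' => by rw [hi i hi']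
  rw [hadd, hadd, hadd, hconst, hsum, hlen, Finset.sum_congr rfl hi']
  change winMessage S D n vk ⟨a, K, o, r⟩ + winKey S D n vk ⟨a, K, o, r⟩ +
    ((K.length / 2 ^ l : ℝ) : ℂ) * r.tr + (∑ i ∈ Finset.range K.length, matForm (U.form l fun m z =>
      (S.sigVrfy n (K.getD i .nil).snd.fst (.ofBits m)
        ((QProgram.ofData o.snd.shave).output z)).prTrue) r) - matForm (U.form l fun m z =>
      ((compile S D).sigVrfy n vk (.ofBits m) ((QProgram.ofData o.snd).output z)).prTrue) r =
    winMessage S D n vk ⟨a, K, o, r⟩ + _ + winKey S D n vk ⟨a, K, o, r⟩ + _ - _ + _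
  push_cast
  ring

/-- If all certificates are valid, then the effect of acceptance by the instance for the key at place
`i` is at most `ε`, up to a successful attack on this instance. -/
theorem posForm_win (hS : S.Efficient) (n : ℕ) {ε : ℝ} (hε : 0 ≤ ε) (a : Data) (K : List Data)
    (o : Data) {i : ℕ} (hi : i < K.length) : PosForm fun r =>
      win S n ε ⟨a, K, o, r⟩ i + (ε : ℂ) * r.tr -
        (S.vrfyAll n (K.map fun e => e.snd.snd) o.fst.toList).prTrue *
          matForm ((QProgram.ofData o.snd.shave).effect (S.msgLen n)
            fun m y => (S.sigVrfy n (K.getD i .nil).snd.fst m y).prTrue) r := by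
  have hv0 := (hS.isDist_vrfyAll n (K.map fun e => e.snd.snd) o.fst.toList).prTrue_nonneg
  have hv1 := (hS.isDist_vrfyAll n (K.map fun e => e.snd.snd) o.fst.toList).prTrue_le_one
  have hvv := prTrue_vrfyAll_le hS n (K.map fun e => e.snd.snd) o.fst.toList i (by simpa using hi)
  have h2 : (K.map fun e => e.snd.snd).getD i .nil = (K.getD i .nil).snd.snd := by
    simp [List.getD_eq_getElem?_getD, hi]
  rw [h2] at hvv
  have hE0 : ∀ N, ((QProgram.ofData o.snd.shave).effect (S.msgLen n)
      (fun m y => (S.sigVrfy n (K.getD i .nil).snd.fst m y).prTrue) N).PosSemidef :=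
    QProgram.posSemidef_effect _ _ fun m y => (hS.isDist_sigVrfy _ _ _ _).prTrue_nonneg
  have hE1 : ∀ N, (1 - (QProgram.ofData o.snd.shave).effect (S.msgLen n)
      (fun m y => (S.sigVrfy n (K.getD i .nil).snd.fst m y).prTrue) N).PosSemidef :=
    QProgram.posSemidef_one_sub_effect _ _ fun m y => (hS.isDist_sigVrfy _ _ _ _).prTrue_le_one
  simp only [win, zero_add]
  generalize (S.vrfyAll n (K.map fun e => e.snd.snd) o.fst.toList).prTrue = v at *
  generalize (S.vrfy n (K.getD i .nil).snd.snd (o.fst.toList.getD i .nil)).prTrue = vi at *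
  generalize ((QProgram.ofData o.snd.shave).effect (S.msgLen n)
    fun m y => (S.sigVrfy n (K.getD i .nil).snd.fst m y).prTrue) = E at *
  have h1 : PosForm fun r => matForm (fun N => spectralProj (E N) ε) r + ε * r.tr -
      matForm E r := by
    refine (posForm_matForm fun N =>
      posSemidef_spectralProj_add_sub (hE0 N) (hE1 N) hε).congr fun r _ => ?_
    rw [matForm_sub, matForm_add, matForm_one]
  have h2 : PosForm (matForm fun N => spectralProj (E N) ε) :=
    posForm_matForm fun N => posSemidef_spectralProj _ _
  -- `vi Π + ε - v E = v (Π + ε - E) + (vi - v) Π + (1 - v) ε` with the spectral projection `Π` of `E`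
  have h3 : PosForm fun r => (((1 - v) * ε : ℝ) : ℂ) * r.tr :=
    posForm_tr (by rw [Complex.ofReal_re]; exact mul_nonneg (sub_nonneg.2 hv1) hε)
  refine (((h1.mul hv0).add (h2.mul (sub_nonneg.2 hvv))).add h3).congr fun r _ => ?_
  push_cast
  ring

/-- A successful attack forges a signature, or signs a message that happens to be one of the signed
verification keys, or succeeds against one of the instances. -/
theorem posForm_winAll (hS : S.Efficient) (hD : D.Efficient) (n : ℕ) (vk : Data) {ε ε' : ℝ}
    (hε' : 0 ≤ ε') (a : Data) (K : List Data) (o : Data) {Q : ℕ} (hQ : K.length ≤ Q) :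
    PosForm fun r => winMessage S D n vk ⟨a, K, o, r⟩ + winKey S D n vk ⟨a, K, o, r⟩ +
      ((Q / 2 ^ S.msgLen n + Q * ε' : ℝ) : ℂ) * r.tr +
      (∑ i ∈ Finset.range K.length, win S n ε' ⟨a, K, o, r⟩ i) -
      ε * winAll S D n vk ε ⟨a, K, o, r⟩ := by
  have hfresh : ∀ x : Wt Bool, x.IsDist → ∀ m svks, 0 ≤ x.prTrue * fresh m svks := fun x hx m svks =>
    mul_nonneg hx.prTrue_nonneg (fresh_nonneg _ _)
  have hA := posForm_effect_compile hS hD n vk a K o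
  have hm : PosForm fun r => winMessage S D n vk ⟨a, K, o, r⟩ :=
    (QProgram.ofData o.snd).posForm_form (S.msgLen n) (g := fun m z =>
      (D.vrfy n vk (.ofBits m) ((QProgram.ofData o.snd).output z)).prTrue *
        fresh (.ofBits m) (K.map fun e => e.snd.fst))
      fun m z => hfresh _ (hD.isDist_vrfy _ _ _ _) _ _
  have hk : PosForm fun r => winKey S D n vk ⟨a, K, o, r⟩ :=
    (QProgram.ofData o.snd).posForm_form (S.msgLen n) (g := fun _ z =>
      (D.vrfy n vk ((QProgram.ofData o.snd).output z).snd.fst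
        ((QProgram.ofData o.snd).output z).snd.snd).prTrue *
        fresh ((QProgram.ofData o.snd).output z).snd.fst (K.map fun e => e.snd.fst))
      fun m z => hfresh _ (hD.isDist_vrfy _ _ _ _) _ _
  have hEpos : ∀ N, ((QProgram.ofData o.snd).effect (S.msgLen n)
      (fun m y => ((compile S D).sigVrfy n vk m y).prTrue) N).PosSemidef :=
    QProgram.posSemidef_effect _ _ fun m y => (isDist_sigVrfy_compile hS hD _ _ _ _).prTrue_nonneg
  have hs := PosForm.sum (s := Finset.range K.length) fun i hi =>
    posForm_win hS n hε' a K o (Finset.mem_range.1 hi)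
  have hv0 := (hS.isDist_vrfyAll n (K.map fun e => e.snd.snd) o.fst.toList).prTrue_nonneg
  have hv1 := sub_nonneg.2
    (hS.isDist_vrfyAll n (K.map fun e => e.snd.snd) o.fst.toList).prTrue_le_one
  have hQ' : (0 : ℝ) ≤ Q - K.length := sub_nonneg.2 (Nat.cast_le.2 hQ)
  simp only [winAll, zero_add]
  generalize (S.vrfyAll n (K.map fun e => e.snd.snd) o.fst.toList).prTrue = v at *
  generalize ((QProgram.ofData o.snd).effect (S.msgLen n)
    fun m y => ((compile S D).sigVrfy n vk m y).prTrue) = E at *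
  have hP : PosForm fun r => matForm E r - ε * matForm (fun N => spectralProj (E N) ε) r := by
    refine (posForm_matForm fun N => posSemidef_sub_smul_spectralProj (hEpos N) (t := ε)).congr
      fun r _ => ?_
    rw [matForm_sub, matForm_smul]
  -- what the multiple `v` of the comparison of effects leaves over is a nonnegative multiple of the
  -- trace
  have hc : 0 ≤ (Q - K.length) / 2 ^ S.msgLen n + (Q - K.length) * ε' +
      (1 - v) * (K.length / 2 ^ S.msgLen n) :=
    add_nonneg (add_nonneg (div_nonneg hQ' (by positivity)) (mul_nonneg hQ' hε'))
      (mul_nonneg hv1 (by positivity))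
  have ht : PosForm fun r => (((Q - K.length) / 2 ^ S.msgLen n + (Q - K.length) * ε' +
      (1 - v) * (K.length / 2 ^ S.msgLen n) : ℝ) : ℂ) * r.tr :=
    posForm_tr (by rw [Complex.ofReal_re]; exact hc)
  refine (((((hA.mul hv0).add (hm.mul hv1)).add (hk.mul hv1)).add (hP.mul hv0)).add
    (hs.add ht)).congr fun r _ => ?_
  simp only [Finset.sum_sub_distrib, Finset.sum_add_distrib, Finset.sum_const,
    Finset.card_range, nsmul_eq_mul, ← Finset.mul_sum]
  push_cast
  ring

end SKL

namespace SKL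
open scoped ComplexOrder

variable {S : DSSKL} {D : DigSig}

theorem posForm_winAll_nonneg (hS : S.Efficient) (n : ℕ) (vk : Data) (ε : ℝ) (a : Data)
    (K : List Data) (o : Data) : PosForm fun r => winAll S D n vk ε ⟨a, K, o, r⟩ := by
  have h := (hS.isDist_vrfyAll n (K.map fun e => e.snd.snd) o.fst.toList).prTrue_nonneg
  simp only [winAll]
  generalize (S.vrfyAll n (K.map fun e => e.snd.snd) o.fst.toList).prTrue = v at *
  generalize (QProgram.ofData o.snd).effect (S.msgLen n)
    (fun m y => ((compile S D).sigVrfy n vk m y).prTrue) = E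
  exact (posForm_matForm (M := fun N => spectralProj (E N) (0 + ε))
    fun _ => posSemidef_spectralProj _ _).mul h

theorem posForm_win_nonneg (hS : S.Efficient) (n : ℕ) (ε : ℝ) (a : Data)
    (K : List Data) (o : Data) (i : ℕ) : PosForm fun r => win S n ε ⟨a, K, o, r⟩ i := by
  have h := (hS.isDist_vrfy n (K.getD i .nil).snd.snd (o.fst.toList.getD i .nil)).prTrue_nonneg
  simp only [win]
  generalize (S.vrfy n (K.getD i .nil).snd.snd (o.fst.toList.getD i .nil)).prTrue = v at *
  generalize (QProgram.ofData o.snd.shave).effect (S.msgLen n)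
    (fun m y => (S.sigVrfy n (K.getD i .nil).snd.fst m y).prTrue) = E
  exact (posForm_matForm (M := fun N => spectralProj (E N) (0 + ε))
    fun _ => posSemidef_spectralProj _ _).mul h

theorem Wt.IsDist.re_ex {α : Type} {x : Wt α} (hx : x.IsDist) (φ : α → ℂ) :
    (x.ex φ).re = (x.ex fun a => ((φ a).re : ℂ)).re := by
  rw [ex_eq_sum, ex_eq_sum, Complex.re_sum, Complex.re_sum]
  refine Finset.sum_congr rfl fun a _ => ?_
  simp [Complex.mul_re, hx.im_eq_zero]

theorem ex_ex_ex_comm {α : Type} (x : Wt α) (u : Wt (List Bool)) (φ : α → Reg → ℂ) :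
    (u.ex fun k => u.conj.ex fun b => x.ex fun a => φ a ⟨k, b⟩) =
      x.ex fun a => u.ex fun k => u.conj.ex fun b => φ a ⟨k, b⟩ := by
  rw [Wt.ex_comm x u]
  refine congrArg _ (funext fun k => ?_)
  rw [Wt.ex_comm]

theorem PosForm.ex {α : Type} {x : Wt α} (hx : x.IsDist) {φ : α → Reg → ℂ}
    (hφ : ∀ a, PosForm (φ a)) : PosForm fun r => x.ex fun a => φ a r := by
  intro N u hu
  rw [ex_ex_ex_comm]
  exact hx.ex_re_nonneg fun a _ => hφ a N u hu

/-- A random place is the right one with inverse polynomial probability. -/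
theorem posForm_pick {φ : ℕ → Reg → ℂ} (hφ : ∀ i, PosForm (φ i)) {q Q : ℕ} (hq : q ≤ Q) :
    PosForm fun r => ((2 * Q ^ 2 : ℝ) : ℂ) * ((pick q).ex fun j => φ (q - 1 - j) r) -
      ∑ i ∈ Finset.range q, φ i r := by
  intro N u hu
  set W : ℕ → ℝ := fun i => (u.ex fun k => u.conj.ex fun b => φ i ⟨k, b⟩).re with hW
  have hW0 : ∀ i, 0 ≤ W i := fun i => hφ i N u hu
  have h1 : (u.ex fun k => u.conj.ex fun b => (pick q).ex fun j => φ (q - 1 - j) ⟨k, b⟩).re =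
      ((pick q).ex fun j => (W (q - 1 - j) : ℂ)).re := by
    rw [ex_ex_ex_comm (pick q) u fun j => φ (q - 1 - j), (isDist_pick q).re_ex]
  simp only [Wt.ex_sub_right, Wt.ex_mul_left, Wt.ex_sum_right, Complex.sub_re, Complex.re_sum,
    Complex.re_ofReal_mul, h1]
  have hB : 0 ≤ ((pick q).ex fun j => (W (q - 1 - j) : ℂ)).re :=
    (isDist_pick q).ex_re_nonneg fun j _ => by simpa using hW0 _
  set B := ((pick q).ex fun j => (W (q - 1 - j) : ℂ)).re
  have h2 : ∀ i ∈ Finset.range q, W i ≤ 2 * Q * B := by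
    intro i hi
    rw [Finset.mem_range] at hi
    have h3 := pick_prob (q := q) (j := q - 1 - i) (by omega) (fun j => W (q - 1 - j)) fun _ => hW0 _
    simp only [show q - 1 - (q - 1 - i) = i by omega] at h3
    have hq0 : (0 : ℝ) < 2 * q := by
      have : (0 : ℝ) < q := Nat.cast_pos.2 (by omega)
      linarith
    rw [div_le_iff₀ hq0] at h3
    have hqQ : (q : ℝ) ≤ Q := Nat.cast_le.2 hq
    change W i ≤ B * (2 * q) at h3
    nlinarith
  have h4 := Finset.sum_le_sum h2
  rw [Finset.sum_const, Finset.card_range, nsmul_eq_mul] at h4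
  have hqQ : (q : ℝ) ≤ Q := Nat.cast_le.2 hq
  have h5 : (q : ℝ) * (2 * Q * B) ≤ Q * (2 * Q * B) :=
    mul_le_mul_of_nonneg_right hqQ (by positivity)
  change 0 ≤ 2 * (Q : ℝ) ^ 2 * B - ∑ i ∈ Finset.range q, W i
  nlinarith

theorem prTrue_stdKLAExp_compile (hS : S.Efficient) (A : KLAdversary) (ε : ℝ) (n : ℕ) :
    ((compile S D).stdKLAExp none A ε n).prTrue = ((D.gen n).ex fun k =>
      (attack S A (fun d => d) (D.sign n k.1) (.ofNat n) k.2).ex (winAll S D n k.2 ε)).re := by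
  rw [Wt.prTrue_eq, ex_stdKLAExp_compile]
  refine congrArg Complex.re (congrArg _ (funext fun k => congrArg _ (funext fun t => ?_)))
  rw [ex_and (hS.isDist_vrfyAll _ _ _), ex_goodTest]
  rfl

theorem prTrue_stdKLAExp_compile_nonneg (hS : S.Efficient) (hD : D.Efficient) (A : KLAdversary)
    (ε : ℝ) (n : ℕ) : 0 ≤ ((compile S D).stdKLAExp none A ε n).prTrue := by
  rw [prTrue_stdKLAExp_compile hS]
  exact (hD.isDist_gen n).ex_re_nonneg fun k _ =>
    attack_re_nonneg hS hD A Det.id n k.1 k.2 fun a K o _ _ => posForm_winAll_nonneg hS _ _ _ _ _ _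

/-- If `A` asks for no key, a key is leased nevertheless in the attack on a single instance. -/
theorem ex_attack_nonempty (A : KLAdversary) (sg : Data → Wt Data) (ν vk : Data)
    (φ : Transcript → ℂ) (hφ : ∀ t, t.keys = [] → φ t = 0) :
    ((attack S A (fun d => d) sg ν vk).ex φ) =
      (attack S A Data.nonempty sg ν vk).ex fun t => if t.a.fst.len = 0 then 0 else φ t := by
  simp only [attack, Wt.ex_bind, Wt.ex_pure]
  refine congrArg _ (funext fun x => ?_)
  by_cases hx : x.1.fst.len = 0
  · simp [hx, entries, hφ]
  · have : x.1.fst.nonempty.len = x.1.fst.len := by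
      rw [Data.len_nonempty]
      omega
    simp [hx, this]

/-- The success probability of the attack on the compiled scheme in terms of those of both forgers
and of the attack on a single instance. -/
theorem prTrue_stdKLAExp_compile_le (hS : S.Efficient) (hD : D.Efficient) (A : KLAdversary)
    (ε : ℝ) {ε' : ℝ} (hε' : 0 ≤ ε') (n Q : ℕ) (hQ : ∀ k ∈ (D.gen n).supp,
      ∀ x ∈ (A.first.exec (.node (.ofNat n) k.2) .empty).supp, x.1.fst.len ≤ Q) :
    ε * ((compile S D).stdKLAExp none A ε n).prTrue ≤
      ((D.gen n).ex fun k => (attack S A (fun d => d) (D.sign n k.1) (.ofNat n) k.2).ex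
        (winMessage S D n k.2)).re +
      ((D.gen n).ex fun k => (attack S A (fun d => d) (D.sign n k.1) (.ofNat n) k.2).ex
        (winKey S D n k.2)).re + (Q / 2 ^ S.msgLen n + Q * ε') +
      2 * Q ^ 2 * ((D.gen n).ex fun k =>
        (attack S A Data.nonempty (D.sign n k.1) (.ofNat n) k.2).ex fun t =>
          (pick t.a.fst.nonempty.len).ex fun j => win S n ε' t (t.a.fst.nonempty.len - 1 - j)).re := by
  rw [prTrue_stdKLAExp_compile hS]
  have hgen := hD.isDist_gen n
  have h := hgen.ex_re_le
    (φ := fun k => ε * (attack S A (fun d => d) (D.sign n k.1) (.ofNat n) k.2).ex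
      (winAll S D n k.2 ε))
    (ψ := fun k => (attack S A (fun d => d) (D.sign n k.1) (.ofNat n) k.2).ex (winMessage S D n k.2) +
      (attack S A (fun d => d) (D.sign n k.1) (.ofNat n) k.2).ex (winKey S D n k.2) +
      ((Q / 2 ^ S.msgLen n + Q * ε' : ℝ) : ℂ) * 1 + ((2 * Q ^ 2 : ℝ) : ℂ) *
      (attack S A Data.nonempty (D.sign n k.1) (.ofNat n) k.2).ex fun t =>
          (pick t.a.fst.nonempty.len).ex fun j => win S n ε' t (t.a.fst.nonempty.len - 1 - j)) ?_
  · simp only [Wt.ex_add_right, Wt.ex_mul_left, hgen.total, Complex.add_re, Complex.re_ofReal_mul,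
      Complex.one_re] at h
    simpa only [mul_one] using h
  intro k hk
  -- both inequalities between observables, in expectation over the attack with `H = id`, and with at
  -- least one leased key
  have h1 := attack_re_nonneg hS hD A Det.id n k.1 k.2 (φ := fun t => winMessage S D n k.2 t +
    winKey S D n k.2 t + ((Q / 2 ^ S.msgLen n + Q * ε' : ℝ) : ℂ) * t.reg.tr +
    (∑ i ∈ Finset.range t.keys.length, win S n ε' t i) - ε * winAll S D n k.2 ε t)
    fun a K o ⟨r, hr⟩ hK => posForm_winAll hS hD n k.2 hε' a K o (hK ▸ hQ k hk _ hr)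
  have h2 := attack_re_nonneg hS hD A (H := Data.nonempty) Det.id.nonempty n k.1 k.2
    (φ := fun t => ((2 * Q ^ 2 : ℝ) : ℂ) * ((pick t.a.fst.nonempty.len).ex fun j =>
      win S n ε' t (t.a.fst.nonempty.len - 1 - j)) - if t.a.fst.len = 0 then 0 else
        ∑ i ∈ Finset.range t.keys.length, win S n ε' t i) fun a K o ⟨r, hr⟩ hK => by
      have hp := fun i => posForm_win_nonneg hS n ε' a K o i
      by_cases ha : a.fst.len = 0
      · simp only [ha, if_true, sub_zero]
        exact (PosForm.ex (isDist_pick _) fun j => hp _).mul (by positivity)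
      · simp only [ha, if_false]
        rw [hK]
        refine posForm_pick hp ?_
        rw [Data.len_nonempty]
        have : a.fst.len ≤ Q := hQ k hk _ hr
        omega
  rw [Wt.ex_sub_right, ← ex_attack_nonempty A _ _ _ (fun t => ∑ i ∈ Finset.range t.keys.length, win S n ε' t i)
    fun t ht => by simp [ht]] at h2
  simp only [Wt.ex_sub_right, Wt.ex_add_right, Wt.ex_mul_left, attack_tr hS hD A Det.id,
    Complex.sub_re, Complex.add_re] at h1 h2 ⊢
  linarith

end SKL

namespace SKL
open Filter Topology

/-! ### Asymptotics -/

variable {S : DSSKL} {D : DigSig}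

theorem Negligible.add {f g : ℕ → ℝ} (hf : Negligible f) (hg : Negligible g) :
    Negligible fun n => f n + g n :=
  Asymptotics.SuperpolynomialDecay.add hf hg

theorem Negligible.polynomial_mul {f : ℕ → ℝ} (hf : Negligible f) (p : ℕ[X]) :
    Negligible fun n => ((p.eval n : ℕ) : ℝ) * f n := by
  have h := Asymptotics.SuperpolynomialDecay.polynomial_mul hf (p.map (Nat.castRingHom ℝ))
  refine h.congr fun n => ?_
  rw [Polynomial.eval_natCast_map]
  rfl

/-- The number of keys that an adversary asks for is bounded by a polynomial. -/
theorem exists_bound_keys (hD : D.Efficient) (A : KLAdversary) : ∃ Q : ℕ[X], ∀ n,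
    ∀ k ∈ (D.gen n).supp, ∀ x ∈ (A.first.exec (.node (.ofNat n) k.2) .empty).supp,
      x.1.fst.len ≤ Q.eval n := by
  obtain ⟨P, ⟨p, hp⟩, h⟩ := hD.gen
  obtain ⟨p', hp'⟩ := A.first_polyTime
  refine ⟨p'.comp (Polynomial.X + p + 1), fun n k hk x hx => ?_⟩
  have h1 : Data.node k.1 k.2 ∈ (P.run (.ofNat n) .empty).supp := by
    rw [h, Wt.mem_supp, Wt.coeff_map (f := fun k : Data × Data => Data.node k.1 k.2)]
    · exact Wt.mem_supp.1 hk
    · rintro ⟨a, b⟩ ⟨c, d⟩ h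
      simpa using h
  obtain ⟨y, hy, h1⟩ := Wt.exists_of_mem_supp_bind h1
  obtain ⟨o, ho, rfl⟩ := mem_supp_exec hy
  obtain ⟨_, _, h1⟩ := Wt.exists_of_mem_supp_bind h1
  rw [Wt.mem_supp_pure] at h1
  have h2 := (P.bounds_of_mem_supp_eval _ _ _ Reg.square_empty o ho).2.1.trans
    (hp _ _ Reg.square_empty o ho)
  obtain ⟨o', ho', rfl⟩ := mem_supp_exec hx
  have h3 := (A.first.bounds_of_mem_supp_eval _ _ _ Reg.square_empty o' ho').2.1.trans
    (hp' _ _ Reg.square_empty o' ho')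
  change Data.node k.1 k.2 = o.data at h1
  simp only [← h1, Data.size, Data.size_ofNat, Reg.len_empty, add_zero] at h2 h3
  refine (((Data.len_le_size _).trans (Data.size_fst_le _)).trans h3).trans ?_
  rw [Polynomial.eval_comp]
  refine eval_mono p' ?_
  simp only [Polynomial.eval_add, Polynomial.eval_X, Polynomial.eval_one]
  omega

end SKL

theorem mainTheorem3 (S : SKL.DSSKL) (D : SKL.DigSig)
    (hS : S.Efficient) (hD : D.Efficient)
    (hmsg : SKL.Negligible fun n => 1 / (2 : ℝ) ^ S.msgLen n)
    (hKLA : S.BoundedStdKLA fun _ => 1)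
    (hPQ : D.PostQuantum) :
    (SKL.compile S D).UnboundedStdKLA := by
  intro A P hP
  obtain ⟨Q, hQ⟩ := SKL.exists_bound_keys hD A
  obtain ⟨B₁, hB₁⟩ := SKL.exists_forger_message hS hD A
  obtain ⟨B₂, hB₂⟩ := SKL.exists_forger_key hS hD A
  obtain ⟨B, hB⟩ := SKL.exists_reduction hS hD A
  -- There is no threshold for the single instance that works for all exponents: `n ^ k * P * Q / p`
  -- has to tend to zero, and `p` has to be a polynomial.
  intro k
  set p : Polynomial ℕ := P * (Q + 1) * (Polynomial.X + 1) ^ (k + 1) with hp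
  have hp0 : ∀ n, 0 < p.eval n := fun n => by
    simp only [hp, Polynomial.eval_mul, Polynomial.eval_add, Polynomial.eval_one,
      Polynomial.eval_pow, Polynomial.eval_X]
    have := hP n
    positivity
  have hneg := ((((hPQ B₁).add (hPQ B₂)).add (hmsg.polynomial_mul Q)).add
    ((hKLA B p hp0).polynomial_mul (2 * Q ^ 2))).polynomial_mul P
  have hlim := (hneg k).add (tendsto_one_div_add_atTop_nhds_zero_nat (𝕜 := ℝ))
  rw [add_zero] at hlim
  refine squeeze_zero (fun n => mul_nonneg (by positivity)
    (SKL.prTrue_stdKLAExp_compile_nonneg hS hD A _ n)) (fun n => ?_) hlim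
  beta_reduce
  have hPn : (0 : ℝ) < (P.eval n : ℕ) := Nat.cast_pos.2 (hP n)
  have hpn : (0 : ℝ) < (p.eval n : ℕ) := Nat.cast_pos.2 (hp0 n)
  have h := SKL.prTrue_stdKLAExp_compile_le hS hD A (1 / ((P.eval n : ℕ) : ℝ))
    (ε' := 1 / ((p.eval n : ℕ) : ℝ)) (by positivity) n (Q.eval n) (hQ n)
  have h1 := hB₁ n
  have h2 := hB₂ n
  have h3 := hB (1 / ((p.eval n : ℕ) : ℝ)) n
  change _ = ((D.gen n).ex fun k => (SKL.attack S A (fun d => d) (D.sign n k.1) (.ofNat n) k.2).ex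
    (SKL.winMessage S D n k.2)).re at h1
  change _ = ((D.gen n).ex fun k => (SKL.attack S A (fun d => d) (D.sign n k.1) (.ofNat n) k.2).ex
    (SKL.winKey S D n k.2)).re at h2
  rw [← h1, ← h2, ← h3] at h
  clear h1 h2 h3
  generalize ((SKL.compile S D).stdKLAExp none A (1 / ((P.eval n : ℕ) : ℝ)) n).prTrue = x at h ⊢
  generalize (S.stdKLAExp (some fun _ => 1) B (1 / ((p.eval n : ℕ) : ℝ)) n).prTrue = e at h ⊢
  have hQ2 : (((2 * Q ^ 2 : Polynomial ℕ).eval n : ℕ) : ℝ) = 2 * ((Q.eval n : ℕ) : ℝ) ^ 2 := by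
    simp [Polynomial.eval_mul, Polynomial.eval_pow]
  have hpe : ((p.eval n : ℕ) : ℝ) = ((P.eval n : ℕ) : ℝ) * (((Q.eval n : ℕ) : ℝ) + 1) * (n + 1) ^ (k + 1) := by
    simp [hp]
  rw [hQ2]
  have hsmall : (n : ℝ) ^ k * (((P.eval n : ℕ) : ℝ) * (((Q.eval n : ℕ) : ℝ) * (1 / ((p.eval n : ℕ) : ℝ)))) ≤ 1 / (n + 1) := by
    have hn : (0 : ℝ) < n + 1 := by positivity
    rw [hpe, mul_one_div, mul_div_assoc', mul_div_assoc', div_le_div_iff₀ (by positivity) hn]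
    have h4 : (n : ℝ) ^ k ≤ (n + 1) ^ k := by gcongr; linarith
    have h5 : ((Q.eval n : ℕ) : ℝ) ≤ ((Q.eval n : ℕ) : ℝ) + 1 := by linarith
    calc (n : ℝ) ^ k * (((P.eval n : ℕ) : ℝ) * ((Q.eval n : ℕ) : ℝ)) * (n + 1)
        ≤ (n + 1) ^ k * (((P.eval n : ℕ) : ℝ) * (((Q.eval n : ℕ) : ℝ) + 1)) * (n + 1) := by gcongr
      _ = 1 * (((P.eval n : ℕ) : ℝ) * (((Q.eval n : ℕ) : ℝ) + 1) * (n + 1) ^ (k + 1)) := by ring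
  have hx : x ≤ ((P.eval n : ℕ) : ℝ) * ((D.forgeExp B₁ n).prTrue + (D.forgeExp B₂ n).prTrue +
      ((Q.eval n : ℕ) : ℝ) * (1 / 2 ^ S.msgLen n) + 2 * ((Q.eval n : ℕ) : ℝ) ^ 2 * e) +
      ((P.eval n : ℕ) : ℝ) * (((Q.eval n : ℕ) : ℝ) * (1 / ((p.eval n : ℕ) : ℝ))) := by
    rw [one_div_mul_eq_div, div_le_iff₀ hPn] at h
    refine h.trans_eq ?_
    ring
  have hnk : (0 : ℝ) ≤ (n : ℝ) ^ k := by positivity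
  have h6 := mul_le_mul_of_nonneg_left hx hnk
  rw [mul_add] at h6
  linarith
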